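/- Let $A$ be a finite set and let $\varphi:A^k\to A$ be an operation with $k\ge 3$ that is a generalized majority-minority operation, i.e., for all $a,b\in A$ either $$\varphi(x,y,\dots,y)=\varphi(y,x,\dots,y)=\cdots=\varphi(y,y,\dots,x)=y\quad\text{for all }x,y\in\{a,b\},$$ or $$\varphi(x,y,\dots,y)=\varphi(y,y,\dots,x)=x\quad\text{for all }x,y\in\{a,b\}$$ (in the second case only the tuples with $x$ in the first or in the last position are meant). Let $\operatorname{Inv}(\varphi)$ be the set of all finitary relations $R$ on $A$ that are invariant under $\varphi$, i.e., whenever $\mathbf t_1,\dots,\mathbf t_k\in R$, the tuple obtained by applying $\varphi$ to them coordinatewise is in $R$. Then $\operatorname{CSP}(\operatorname{Inv}(\varphi))$ is solvable in polynomial time. That is, there is a deterministic Turing machine (depending on $A$ and $\varphi$) which, given a finite set of variables $V$ and a finite list of constraints, each consisting of a tuple of variables $(v_{i_1},\dots,v_{i_r})$ and an $r$-ary relation $S\in\operatorname{Inv}(\varphi)$ written explicitly as a list of its tuples (the arity $r$ is not bounded in advance), decides, in time polynomial in the length of this input, whether there is a map $s:V\to A$ such that $(s(v_{i_1}),\dots,s(v_{i_r}))\in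 S$ for every constraint. -/

import Mathlib

namespace GMMCSP

/-- Relations (of any finite arity) on `A`. -/
abbrev Relation (A : Type) : Type := Σ n : ℕ, Set (Fin n → A)

/-- The relation `R` is invariant under the `k`-ary operation `φ`, applied coordinatewise to
`k` (not necessarily different) tuples of `R`. -/
def Invariant {A : Type} {k n : ℕ} (φ : (Fin k → A) → A) (R : Set (Fin n → A)) : Prop :=
  ∀ t : Fin k → (Fin n → A), (∀ i, t i ∈ R) → (fun j => φ (fun i => t i j)) ∈ R

/-- `Inv φ`: the set of all relations on `A` invariant under `φ`. -/
def Inv {A : Type} {k : ℕ} (φ : (Fin k → A) → A) : Set (Relation A) :=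
  {R | Invariant φ R.2}

/-- `single i x y` is the tuple `(y, …, y, x, y, …, y)` with `x` at position `i`. -/
def single {A : Type} {k : ℕ} (i : Fin k) (x y : A) : Fin k → A :=
  Function.update (fun _ => y) i x

/-- `φ (x, y, …, y) = φ (y, x, …, y) = ⋯ = φ (y, y, …, x) = y` for all `x, y ∈ {a, b}`. -/
def IsMajorityPair {A : Type} {k : ℕ} (φ : (Fin k → A) → A) (a b : A) : Prop :=
  ∀ x ∈ ({a, b} : Set A), ∀ y ∈ ({a, b} : Set A), ∀ i : Fin k, φ (single i x y) = y

/-- `φ (x, y, …, y) = φ (y, y, …, x) = x` for all `x, y ∈ {a, b}`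
(`x` in the first position and in the last position only). -/
def IsMinorityPair {A : Type} {k : ℕ} (φ : (Fin k → A) → A) (a b : A) : Prop :=
  ∀ x ∈ ({a, b} : Set A), ∀ y ∈ ({a, b} : Set A), ∀ i : Fin k,
    ((i : ℕ) = 0 ∨ (i : ℕ) + 1 = k) → φ (single i x y) = x

/-- Generalized majority-minority operations. -/
def IsGMM {A : Type} {k : ℕ} (φ : (Fin k → A) → A) : Prop :=
  3 ≤ k ∧ ∀ a b : A, IsMajorityPair φ a b ∨ IsMinorityPair φ a b

/-- A constraint over the variables `Fin n`: a scope, and a constraint relation of the same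
arity given explicitly as a list of tuples (in any order, repetitions allowed). -/
structure Constraint (A : Type) (n : ℕ) where
  arity : ℕ
  scope : Fin arity → Fin n
  tuples : List (Fin arity → A)

/-- The constraint relation. -/
def Constraint.relation {A : Type} {n : ℕ} (C : Constraint A n) : Relation A :=
  ⟨C.arity, {t | t ∈ C.tuples}⟩

/-- A constraint satisfaction instance with domain `A`. -/
structure Instance (A : Type) where
  numVars : ℕ
  constraints : List (Constraint A numVars)

/-- `s` is a solution: it maps every constraint scope into the constraint relation. -/
def Instance.IsSolution {A : Type} (P : Instance A) (s : Fin P.numVars → A) : Prop :=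
  ∀ C ∈ P.constraints, (fun j => s (C.scope j)) ∈ C.relation.2

def Instance.HasSolution {A : Type} (P : Instance A) : Prop :=
  ∃ s : Fin P.numVars → A, P.IsSolution s

/-- The instances of `CSP(Γ)`: all constraint relations are elements of `Γ`. -/
abbrev CSP {A : Type} (Γ : Set (Relation A)) : Type :=
  {P : Instance A // ∀ C ∈ P.constraints, C.relation ∈ Γ}

/-- The input alphabet for instances with domain `A`. -/
inductive Symbol (A : Type) where
  | tick : Symbol A
  | newConstraint : Symbol A
  | newVar : Symbol A
  | newTuple : Symbol A
  | val : A → Symbol A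

/-- A constraint is written as a marker, the entries of its scope (a marker and the index of the
variable in unary), and then its tuples (a marker and the entries of the tuple). -/
def Constraint.encode {A : Type} {n : ℕ} (C : Constraint A n) : List (Symbol A) :=
  Symbol.newConstraint ::
    ((List.ofFn C.scope).flatMap
        (fun i => Symbol.newVar :: List.replicate (i : ℕ) Symbol.tick) ++
      C.tuples.flatMap (fun t => Symbol.newTuple :: (List.ofFn t).map Symbol.val))

/-- An instance is written as one tick for each variable, followed by its constraints.
As the variables are listed, a word of this encoding is at most quadratically longer than
with the indices of the variables written in binary. -/
def Instance.encode {A : Type} (P : Instance A) : List (Symbol A) :=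
  List.replicate P.numVars Symbol.tick ++ P.constraints.flatMap Constraint.encode

open Classical in
/-- `CSP(Γ)` is solvable in polynomial time: some (multi-stack) Turing machine, started on the
encoding of any instance of `CSP(Γ)`, halts after a number of steps that is polynomially bounded
in the length of the encoding, with output `true` if the instance has a solution and `false` if it
has none. -/
def SolvableInPolyTime {A : Type} (Γ : Set (Relation A)) : Prop :=
  Nonempty (Turing.TM2ComputableInPolyTime
    (fun P : CSP Γ => P.1.encode) Computability.encodeBool
    (fun P : CSP Γ => decide P.1.HasSolution))

end GMMCSP

/-! The solutions of an instance are the tuples of one large relation: take the product of a copy of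
`A` for each variable and of all constraint relations, and require that every coordinate equals the
coordinate of its variable. The product can be exponentially large, so each invariant relation `R`
met on the way is stored through a small subset `U`. `Represents` asks that `U` has the same
projections as `R` to at most `k - 1` coordinates and that it realizes every fork of `R`: if two
tuples of `R` agree before `i` and take at `i` values `a`, `b` that are not a majority pair, then so
do two tuples of `U`.

Two terms make this work. `selectTerm`, d(x, y) = φ(y, x, …, x), is x on majority pairs and y on
minority pairs; `forkTerm`, f, satisfies f(x, y, y) = x always and f(x, x, y) = y on minority pairs.
Inside any closed set containing `U`, a tuple of `R` is approximated coordinate by coordinate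
(`Represents.subset_of_closed`): at a majority pair a near-unanimity argument extends the agreement
(`Represents.exists_agree_of_majority`), at a minority pair f transfers the change of value from a
fork in `U`. So `U` generates `R`, and by counting, the projections to boundedly many coordinates
are complete after a constant number of rounds of applying φ (`Represents.exists_agree`). This
yields representations after fixing a coordinate, imposing an equation, or multiplying by a relation
(`Represents.fix`, `Represents.equalizer`, `Represents.concat`). `ListRepresents.compress` thins
each of them to a size polynomial in the number of coordinates alone, so iteration does not blow up.
At the end, the relation is nonempty exactly if its representation is (`solve_iff`,
`decideInstance_iff`).

For the running time, while-programs on stacks are translated to Turing machines (`Exec.stepsTo`),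
data are coded by binary trees, and `PolyTime` is shown to be closed under composition, case
distinction, and folds with polynomially bounded intermediate values (`PolyTime.foldl`). The
algorithm is a Lean function whose `PolyTime` proof follows its definition. -/

namespace StackProgram

/-! ### While-programs on stacks and their translation to Turing machines. -/

open Turing Function

/-- While-programs acting on stacks of Booleans indexed by natural numbers. -/
inductive Cmd
  | skip
  | push (k : ℕ) (a : Bool)
  | seq (c d : Cmd)
  /-- Pop stack `k`, and continue according to whether it was empty or gave `true` or `false`. -/
  | popCase (k : ℕ) (e c d : Cmd)
  /-- While popping stack `k` gives `true` (or `false`), run `c` (or `d`). -/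
  | loop (k : ℕ) (c d : Cmd)

abbrev Store := ℕ → List Bool

/-- `Exec c S t S'`: the program `c` started in `S` halts in `S'` after `t` steps. -/
inductive Exec : Cmd → Store → ℕ → Store → Prop
  | skip {S} : Exec .skip S 1 S
  | push {k a S} : Exec (.push k a) S 1 (update S k (a :: S k))
  | seq {c d S t S' t' S''} : Exec c S t S' → Exec d S' t' S'' → Exec (.seq c d) S (t + t') S''
  | pop_nil {k e c d S t S'} : S k = [] → Exec e S t S' → Exec (.popCase k e c d) S (t + 1) S'
  | pop_true {k e c d S t S' l} : S k = true :: l → Exec c (update S k l) t S' →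
      Exec (.popCase k e c d) S (t + 1) S'
  | pop_false {k e c d S t S' l} : S k = false :: l → Exec d (update S k l) t S' →
      Exec (.popCase k e c d) S (t + 1) S'
  | loop_nil {k c d S} : S k = [] → Exec (.loop k c d) S 1 S
  | loop_true {k c d S t S' t' S'' l} : S k = true :: l → Exec c (update S k l) t S' →
      Exec (.loop k c d) S' t' S'' → Exec (.loop k c d) S (t + t' + 1) S''
  | loop_false {k c d S t S' t' S'' l} : S k = false :: l → Exec d (update S k l) t S' →
      Exec (.loop k c d) S' t' S'' → Exec (.loop k c d) S (t + t' + 1) S''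

/-- A step pushes at most one letter. All bounds for the size of outputs come from here: a
polynomial running time forces a polynomially long output. -/
theorem Exec.length_le {c : Cmd} {S S' : Store} {t : ℕ} (h : Exec c S t S') (j : ℕ) :
    (S' j).length ≤ (S j).length + t := by
  induction h with
  | skip => simp
  | @push k a S =>
    by_cases hj : j = k
    · subst hj; simp
    · simp [hj]
  | seq _ _ ih1 ih2 => omega
  | pop_nil _ _ ih => omega
  | @pop_true k e c d S t S' l hS _ ih | @pop_false k e c d S t S' l hS _ ih =>
    by_cases hj : j = k
    · subst hj; simp [hS] at ih ⊢; omega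
    · simp [hj] at ih; omega
  | loop_nil _ => simp
  | @loop_true k c d S t S' t' S'' l hS _ _ ih ih' | @loop_false k c d S t S' t' S'' l hS _ _ ih ih' =>
    by_cases hj : j = k
    · subst hj; simp [hS] at ih ⊢; omega
    · simp [hj] at ih; omega

namespace Cmd

/-- A strict bound for the indices of the stacks used by a program. -/
def width : Cmd → ℕ
  | skip => 0
  | push k _ => k + 1
  | seq c d => max c.width d.width
  | popCase k e c d => max (k + 1) (max e.width (max c.width d.width))
  | loop k c d => max (k + 1) (max c.width d.width)

/-- The labels of the machine for a program. -/
def Label : Cmd → Type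
  | skip => Unit
  | push _ _ => Unit
  | seq c d => c.Label ⊕ d.Label
  | popCase _ e c d => Option (e.Label ⊕ c.Label ⊕ d.Label)
  | loop _ c d => Option (c.Label ⊕ d.Label)

instance Label.finite : (c : Cmd) → Finite c.Label
  | skip => inferInstanceAs (Finite Unit)
  | push _ _ => inferInstanceAs (Finite Unit)
  | seq c d =>
    have := Label.finite c
    have := Label.finite d
    inferInstanceAs (Finite (c.Label ⊕ d.Label))
  | popCase _ e c d =>
    have := Label.finite e
    have := Label.finite c
    have := Label.finite d
    inferInstanceAs (Finite (Option (e.Label ⊕ c.Label ⊕ d.Label)))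
  | loop _ c d =>
    have := Label.finite c
    have := Label.finite d
    inferInstanceAs (Finite (Option (c.Label ⊕ d.Label)))

def entry : (c : Cmd) → c.Label
  | skip => ()
  | push _ _ => ()
  | seq c _ => Sum.inl c.entry
  | popCase _ _ _ _ => (none : Option _)
  | loop _ _ _ => (none : Option _)

end Cmd

/-- The stack alphabets: an input stack, and `n + 1` stacks of Booleans. -/
abbrev Alphabet (I : Type) (n : ℕ) : Option (Fin (n + 1)) → Type
  | none => I
  | some _ => Bool

/-- The stack of Booleans with index `k`. -/
def stackIndex (n k : ℕ) : Fin (n + 1) := Fin.ofNat (n + 1) k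

theorem val_stackIndex {n k : ℕ} (hk : k < n + 1) : (stackIndex n k : ℕ) = k :=
  Nat.mod_eq_of_lt hk

/-- The internal states: the symbols popped last. -/
abbrev Register (I : Type) : Type := Option Bool × Option I

variable {I : Type} {n : ℕ} {Λ : Type}

/-- The statement of the machine for a program at a label. -/
def Cmd.stmt : (c : Cmd) → (c.Label → Λ) → Λ → c.Label → TM2.Stmt (Alphabet I n) Λ (Register I)
  | .skip, _, exit, _ => .goto fun _ => exit
  | .push k a, _, exit, _ =>
    .push (some (stackIndex n k)) (fun _ => a) (.goto fun _ => exit)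
  | .seq c d, emb, exit, l =>
    match (l : c.Label ⊕ d.Label) with
    | .inl l => c.stmt (fun l => emb (Sum.inl l : c.Label ⊕ d.Label))
        (emb (Sum.inr d.entry : c.Label ⊕ d.Label)) l
    | .inr l => d.stmt (fun l => emb (Sum.inr l : c.Label ⊕ d.Label)) exit l
  | .popCase k e c d, emb, exit, l =>
    match (l : Option (e.Label ⊕ c.Label ⊕ d.Label)) with
    | none => .pop (some (stackIndex n k)) (fun s a => (a, s.2))
        (.goto fun s => emb (match s.1 with
          | none => (some (.inl e.entry) : Option (e.Label ⊕ c.Label ⊕ d.Label))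
          | some true => (some (.inr (.inl c.entry)) : Option (e.Label ⊕ c.Label ⊕ d.Label))
          | some false => (some (.inr (.inr d.entry)) : Option (e.Label ⊕ c.Label ⊕ d.Label))))
    | some (.inl l) =>
      e.stmt (fun l => emb (some (.inl l) : Option (e.Label ⊕ c.Label ⊕ d.Label))) exit l
    | some (.inr (.inl l)) =>
      c.stmt (fun l => emb (some (.inr (.inl l)) : Option (e.Label ⊕ c.Label ⊕ d.Label))) exit l
    | some (.inr (.inr l)) =>
      d.stmt (fun l => emb (some (.inr (.inr l)) : Option (e.Label ⊕ c.Label ⊕ d.Label))) exit l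
  | .loop k c d, emb, exit, l =>
    match (l : Option (c.Label ⊕ d.Label)) with
    | none => .pop (some (stackIndex n k)) (fun s a => (a, s.2))
        (.goto fun s => match s.1 with
          | none => exit
          | some true => emb (some (.inl c.entry) : Option (c.Label ⊕ d.Label))
          | some false => emb (some (.inr d.entry) : Option (c.Label ⊕ d.Label)))
    | some (.inl l) =>
      c.stmt (fun l => emb (some (.inl l) : Option (c.Label ⊕ d.Label)))
        (emb (none : Option (c.Label ⊕ d.Label))) l
    | some (.inr l) =>
      d.stmt (fun l => emb (some (.inr l) : Option (c.Label ⊕ d.Label)))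
        (emb (none : Option (c.Label ⊕ d.Label))) l

/-- The stacks of the machine for a store, with an empty input stack. -/
def toStacks (I : Type) (n : ℕ) (S : Store) : ∀ k, List (Alphabet I n k)
  | none => []
  | some i => S i

theorem toStacks_update (S : Store) {k : ℕ} (hk : k < n + 1) (x : List Bool) :
    update (toStacks I n S) (some (stackIndex n k)) x = toStacks I n (update S k x) := by
  funext j
  rcases j with _ | j
  · rfl
  · by_cases h : j = stackIndex n k
    · subst h
      simp [toStacks, val_stackIndex hk]
    · have h' : (j : ℕ) ≠ k := by
        rintro rfl; exact h (Fin.ext (val_stackIndex hk).symm)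
      rw [update_of_ne (by simpa using h)]
      simp [toStacks, h']

theorem toStacks_apply (S : Store) {k : ℕ} (hk : k < n + 1) :
    toStacks I n S (some (stackIndex n k)) = S k := by
  simp [toStacks, val_stackIndex hk]

/-- The configuration `c` leads to the configuration `c'` in exactly `t` steps. -/
def StepsTo (M : Λ → TM2.Stmt (Alphabet I n) Λ (Register I)) (t : ℕ)
    (c c' : TM2.Cfg (Alphabet I n) Λ (Register I)) : Prop :=
  (flip bind (TM2.step M))^[t] (some c) = some c'

theorem StepsTo.trans {M : Λ → TM2.Stmt (Alphabet I n) Λ (Register I)} {t t' : ℕ}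
    {c c' c'' : TM2.Cfg (Alphabet I n) Λ (Register I)} (h : StepsTo M t c c')
    (h' : StepsTo M t' c' c'') : StepsTo M (t + t') c c'' := by
  unfold StepsTo at *
  have := Function.iterate_add_apply (flip bind (TM2.step M)) t' t (some c)
  rw [h, h'] at this
  convert this using 2
  exact add_comm t t'

theorem StepsTo.one {M : Λ → TM2.Stmt (Alphabet I n) Λ (Register I)} {l : Λ} {v S}
    {c : TM2.Cfg (Alphabet I n) Λ (Register I)} (h : TM2.stepAux (M l) v S = c) :
    StepsTo M 1 ⟨some l, v, S⟩ c := by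
  subst h; rfl

/-- Correctness of the translation. The program may sit anywhere inside a larger machine, through
`emb` and `exit`, which is what the induction needs for subprograms. The step counts agree exactly:
sequencing is free, since the exit of the first program is the entry of the second. -/
theorem Exec.stepsTo {M : Λ → TM2.Stmt (Alphabet I n) Λ (Register I)} {c : Cmd} {S S' : Store}
    {t : ℕ} (h : Exec c S t S') (hc : c.width ≤ n + 1) (emb : c.Label → Λ) (exit : Λ)
    (hM : ∀ l, M (emb l) = c.stmt emb exit l) (v : Register I) :
    ∃ v', StepsTo M t ⟨some (emb c.entry), v, toStacks I n S⟩ ⟨some exit, v', toStacks I n S'⟩ := by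
  induction h generalizing v exit with
  | skip => exact ⟨v, .one (by rw [hM]; rfl)⟩
  | @push k a S =>
    refine ⟨v, .one ?_⟩
    rw [hM]
    have hk : k < n + 1 := hc
    simp [Cmd.stmt, toStacks_update S hk, toStacks_apply S hk]
  | @seq c d S t S' t' S'' h1 h2 ih1 ih2 =>
    have hw : c.width ≤ n + 1 ∧ d.width ≤ n + 1 := max_le_iff.1 hc
    obtain ⟨v1, h1⟩ := ih1 hw.1 _ _ (fun l => hM (Sum.inl l : c.Label ⊕ d.Label)) v
    obtain ⟨v2, h2⟩ := ih2 hw.2 _ _ (fun l => hM (Sum.inr l : c.Label ⊕ d.Label)) v1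
    exact ⟨v2, h1.trans h2⟩
  | @pop_nil k e c d S t S' hS h ih =>
    have hw : k + 1 ≤ n + 1 ∧ e.width ≤ n + 1 ∧ c.width ≤ n + 1 ∧ d.width ≤ n + 1 := by
      simpa [Cmd.width] using hc
    obtain ⟨v1, h1⟩ := ih hw.2.1 _ _
      (fun l => hM (some (.inl l) : Option (e.Label ⊕ c.Label ⊕ d.Label))) (none, v.2)
    refine ⟨v1, ?_⟩
    rw [add_comm]
    refine StepsTo.trans (.one ?_) h1
    have hS' : update S k [] = S := by rw [← hS, update_eq_self]
    erw [hM]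
    simp [Cmd.stmt, Cmd.entry, toStacks_update S hw.1, toStacks_apply S hw.1, hS, hS']
  | @pop_true k e c d S t S' l hS h ih =>
    have hw : k + 1 ≤ n + 1 ∧ e.width ≤ n + 1 ∧ c.width ≤ n + 1 ∧ d.width ≤ n + 1 := by
      simpa [Cmd.width] using hc
    obtain ⟨v1, h1⟩ := ih hw.2.2.1 _ _
      (fun l => hM (some (.inr (.inl l)) : Option (e.Label ⊕ c.Label ⊕ d.Label))) (some true, v.2)
    refine ⟨v1, ?_⟩
    rw [add_comm]
    refine StepsTo.trans (.one ?_) h1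
    erw [hM]
    simp [Cmd.stmt, Cmd.entry, toStacks_update S hw.1, toStacks_apply S hw.1, hS]
  | @pop_false k e c d S t S' l hS h ih =>
    have hw : k + 1 ≤ n + 1 ∧ e.width ≤ n + 1 ∧ c.width ≤ n + 1 ∧ d.width ≤ n + 1 := by
      simpa [Cmd.width] using hc
    obtain ⟨v1, h1⟩ := ih hw.2.2.2 _ _
      (fun l => hM (some (.inr (.inr l)) : Option (e.Label ⊕ c.Label ⊕ d.Label))) (some false, v.2)
    refine ⟨v1, ?_⟩
    rw [add_comm]
    refine StepsTo.trans (.one ?_) h1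
    erw [hM]
    simp [Cmd.stmt, Cmd.entry, toStacks_update S hw.1, toStacks_apply S hw.1, hS]
  | @loop_nil k c d S hS =>
    have hw : k + 1 ≤ n + 1 ∧ c.width ≤ n + 1 ∧ d.width ≤ n + 1 := by
      simpa [Cmd.width] using hc
    refine ⟨(none, v.2), .one ?_⟩
    have hS' : update S k [] = S := by rw [← hS, update_eq_self]
    erw [hM]
    simp [Cmd.stmt, toStacks_update S hw.1, toStacks_apply S hw.1, hS, hS', Cmd.entry]
  | @loop_true k c d S t S' t' S'' l hS h h' ih ih' =>
    have hw : k + 1 ≤ n + 1 ∧ c.width ≤ n + 1 ∧ d.width ≤ n + 1 := by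
      simpa [Cmd.width] using hc
    obtain ⟨v1, h1⟩ := ih hw.2.1 _ _
      (fun l => hM (some (.inl l) : Option (c.Label ⊕ d.Label))) (some true, v.2)
    obtain ⟨v2, h2⟩ := ih' hc _ _ hM v1
    refine ⟨v2, ?_⟩
    rw [add_comm]
    refine StepsTo.trans (.one ?_) (h1.trans h2)
    erw [hM]
    simp [Cmd.stmt, Cmd.entry, toStacks_update S hw.1, toStacks_apply S hw.1, hS]
  | @loop_false k c d S t S' t' S'' l hS h h' ih ih' =>
    have hw : k + 1 ≤ n + 1 ∧ c.width ≤ n + 1 ∧ d.width ≤ n + 1 := by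
      simpa [Cmd.width] using hc
    obtain ⟨v1, h1⟩ := ih hw.2.2 _ _
      (fun l => hM (some (.inr l) : Option (c.Label ⊕ d.Label))) (some false, v.2)
    obtain ⟨v2, h2⟩ := ih' hc _ _ hM v1
    refine ⟨v2, ?_⟩
    rw [add_comm]
    refine StepsTo.trans (.one ?_) (h1.trans h2)
    erw [hM]
    simp [Cmd.stmt, Cmd.entry, toStacks_update S hw.1, toStacks_apply S hw.1, hS]

/-- Push the letters of a word onto the first (`i = 0`), … stack of Booleans. -/
def pushWord (i : Fin (n + 1)) : List Bool → TM2.Stmt (Alphabet I n) Λ (Register I) →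
    TM2.Stmt (Alphabet I n) Λ (Register I)
  | [], q => q
  | a :: w, q => .push (some i) (fun _ => a) (pushWord i w q)

theorem stepAux_pushWord (i : Fin (n + 1)) (w : List Bool)
    (q : TM2.Stmt (Alphabet I n) Λ (Register I)) (v : Register I) (T : ∀ k, List (Alphabet I n k)) :
    TM2.stepAux (pushWord i w q) v T =
      TM2.stepAux q v (update T (some i) (w.reverse ++ T (some i))) := by
  induction w generalizing T with
  | nil => simp [pushWord]
  | cons a w ih =>
    simp only [pushWord, TM2.stepAux, ih]
    simp

open Classical in
/-- Push the word `w a` if the symbol `a` was read last from the input. -/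
noncomputable def pushWordOf (i : Fin (n + 1)) (w : I → List Bool) :
    List I → TM2.Stmt (Alphabet I n) Λ (Register I) → TM2.Stmt (Alphabet I n) Λ (Register I)
  | [], q => q
  | a :: as, q => .branch (fun s => decide (s.2 = some a)) (pushWord i (w a) q) (pushWordOf i w as q)

theorem stepAux_pushWordOf (i : Fin (n + 1)) (w : I → List Bool) {as : List I} {a : I} (ha : a ∈ as)
    (q : TM2.Stmt (Alphabet I n) Λ (Register I)) (v : Option Bool)
    (T : ∀ k, List (Alphabet I n k)) :
    TM2.stepAux (pushWordOf i w as q) (v, some a) T =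
      TM2.stepAux q (v, some a) (update T (some i) ((w a).reverse ++ T (some i))) := by
  induction as with
  | nil => simp at ha
  | cons b as ih =>
    by_cases hb : b = a
    · subst hb
      simp [pushWordOf, stepAux_pushWord]
    · simp only [pushWordOf, TM2.stepAux]
      rw [← ih (by simpa [Ne.symm hb] using ha)]
      simp [Ne.symm hb]

/-- The statements of the machine which writes the words of the input symbols on stack `1`,
runs `c`, and halts. -/
noncomputable def machineStmt (n : ℕ) (w : I → List Bool) (as : List I) (c : Cmd) :
    Option (Option c.Label) → TM2.Stmt (Alphabet I n) (Option (Option c.Label)) (Register I)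
  | none => .pop none (fun s a => (s.1, a))
      (.branch (fun s => s.2.isSome)
        (pushWordOf (stackIndex n 1) w as (.goto fun _ => none))
        (.goto fun _ => some (some c.entry)))
  | some none => .load (fun _ => (none, none)) .halt
  | some (some l) => c.stmt (fun l => some (some l)) (some none) l

/-- The stacks of the machine for a store and a content of the input stack. -/
def withInput (n : ℕ) (S : Store) (l : List I) : ∀ k, List (Alphabet I n k)
  | none => l
  | some i => S i

theorem stepsTo_read (w : I → List Bool) {as : List I} (has : ∀ a, a ∈ as) (c : Cmd)
    (hn : 1 ≤ n) (l : List I) (S : Store) (v : Option Bool) (v' : Option I) :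
    StepsTo (machineStmt n w as c) (l.length + 1) ⟨some none, (v, v'), withInput n S l⟩
      ⟨some (some (some c.entry)), (v, none),
        toStacks I n (update S 1 ((l.flatMap w).reverse ++ S 1))⟩ := by
  induction l generalizing S v' with
  | nil =>
    refine .one ?_
    simp only [machineStmt, TM2.stepAux]
    simp only [withInput, List.head?_nil, Option.isSome_none, cond_false, List.tail_nil]
    congr 1
    funext k
    rcases k with _ | k
    · rfl
    · simp [toStacks, withInput]
  | cons a l ih =>
    have key := ih (update S 1 ((w a).reverse ++ S 1)) (some a)
    rw [List.length_cons, add_comm (l.length + 1)]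
    have e : update (update S 1 ((w a).reverse ++ S 1)) 1
        ((List.flatMap w l).reverse ++ (update S 1 ((w a).reverse ++ S 1)) 1) =
        update S 1 ((List.flatMap w (a :: l)).reverse ++ S 1) := by
      simp
    rw [e] at key
    refine StepsTo.trans (.one ?_) key
    simp only [machineStmt, TM2.stepAux]
    simp only [withInput, List.head?_cons, Option.isSome_some, cond_true, List.tail_cons]
    rw [stepAux_pushWordOf _ _ (has a)]
    simp only [TM2.stepAux]
    congr 1
    have h1 : (stackIndex n 1 : ℕ) = 1 := val_stackIndex (by omega)
    funext k
    rcases k with _ | k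
    · rfl
    · by_cases hk : k = stackIndex n 1
      · subst hk
        simp only [update_self, withInput, h1]
        simp [withInput, h1]
      · have : (k : ℕ) ≠ 1 := fun h => hk (Fin.ext (by rw [h, h1]))
        rw [update_of_ne (by simpa using hk)]
        simp [withInput, this]

open Classical in
/-- A function is computable in polynomial time if a program computes it in polynomial time
from the words of the input symbols on stack `1`. -/
theorem nonempty_tm2ComputableInPolyTime {α : Type} [Finite I] (ea : α → List I) (f : α → Bool)
    (w : I → List Bool) (c : Cmd) (p : Polynomial ℕ)
    (h : ∀ a, ∃ t ≤ p.eval (ea a).length,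
      Exec c (update (fun _ => []) 1 ((ea a).flatMap w).reverse) t
        (update (fun _ => []) 0 [f a])) :
    Nonempty (TM2ComputableInPolyTime ea Computability.encodeBool f) := by
  have hI := Fintype.ofFinite I
  have hL := Fintype.ofFinite c.Label
  let n := c.width + 1
  let as := (Finset.univ : Finset I).toList
  let tm : FinTM2 :=
    { K := Option (Fin (n + 1))
      k₀ := none
      k₁ := some 0
      Γ := Alphabet I n
      Λ := Option (Option c.Label)
      main := none
      σ := Register I
      initialState := (none, none)
      Γk₀Fin := inferInstanceAs (Fintype I)
      m := machineStmt n w as c }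
  refine ⟨{
    tm := tm
    inputAlphabet := Equiv.refl I
    outputAlphabet := Equiv.refl Bool
    time := Polynomial.X + p + 2
    outputsFun := fun a => ?_ }⟩
  choose t ht ht' using h
  have h1 := stepsTo_read (n := n) w (as := as) (by simp [as]) c (by omega) (ea a)
    (fun _ => []) none none
  choose v h2 using (ht' a).stepsTo (M := machineStmt n w as c) (n := n) (by omega)
    (fun l => some (some l)) (some none) (fun _ => rfl) (none, none)
  have h3 : StepsTo (machineStmt n w as c) 1 ⟨some (some none), v,
      toStacks I n (update (fun _ => []) 0 [f a])⟩
      ⟨none, (none, none), toStacks I n (update (fun _ => []) 0 [f a])⟩ := .one rfl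
  rw [List.append_nil] at h1
  have h4 := (h1.trans h2).trans h3
  refine ⟨⟨(ea a).length + 1 + t a + 1, ?_⟩, ?_⟩
  · have hi : initList tm (List.map (Equiv.refl I).invFun (ea a)) =
        ⟨some none, (none, none), withInput n (fun _ => []) (ea a)⟩ := by
      unfold initList
      congr 1
      funext k
      rcases k with _ | k
      · simp [withInput, tm]
      · simp [withInput, tm]
    -- The prescribed final configuration has the initial register, which is why the machine resets
    -- its register before halting.
    have ho : haltList tm (List.map (Equiv.refl Bool).invFun (Computability.encodeBool (f a))) =
        ⟨none, (none, none), toStacks I n (update (fun _ => []) 0 [f a])⟩ := by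
      unfold haltList
      congr 1
      funext k
      rcases k with _ | k
      · simp [toStacks, tm]
      · by_cases hk : k = 0
        · subst hk
          simp [toStacks, tm, Computability.encodeBool]
        · have : (k : ℕ) ≠ 0 := fun h => hk (Fin.ext h)
          simp [toStacks, tm, hk, this]
    rw [hi, Option.map_some, ho]
    exact h4
  · have := ht a
    show (ea a).length + 1 + t a + 1 ≤ _
    rw [Polynomial.eval_add, Polynomial.eval_add, Polynomial.eval_X, Polynomial.eval_ofNat]
    omega

end StackProgram

/-! ### Programs for binary trees in prefix notation. -/

namespace StackProgram

open Function

/-- `c` started in `S` halts in `S'` after at most `t` steps. -/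
def ExecLe (c : Cmd) (S : Store) (t : ℕ) (S' : Store) : Prop := ∃ t' ≤ t, Exec c S t' S'

theorem ExecLe.mono {c : Cmd} {S S' : Store} {t t' : ℕ} (h : ExecLe c S t S') (ht : t ≤ t') :
    ExecLe c S t' S' :=
  let ⟨u, hu, h⟩ := h; ⟨u, hu.trans ht, h⟩

theorem ExecLe.seq {c d : Cmd} {S S' S'' : Store} {t t' : ℕ} (h : ExecLe c S t S')
    (h' : ExecLe d S' t' S'') : ExecLe (.seq c d) S (t + t') S'' :=
  let ⟨u, hu, h⟩ := h
  let ⟨u', hu', h'⟩ := h'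
  ⟨u + u', by omega, h.seq h'⟩

/-- The store with words `w`, `x`, `y`, `z` on the stacks `b`, …, `b + 3`, and nothing above. -/
def frame (S : Store) (b : ℕ) (w x y z : List Bool) : Store := fun j =>
  if j < b then S j else if j = b then w else if j = b + 1 then x else if j = b + 2 then y else
    if j = b + 3 then z else []

variable {S : Store} {b : ℕ} {w x y z v : List Bool}

@[simp] theorem frame_apply_zero : frame S b w x y z b = w := by simp [frame]
@[simp] theorem frame_apply_one : frame S b w x y z (b + 1) = x := by simp [frame]
@[simp] theorem frame_apply_two : frame S b w x y z (b + 2) = y := by simp [frame]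
@[simp] theorem frame_apply_three : frame S b w x y z (b + 3) = z := by simp [frame]

@[simp] theorem update_frame_zero : update (frame S b w x y z) b v = frame S b v x y z := by
  funext j
  rcases eq_or_ne j b with rfl | h
  · simp
  · simp [h, frame]

@[simp] theorem update_frame_one : update (frame S b w x y z) (b + 1) v = frame S b w v y z := by
  funext j
  rcases eq_or_ne j (b + 1) with rfl | h
  · simp
  · simp [h, frame]

@[simp] theorem update_frame_two : update (frame S b w x y z) (b + 2) v = frame S b w x v z := by
  funext j
  rcases eq_or_ne j (b + 2) with rfl | h
  · simp
  · simp [h, frame]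

@[simp] theorem update_frame_three : update (frame S b w x y z) (b + 3) v = frame S b w x y v := by
  funext j
  rcases eq_or_ne j (b + 3) with rfl | h
  · simp
  · simp [h, frame]

/-- A subprogram called one stack higher regards the word on stack `b` as part of the untouched
store below it. This lets programs that are indexed by their base stack be nested. -/
theorem frame_frame : frame (frame S b w [] [] []) (b + 1) x [] [] [] = frame S b w x [] [] := by
  funext j
  unfold frame
  split_ifs <;> first | rfl | omega

/-- Move the letters of stack `i` to stack `j`, which reverses them. -/
def move (i j : ℕ) : Cmd := .loop i (.push j true) (.push j false)

theorem exec_move {i j : ℕ} (hij : i ≠ j) (S : Store) :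
    Exec (move i j) S (2 * (S i).length + 1)
      (update (update S i []) j ((S i).reverse ++ S j)) := by
  generalize hl : S i = l
  induction l generalizing S with
  | nil =>
    have : update (update S i []) j ([].reverse ++ S j) = S := by
      rw [← hl, update_eq_self]; simp [hl]
    rw [this]
    exact .loop_nil hl
  | cons a l ih =>
    have key := ih (update (update S i l) j (a :: S j)) (by simp [hij])
    have e : update (update (update (update S i l) j (a :: S j)) i []) j
        (l.reverse ++ update (update S i l) j (a :: S j) j) =
        update (update S i []) j ((a :: l).reverse ++ S j) := by
      funext x
      by_cases hx : x = j
      · subst hx; simp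
      · by_cases hx' : x = i
        · subst hx'; simp [hx]
        · simp [hx, hx']
    rw [e] at key
    have ht : 2 * (a :: l).length + 1 = 1 + (2 * l.length + 1) + 1 := by simp; ring
    rw [ht]
    have hj : a :: S j = a :: update S i l j := by simp [hij.symm]
    rw [hj] at key
    cases a
    · exact .loop_false hl .push key
    · exact .loop_true hl .push key

theorem execLe_move {i j : ℕ} (hij : i ≠ j) (S : Store) :
    ExecLe (move i j) S (2 * (S i).length + 1)
      (update (update S i []) j ((S i).reverse ++ S j)) :=
  ⟨_, le_rfl, exec_move hij S⟩

/-- Empty the stack `i`. -/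
def clear (i : ℕ) : Cmd := .loop i .skip .skip

theorem execLe_clear (i : ℕ) (S : Store) :
    ExecLe (clear i) S (2 * (S i).length + 1) (update S i []) := by
  refine ⟨_, le_rfl, ?_⟩
  generalize hl : S i = l
  induction l generalizing S with
  | nil =>
    have : update S i [] = S := by rw [← hl, update_eq_self]
    rw [this]
    exact .loop_nil hl
  | cons a l ih =>
    have key := ih (update S i l) (by simp)
    rw [update_idem] at key
    have ht : 2 * (a :: l).length + 1 = 1 + (2 * l.length + 1) + 1 := by simp; ring
    rw [ht]
    cases a
    · exact .loop_false hl .skip key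
    · exact .loop_true hl .skip key

theorem execLe_push (i : ℕ) (a : Bool) (S : Store) :
    ExecLe (.push i a) S 1 (update S i (a :: S i)) := ⟨1, le_rfl, .push⟩

/-- Move stack `b + 2` back to stack `b`, with a copy on stack `b + 1`. -/
def unstash (b : ℕ) : Cmd :=
  .loop (b + 2) (.seq (.push b true) (.push (b + 1) true))
    (.seq (.push b false) (.push (b + 1) false))

theorem exec_unstash (S : Store) (b : ℕ) (w x y : List Bool) :
    Exec (unstash b) (frame S b w x y []) (3 * y.length + 1)
      (frame S b (y.reverse ++ w) (y.reverse ++ x) [] []) := by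
  induction y generalizing w x with
  | nil => exact .loop_nil (by simp)
  | cons a y ih =>
    have key := ih (a :: w) (a :: x)
    have ht : 3 * (a :: y).length + 1 = (1 + 1) + (3 * y.length + 1) + 1 := by simp; ring
    rw [ht]
    simp only [List.reverse_cons, List.append_assoc, List.cons_append, List.nil_append]
    cases a
    · refine .loop_false (by simp; rfl) (.seq .push .push) ?_
      simpa [unstash] using key
    · refine .loop_true (by simp; rfl) (.seq .push .push) ?_
      simpa [unstash] using key

def copy (b : ℕ) : Cmd := .seq (move b (b + 2)) (unstash b)

theorem execLe_copy (S : Store) (b : ℕ) (w : List Bool) :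
    ExecLe (copy b) (frame S b w [] [] []) (5 * w.length + 2) (frame S b w w [] []) := by
  have h1 := execLe_move (i := b) (j := b + 2) (by omega) (frame S b w [] [] [])
  simp only [frame_apply_zero, frame_apply_two, update_frame_zero, update_frame_two] at h1
  have h2 : ExecLe (unstash b) _ _ _ := ⟨_, le_rfl, exec_unstash S b [] [] w.reverse⟩
  simp only [List.append_nil, List.reverse_reverse] at h1 h2
  exact (h1.seq h2).mono (by simp; omega)

/-- Exchange the stacks `b` and `b + 1`. -/
def swap (b : ℕ) : Cmd :=
  .seq (.seq (move b (b + 2)) (move (b + 1) (b + 3)))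
    (.seq (move (b + 2) (b + 1)) (move (b + 3) b))

theorem execLe_swap (S : Store) (b : ℕ) (w x : List Bool) :
    ExecLe (swap b) (frame S b w x [] []) (4 * w.length + 4 * x.length + 4)
      (frame S b x w [] []) := by
  have h1 := execLe_move (i := b) (j := b + 2) (by omega) (frame S b w x [] [])
  have h2 := execLe_move (i := b + 1) (j := b + 3) (by omega) (frame S b [] x w.reverse [])
  have h3 := execLe_move (i := b + 2) (j := b + 1) (by omega) (frame S b [] [] w.reverse x.reverse)
  have h4 := execLe_move (i := b + 3) (j := b) (by omega) (frame S b [] w [] x.reverse)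
  simp at h1 h2 h3 h4
  exact ((h1.seq h2).seq (h3.seq h4)).mono (by omega)

/-- Put `true` and the concatenation of the stacks `b` and `b + 1` on stack `b`. -/
def join (b : ℕ) : Cmd :=
  .seq (.seq (move b (b + 2)) (move (b + 2) (b + 1)))
    (.seq (.push (b + 1) true) (.seq (move (b + 1) (b + 2)) (move (b + 2) b)))

theorem execLe_join (S : Store) (b : ℕ) (w x : List Bool) :
    ExecLe (join b) (frame S b w x [] []) (8 * w.length + 4 * x.length + 9)
      (frame S b (true :: (w ++ x)) [] [] []) := by
  have h1 := execLe_move (i := b) (j := b + 2) (by omega) (frame S b w x [] [])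
  have h2 := execLe_move (i := b + 2) (j := b + 1) (by omega) (frame S b [] x w.reverse [])
  have h3 := execLe_push (b + 1) true (frame S b [] (w ++ x) [] [])
  have h4 := execLe_move (i := b + 1) (j := b + 2) (by omega)
    (frame S b [] (true :: (w ++ x)) [] [])
  have h5 := execLe_move (i := b + 2) (j := b) (by omega)
    (frame S b [] [] (true :: (w ++ x)).reverse [])
  simp at h1 h2 h3 h4 h5
  exact ((h1.seq h2).seq (h3.seq (h4.seq h5))).mono (by omega)

/-- Binary trees. -/
inductive Tree
  | leaf
  | node (x y : Tree)

namespace Tree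

/-- The word of a tree in prefix notation. -/
def code : Tree → List Bool
  | leaf => [false]
  | node x y => true :: (x.code ++ y.code)

def size (x : Tree) : ℕ := x.code.length

@[simp] theorem size_leaf : leaf.size = 1 := rfl

@[simp] theorem size_node (x y : Tree) : (node x y).size = x.size + y.size + 1 := by
  simp [size, code]

theorem size_pos (x : Tree) : 0 < x.size := by
  cases x <;> simp

def fst : Tree → Tree
  | leaf => leaf
  | node x _ => x

def snd : Tree → Tree
  | leaf => leaf
  | node _ y => y

def isLeaf : Tree → Bool
  | leaf => true
  | node _ _ => false

end Tree

/-- With `m` letters on stack `b + 1`, move the words of `m` trees from stack `b` to stack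
`b + 2`. -/
def parse (b : ℕ) : Cmd :=
  .loop (b + 1)
    (.popCase b .skip
      (.seq (.push (b + 2) true) (.seq (.push (b + 1) true) (.push (b + 1) true)))
      (.push (b + 2) false)) .skip

/-- Stack `b + 1` counts the trees still to be read: a node replaces one pending tree by two, a leaf
removes one. Stated backwards, from a run after `x` was read to a run before it, so that the two
subtrees of a node can be prepended one after the other. -/
theorem exec_parse (x : Tree) {S S' : Store} {b t : ℕ} {r m z : List Bool}
    (h : Exec (parse b) (frame S b r m (x.code.reverse ++ z) []) t S') :
    ∃ t' ≤ t + 5 * x.size,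
      Exec (parse b) (frame S b (x.code ++ r) (true :: m) z []) t' S' := by
  induction x generalizing t r m z with
  | leaf =>
    refine ⟨2 + t + 1, by simp; omega, .loop_true (by simp; rfl)
      (S' := frame S b r m (false :: z) []) ?_ h⟩
    refine .pop_false (by simp; rfl) ?_
    convert Exec.push using 1
    simp
  | node x y ihx ihy =>
    have e : (Tree.node x y).code.reverse ++ z =
        y.code.reverse ++ (x.code.reverse ++ (true :: z)) := by
      simp [Tree.code]
    rw [e] at h
    obtain ⟨t1, ht1, h1⟩ := ihy h
    obtain ⟨t2, ht2, h2⟩ := ihx h1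
    refine ⟨4 + t2 + 1, by simp; omega, .loop_true (by simp; rfl)
      (S' := frame S b (x.code ++ (y.code ++ r)) (true :: true :: m) (true :: z) []) ?_ h2⟩
    refine .pop_true (by simp [Tree.code]; rfl) ?_
    convert Exec.seq Exec.push (.seq .push .push) using 1
    simp

theorem execLe_parse (S : Store) (b : ℕ) (x : Tree) (r : List Bool) :
    ExecLe (parse b) (frame S b (x.code ++ r) [true] [] []) (5 * x.size + 1)
      (frame S b r [] x.code.reverse []) := by
  obtain ⟨t, ht, h⟩ := exec_parse x (S := S) (b := b) (r := r) (m := []) (z := [])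
    (.loop_nil (by simp))
  refine ⟨t, by omega, ?_⟩
  simpa using h

/-- A family of programs, indexed by the stack used for input and output, turns the word `x`
into the word `y` within `t` steps. -/
def Computes (c : ℕ → Cmd) (x : List Bool) (t : ℕ) (y : List Bool) : Prop :=
  ∀ b S, ExecLe (c b) (frame S b x [] [] []) t (frame S b y [] [] [])

theorem Computes.mono {c : ℕ → Cmd} {x y : List Bool} {t t' : ℕ} (h : Computes c x t y)
    (ht : t ≤ t') : Computes c x t' y := fun b S => (h b S).mono ht

theorem Computes.length_le {c : ℕ → Cmd} {x y : List Bool} {t : ℕ} (h : Computes c x t y) :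
    y.length ≤ x.length + t := by
  obtain ⟨t', ht', h⟩ := h 0 (fun _ => [])
  have := h.length_le 0
  simp only [frame_apply_zero] at this
  omega

theorem Computes.comp {c d : ℕ → Cmd} {x y z : List Bool} {t t' : ℕ} (h : Computes c x t y)
    (h' : Computes d y t' z) : Computes (fun b => .seq (c b) (d b)) x (t + t') z :=
  fun b S => (h b S).seq (h' b S)

theorem Computes.id (x : List Bool) : Computes (fun _ => .skip) x 1 x :=
  fun _ _ => ⟨1, le_rfl, .skip⟩

theorem Computes.leaf (x : List Bool) :
    Computes (fun b => .seq (clear b) (.push b false)) x (2 * x.length + 2) Tree.leaf.code := by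
  intro b S
  have h1 := execLe_clear b (frame S b x [] [] [])
  have h2 := execLe_push b false (frame S b [] [] [] [])
  simp at h1 h2
  exact (h1.seq h2).mono (by omega)

/-- The first program runs on a copy; the swap then puts its result below and the saved input on top
for the second program. The lengths of both results, which enter the cost of swapping and joining,
are bounded through `Computes.length_le`. -/
theorem Computes.pair {c d : ℕ → Cmd} {x : List Bool} {y z : Tree} {t t' : ℕ}
    (h : Computes c x t y.code) (h' : Computes d x t' z.code) :
    Computes (fun b => .seq (copy b) (.seq (c (b + 1)) (.seq (swap b) (.seq (d (b + 1)) (join b)))))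
      x (50 * (x.length + t + t' + 1)) (Tree.node y z).code := by
  intro b S
  have h1 := execLe_copy S b x
  have h2 := h (b + 1) (frame S b x [] [] [])
  have h3 := execLe_swap S b x y.code
  have h4 := h' (b + 1) (frame S b y.code [] [] [])
  have h5 := execLe_join S b y.code z.code
  simp only [frame_frame] at h2 h4
  refine (h1.seq (h2.seq (h3.seq (h4.seq h5)))).mono ?_
  have := h.length_le
  have := h'.length_le
  omega

def fstCmd (b : ℕ) : Cmd :=
  .popCase b .skip
    (.seq (.push (b + 1) true) (.seq (parse b) (.seq (clear b) (move (b + 2) b))))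
    (.push b false)

def sndCmd (b : ℕ) : Cmd :=
  .popCase b .skip
    (.seq (.push (b + 1) true) (.seq (parse b) (clear (b + 2))))
    (.push b false)

theorem ExecLe.pop_true {k : ℕ} {e c d : Cmd} {S S' : Store} {t : ℕ} {l : List Bool}
    (hS : S k = true :: l) (h : ExecLe c (update S k l) t S') :
    ExecLe (.popCase k e c d) S (t + 1) S' :=
  let ⟨u, hu, h⟩ := h; ⟨u + 1, by omega, h.pop_true hS⟩

theorem ExecLe.pop_false {k : ℕ} {e c d : Cmd} {S S' : Store} {t : ℕ} {l : List Bool}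
    (hS : S k = false :: l) (h : ExecLe d (update S k l) t S') :
    ExecLe (.popCase k e c d) S (t + 1) S' :=
  let ⟨u, hu, h⟩ := h; ⟨u + 1, by omega, h.pop_false hS⟩

theorem Computes.fst (x : Tree) : Computes fstCmd x.code (10 * x.size + 10) x.fst.code := by
  intro b S
  cases x with
  | leaf =>
    refine (ExecLe.pop_false (l := []) (by simp [Tree.code]) (t := 1) ?_).mono (by omega)
    simpa [Tree.fst, Tree.snd, Tree.code] using execLe_push b false (frame S b [] [] [] [])
  | node x y =>
    refine (ExecLe.pop_true (l := x.code ++ y.code) (by simp [Tree.code])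
      (t := 9 * (x.size + y.size) + 9) ?_).mono (by simp; omega)
    have h1 := execLe_push (b + 1) true (frame S b (x.code ++ y.code) [] [] [])
    have h2 := execLe_parse S b x y.code
    have h3 := execLe_clear b (frame S b y.code [] x.code.reverse [])
    have h4 := execLe_move (i := b + 2) (j := b) (by omega) (frame S b [] [] x.code.reverse [])
    simp at h1 h2 h3 h4 ⊢
    refine (h1.seq (h2.seq (h3.seq h4))).mono ?_
    simp only [Tree.size]
    omega

theorem Computes.snd (x : Tree) : Computes sndCmd x.code (10 * x.size + 10) x.snd.code := by
  intro b S
  cases x with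
  | leaf =>
    refine (ExecLe.pop_false (l := []) (by simp [Tree.code]) (t := 1) ?_).mono (by omega)
    simpa [Tree.fst, Tree.snd, Tree.code] using execLe_push b false (frame S b [] [] [] [])
  | node x y =>
    refine (ExecLe.pop_true (l := x.code ++ y.code) (by simp [Tree.code])
      (t := 9 * (x.size + y.size) + 9) ?_).mono (by simp; omega)
    have h1 := execLe_push (b + 1) true (frame S b (x.code ++ y.code) [] [] [])
    have h2 := execLe_parse S b x y.code
    have h3 := execLe_clear (b + 2) (frame S b y.code [] x.code.reverse [])
    simp at h1 h2 h3 ⊢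
    refine (h1.seq (h2.seq h3)).mono ?_
    simp only [Tree.size]
    omega

/-- The code of a Boolean. -/
def boolTree : Bool → Tree
  | false => .leaf
  | true => .node .leaf .leaf

def isLeafCmd (b : ℕ) : Cmd :=
  .popCase b .skip
    (.seq (clear b) (.push b false))
    (.seq (.push b false) (.seq (.push b false) (.push b true)))

theorem Computes.isLeaf (x : Tree) :
    Computes isLeafCmd x.code (2 * x.size + 4) (boolTree x.isLeaf).code := by
  intro b S
  cases x with
  | leaf =>
    refine (ExecLe.pop_false (l := []) (by simp [Tree.code]) (t := 3) ?_).mono (by simp)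
    have h1 := execLe_push b false (frame S b [] [] [] [])
    have h2 := execLe_push b false (frame S b [false] [] [] [])
    have h3 := execLe_push b true (frame S b [false, false] [] [] [])
    simp at h1 h2 h3 ⊢
    exact h1.seq (h2.seq h3)
  | node x y =>
    refine (ExecLe.pop_true (l := x.code ++ y.code) (by simp [Tree.code])
      (t := 2 * (x.size + y.size) + 2) ?_).mono (by simp; omega)
    have h1 := execLe_clear b (frame S b (x.code ++ y.code) [] [] [])
    have h2 := execLe_push b false (frame S b [] [] [] [])
    simp at h1 h2 ⊢
    refine (h1.seq h2).mono ?_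
    simp only [Tree.size]
    omega

/-- Run `c` or `d` on the second component, if the first component is true or false. -/
def caseCmd (c d : ℕ → Cmd) (b : ℕ) : Cmd :=
  .popCase b .skip
    (.popCase b .skip
      (.popCase b .skip .skip (.popCase b .skip .skip (c b)))
      (d b)) .skip

/-- Each branch has to be correct only when it is taken, which later allows branches defined on a
subtype. -/
theorem Computes.case {c d : ℕ → Cmd} {x y : Tree} {t : ℕ} (β : Bool)
    (hc : β = true → Computes c x.code t y.code) (hd : β = false → Computes d x.code t y.code) :
    Computes (caseCmd c d) (Tree.node (boolTree β) x).code (t + 4) y.code := by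
  intro b S
  cases β with
  | false =>
    refine (ExecLe.pop_true (l := false :: x.code) (by simp [Tree.code, boolTree])
      (ExecLe.pop_false (l := x.code) (by simp) (t := t) ?_)).mono (by omega)
    simpa using hd rfl b S
  | true =>
    refine (ExecLe.pop_true (l := true :: false :: false :: x.code) (by simp [Tree.code, boolTree])
      (ExecLe.pop_true (l := false :: false :: x.code) (by simp)
      (ExecLe.pop_false (l := false :: x.code) (by simp)
      (ExecLe.pop_false (l := x.code) (by simp) (t := t) ?_)))).mono (by omega)
    simpa using hc rfl b S

/-- Put a letter on stack `b + 1` if the tree on stack `b` is a node whose first component is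
a node. -/
def testCmd (b : ℕ) : Cmd :=
  .popCase b .skip
    (.popCase b .skip
      (.seq (.push b true) (.seq (.push b true) (.push (b + 1) true)))
      (.seq (.push b false) (.push b true))) .skip

/-- Run `c` while the first component is a node. -/
def loopCmd (c : ℕ → Cmd) (b : ℕ) : Cmd :=
  .seq (testCmd b) (.loop (b + 1) (.seq (c b) (testCmd b)) .skip)

theorem execLe_test (S : Store) (b : ℕ) (x y : Tree) :
    ExecLe (testCmd b) (frame S b (Tree.node x y).code [] [] []) 5
      (frame S b (Tree.node x y).code (if x.isLeaf then [] else [true]) [] []) := by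
  cases x with
  | leaf =>
    refine (ExecLe.pop_true (l := false :: y.code) (by simp [Tree.code])
      (ExecLe.pop_false (l := y.code) (by simp) (t := 2) ?_)).mono (by omega)
    have h1 := execLe_push b false (frame S b y.code [] [] [])
    have h2 := execLe_push b true (frame S b (false :: y.code) [] [] [])
    simp at h1 h2 ⊢
    exact h1.seq h2
  | node x x' =>
    refine (ExecLe.pop_true (l := true :: (x.code ++ x'.code ++ y.code)) (by simp [Tree.code])
      (ExecLe.pop_true (l := x.code ++ x'.code ++ y.code) (by simp) (t := 3) ?_)).mono (by omega)
    have h1 := execLe_push b true (frame S b (x.code ++ x'.code ++ y.code) [] [] [])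
    have h2 := execLe_push b true (frame S b (true :: (x.code ++ x'.code ++ y.code)) [] [] [])
    have h3 := execLe_push (b + 1) true
      (frame S b (true :: true :: (x.code ++ x'.code ++ y.code)) [] [] [])
    simp at h1 h2 h3 ⊢
    simp only [Tree.code, Tree.isLeaf]
    simpa using h1.seq (h2.seq h3)

theorem Computes.loop {c : ℕ → Cmd} {x y : ℕ → Tree} {n t : ℕ}
    (hn : (x n).isLeaf = true) (hx : ∀ i < n, (x i).isLeaf = false)
    (hc : ∀ i < n, Computes c (Tree.node (x i) (y i)).code t (Tree.node (x (i + 1)) (y (i + 1))).code) :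
    Computes (loopCmd c) (Tree.node (x 0) (y 0)).code (n * (t + 6) + 6)
      (Tree.node (x n) (y n)).code := by
  intro b S
  -- Induction on the number `i` of rounds that remain; a round costs `t` for the body, 5 for the
  -- test and 1 for the jump.
  have key : ∀ i ≤ n, ExecLe (.loop (b + 1) (.seq (c b) (testCmd b)) .skip)
      (frame S b (Tree.node (x (n - i)) (y (n - i))).code
        (if (x (n - i)).isLeaf then [] else [true]) [] []) (i * (t + 6) + 1)
      (frame S b (Tree.node (x n) (y n)).code [] [] []) := by
    intro i hi
    induction i with
    | zero =>
      simp only [Nat.sub_zero, hn, if_true]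
      exact ⟨1, by omega, .loop_nil (by simp)⟩
    | succ i ih =>
      have hlt : n - (i + 1) < n := by omega
      have e : n - (i + 1) + 1 = n - i := by omega
      obtain ⟨t1, ht1, h1⟩ := ih (by omega)
      obtain ⟨t2, ht2, h2⟩ := (hc _ hlt b S).seq (execLe_test S b _ _)
      rw [e] at h2
      refine ⟨t2 + t1 + 1, ?_, .loop_true (l := []) (by simp [hx _ hlt]) ?_ h1⟩
      · have : (i + 1) * (t + 6) = i * (t + 6) + (t + 6) := by ring
        omega
      · simpa using h2
  have h := (execLe_test S b (x 0) (y 0)).seq (by simpa using key n le_rfl)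
  exact h.mono (by omega)

end StackProgram

/-! ### Encodings by trees and functions computable in polynomial time. -/

namespace StackProgram

open Function

/-- An encoding by binary trees. -/
class Enc (α : Type) where
  enc : α → Tree
  injective : Injective enc

open Enc

/-- The length of the code of `a`. -/
def size {α : Type} [Enc α] (a : α) : ℕ := (enc a).size

variable {α β γ δ : Type} [Enc α] [Enc β] [Enc γ] [Enc δ]

theorem size_pos (a : α) : 0 < size a := Tree.size_pos _

instance : Enc Tree := ⟨id, injective_id⟩

instance : Enc (α × β) where
  enc x := .node (enc x.1) (enc x.2)
  injective := by
    rintro ⟨a, b⟩ ⟨a', b'⟩ h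
    simpa [(injective (α := α)).eq_iff, (injective (α := β)).eq_iff] using h

instance : Enc Bool where
  enc := boolTree
  injective := by
    intro a b h
    cases a <;> cases b <;> simp_all [boolTree]

def encList : List α → Tree
  | [] => .leaf
  | a :: l => .node (enc a) (encList l)

instance : Enc (List α) where
  enc := encList
  injective := by
    intro l
    induction l with
    | nil => rintro (_ | ⟨a, l⟩) h <;> simp_all [encList]
    | cons a l ih =>
      rintro (_ | ⟨b, l'⟩) h
      · simp [encList] at h
      · simp only [encList, Tree.node.injEq] at h
        rw [injective h.1, ih h.2]

def encOption : Option α → Tree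
  | none => .leaf
  | some a => .node (enc a) .leaf

instance : Enc (Option α) where
  enc := encOption
  injective := by
    rintro (_ | a) (_ | b) h
    · rfl
    · simp [encOption] at h
    · simp [encOption] at h
    · simp only [encOption, Tree.node.injEq, and_true] at h
      rw [injective h]

def encNat : ℕ → Tree
  | 0 => .leaf
  | n + 1 => .node .leaf (encNat n)

instance : Enc ℕ where
  enc := encNat
  injective := by
    intro m
    induction m with
    | zero => rintro (_ | n) h <;> simp_all [encNat]
    | succ m ih =>
      rintro (_ | n) h
      · simp [encNat] at h
      · simp only [encNat, Tree.node.injEq, true_and] at h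
        rw [ih h]

instance {P : α → Prop} : Enc {a // P a} where
  enc a := enc a.1
  injective := injective.comp Subtype.val_injective

/-- An encoding of a finite type. -/
@[reducible]
noncomputable def Enc.ofFinite (α : Type) [Finite α] : Enc α where
  enc a := enc ((Finite.equivFin α a : Fin _) : ℕ)
  injective := injective.comp (Fin.val_injective.comp (Finite.equivFin α).injective)

@[simp] theorem size_prod (a : α) (b : β) : size (a, b) = size a + size b + 1 :=
  Tree.size_node _ _

@[simp] theorem size_nil : size ([] : List α) = 1 := rfl

@[simp] theorem size_cons (a : α) (l : List α) : size (a :: l) = size a + size l + 1 :=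
  Tree.size_node _ _

@[simp] theorem size_nat (n : ℕ) : size n = 2 * n + 1 := by
  induction n with
  | zero => rfl
  | succ n ih =>
    have : size (n + 1) = 1 + size n + 1 := Tree.size_node _ _
    omega

theorem eval_mono (p : Polynomial ℕ) {m n : ℕ} (h : m ≤ n) : p.eval m ≤ p.eval n := by
  rw [Polynomial.eval_eq_sum, Polynomial.eval_eq_sum]
  exact Finset.sum_le_sum fun i _ => Nat.mul_le_mul_left _ (Nat.pow_le_pow_left h i)

/-- A function is computed by some program in polynomial time. -/
def PolyTime (f : α → β) : Prop :=
  ∃ (c : ℕ → Cmd) (p : Polynomial ℕ),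
    ∀ a, Computes c (enc a).code (p.eval (size a)) (enc (f a)).code

namespace PolyTime

theorem size_le {f : α → β} (hf : PolyTime f) :
    ∃ p : Polynomial ℕ, ∀ a, size (f a) ≤ p.eval (size a) := by
  obtain ⟨c, p, h⟩ := hf
  refine ⟨.X + p, fun a => ?_⟩
  have := (h a).length_le
  simpa [size, Tree.size] using this

theorem comp {g : β → γ} {f : α → β} (hg : PolyTime g) (hf : PolyTime f) :
    PolyTime (fun a => g (f a)) := by
  obtain ⟨r, hr⟩ := hf.size_le
  obtain ⟨c, p, h⟩ := hf
  obtain ⟨d, q, h'⟩ := hg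
  refine ⟨_, p + q.comp r, fun a => ((h a).comp (h' (f a))).mono ?_⟩
  simpa using eval_mono q (hr a)

theorem of_enc {f : α → β} (hf : PolyTime (fun a => enc (f a))) : PolyTime f := hf

theorem encode : PolyTime (enc : α → Tree) := ⟨_, 1, fun _ => (Computes.id _).mono (by simp)⟩

theorem arg : PolyTime (fun a : α => a) := ⟨_, 1, fun _ => (Computes.id _).mono (by simp)⟩

theorem enc_comp {f : α → β} (hf : PolyTime f) : PolyTime (fun a => enc (f a)) := hf

theorem val {P : α → Prop} : PolyTime (Subtype.val : {a // P a} → α) := PolyTime.arg (α := α).comp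
  (f := fun a : {a // P a} => a.1) ⟨_, 1, fun _ => (Computes.id _).mono (by simp)⟩

theorem pair {f : α → β} {g : α → γ} (hf : PolyTime f) (hg : PolyTime g) :
    PolyTime (fun a => (f a, g a)) := by
  obtain ⟨c, p, h⟩ := hf
  obtain ⟨d, q, h'⟩ := hg
  refine ⟨_, 50 * (.X + p + q + 1), fun a => ((h a).pair (h' a)).mono ?_⟩
  simp [size, Tree.size]

theorem treeFst : PolyTime Tree.fst := ⟨_, 10 * .X + 10, fun x => (Computes.fst x).mono (by simp [size, enc])⟩

theorem treeSnd : PolyTime Tree.snd := ⟨_, 10 * .X + 10, fun x => (Computes.snd x).mono (by simp [size, enc])⟩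

theorem isLeaf : PolyTime Tree.isLeaf := ⟨_, 2 * .X + 4, fun x => (Computes.isLeaf x).mono (by simp [size, enc])⟩

theorem leaf : PolyTime (fun _ : α => Tree.leaf) :=
  ⟨_, 2 * .X + 2, fun x => (Computes.leaf _).mono (by simp [size, Tree.size])⟩

theorem node {f g : α → Tree} (hf : PolyTime f) (hg : PolyTime g) :
    PolyTime (fun a => Tree.node (f a) (g a)) := hf.pair hg

theorem fst {f : α → β × γ} (hf : PolyTime f) : PolyTime (fun a => (f a).1) :=
  of_enc (treeFst.comp hf.enc_comp)

theorem snd {f : α → β × γ} (hf : PolyTime f) : PolyTime (fun a => (f a).2) :=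
  of_enc (treeSnd.comp hf.enc_comp)

theorem const (b : β) : PolyTime (fun _ : α => b) := by
  refine of_enc ?_
  generalize enc b = x
  induction x with
  | leaf => exact leaf
  | node x y ihx ihy => exact ihx.node ihy

/-- An element of a subtype has the code of its value, so a function on a subtype is a program whose
behaviour elsewhere is irrelevant. This is what makes `optionElim` possible, where the content of an
option exists only in one branch. -/
theorem dite {c : α → Bool} (hc : PolyTime c) {h : α → γ} {f : {a // c a = true} → γ}
    {g : {a // c a = false} → γ} (hf : PolyTime f) (hg : PolyTime g)
    (hf' : ∀ a, h a.1 = f a) (hg' : ∀ a, h a.1 = g a) : PolyTime h := by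
  obtain ⟨d, q, hd⟩ := hc.pair PolyTime.arg
  obtain ⟨e, r, he⟩ := hf
  obtain ⟨e', r', he'⟩ := hg
  refine ⟨_, q + (r + r' + 4), fun a => ((hd a).comp
    (Computes.case (c := e) (d := e') (t := r.eval (size a) + r'.eval (size a)) (c a)
      (fun hca => ?_) (fun hca => ?_))).mono (by simp)⟩
  · rw [hf' ⟨a, hca⟩]
    exact (he ⟨a, hca⟩).mono (Nat.le_add_right _ _)
  · rw [hg' ⟨a, hca⟩]
    exact (he' ⟨a, hca⟩).mono (Nat.le_add_left _ _)

theorem ite {c : α → Bool} (hc : PolyTime c) {f g : α → γ} (hf : PolyTime f) (hg : PolyTime g) :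
    PolyTime (fun a => if c a then f a else g a) :=
  hc.dite (hf.comp val) (hg.comp val) (fun a => by simp [a.2]) (fun a => by simp [a.2])

theorem and {f g : α → Bool} (hf : PolyTime f) (hg : PolyTime g) :
    PolyTime (fun a => f a && g a) := by
  convert hf.ite hg (const false) using 2 with a
  cases f a <;> simp

open Classical in
theorem eq_tree {f : α → Tree} (hf : PolyTime f) (x : Tree) :
    PolyTime (fun a => decide (f a = x)) := by
  induction x generalizing α with
  | leaf =>
    convert isLeaf.comp hf using 2 with a
    cases f a <;> simp [Tree.isLeaf]
  | node x y ihx ihy =>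
    convert (isLeaf.comp hf).ite (const false)
      ((ihx (treeFst.comp hf)).and (ihy (treeSnd.comp hf))) using 2 with a
    cases f a <;> simp [Tree.isLeaf, Tree.fst, Tree.snd]; congr

/-- Table lookup, one comparison for each element. In this way φ itself is computed, whatever the
encoding of `A`. -/
theorem of_finite [Finite α] (f : α → β) : PolyTime f := by
  classical
  rcases isEmpty_or_nonempty α with h | ⟨⟨a₀⟩⟩
  · exact ⟨fun _ => .skip, 0, fun a => h.elim a⟩
  have := Fintype.ofFinite α
  have key : ∀ s : Finset α, ∃ g : α → β, PolyTime g ∧ ∀ a ∈ s, g a = f a := by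
    intro s
    induction s using Finset.induction with
    | empty => exact ⟨fun _ => f a₀, const _, by simp⟩
    | insert a s _ ih =>
      obtain ⟨g, hg, hg'⟩ := ih
      refine ⟨_, (encode.eq_tree (enc a)).ite (const (f a)) hg, fun b hb => ?_⟩
      by_cases hba : b = a
      · subst hba; simp
      · simp [injective.eq_iff, hba, hg' b (by simpa [hba] using hb)]
  obtain ⟨g, hg, hg'⟩ := key Finset.univ
  convert hg using 1
  exact funext fun a => (hg' a (by simp)).symm

theorem isNone {o : α → Option β} (ho : PolyTime o) : PolyTime (fun a => (o a).isNone) := by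
  refine of_enc ?_
  convert (isLeaf.comp ho.enc_comp).enc_comp using 2 with a
  cases o a <;> rfl

theorem isEmpty {l : α → List β} (hl : PolyTime l) : PolyTime (fun a => (l a).isEmpty) := by
  refine of_enc ?_
  convert (isLeaf.comp hl.enc_comp).enc_comp using 2 with a
  cases l a <;> rfl

theorem cons {f : α → β} {l : α → List β} (hf : PolyTime f) (hl : PolyTime l) :
    PolyTime (fun a => f a :: l a) := hf.enc_comp.node hl.enc_comp

theorem optionSome {f : α → β} (hf : PolyTime f) : PolyTime (fun a => some (f a)) :=
  hf.enc_comp.node leaf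

theorem succ {f : α → ℕ} (hf : PolyTime f) : PolyTime (fun a => f a + 1) :=
  leaf.node hf.enc_comp

theorem tail {l : α → List β} (hl : PolyTime l) : PolyTime (fun a => (l a).tail) := by
  refine of_enc ?_
  convert treeSnd.comp hl.enc_comp using 2 with a
  cases l a <;> rfl

theorem head? {l : α → List β} (hl : PolyTime l) : PolyTime (fun a => (l a).head?) := by
  refine of_enc ?_
  convert (isLeaf.comp hl.enc_comp).ite leaf ((treeFst.comp hl.enc_comp).node leaf) using 2 with a
  cases l a <;> rfl

theorem optionElim {o : α → Option β} {f : α → γ} {g : α → β → γ} (ho : PolyTime o)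
    (hf : PolyTime f) (hg : PolyTime (fun x : α × β => g x.1 x.2)) :
    PolyTime (fun a => (o a).elim (f a) (g a)) := by
  have hget : PolyTime (fun a : {a // (o a).isNone = false} =>
      (o a.1).get (by simpa using a.2)) := by
    refine of_enc ?_
    convert treeFst.comp (ho.comp val).enc_comp using 2 with a
    obtain ⟨a, ha⟩ := a
    obtain ⟨b, hb⟩ := Option.isSome_iff_exists.1 (by simpa using ha)
    simp only [hb, Option.get_some]
    rfl
  refine ho.isNone.dite (hf.comp val) (hg.comp (val.pair hget)) (fun a => ?_) (fun a => ?_)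
  · have := a.2
    rw [Option.isNone_iff_eq_none] at this
    simp [this]
  · obtain ⟨a, ha⟩ := a
    obtain ⟨b, hb⟩ := Option.isSome_iff_exists.1 (by simpa using ha)
    simp [hb]

end PolyTime

theorem length_le_size (l : List α) : l.length ≤ size l := by
  induction l with
  | nil => simp
  | cons a l ih => simp; omega

theorem size_drop_le (l : List α) (i : ℕ) : size (l.drop i) ≤ size l := by
  induction l generalizing i with
  | nil => simp
  | cons a l ih =>
    cases i with
    | zero => simp
    | succ i => have := ih i; simp; omega

/-- The loop state consists of the remaining list, the accumulator and the input. The bound `hp` on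
all partial folds is essential: iterating a polynomial-time step could otherwise let the accumulator
grow exponentially. -/
theorem PolyTime.foldl {l : α → List β} {s : α → γ} {f : α → γ → β → γ} (hl : PolyTime l)
    (hs : PolyTime s) (hf : PolyTime (fun x : α × γ × β => f x.1 x.2.1 x.2.2))
    (hp : ∃ p : Polynomial ℕ, ∀ a i, size (((l a).take i).foldl (f a) (s a)) ≤ p.eval (size a)) :
    PolyTime (fun a => (l a).foldl (f a) (s a)) := by
  obtain ⟨p, hp⟩ := hp
  have hstep : PolyTime (fun x : List β × γ × α =>
      (x.1.tail, (x.1.head?.elim x.2.1 (f x.2.2 x.2.1), x.2.2))) :=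
    PolyTime.arg.fst.tail.pair ((PolyTime.arg.fst.head?.optionElim PolyTime.arg.snd.fst
      (hf.comp (PolyTime.arg.fst.snd.snd.pair (PolyTime.arg.fst.snd.fst.pair PolyTime.arg.snd)))).pair
      PolyTime.arg.snd.snd)
  have hres : PolyTime (fun x : List β × γ × α => x.2.1) := PolyTime.arg.snd.fst
  obtain ⟨q, hq⟩ := hl.size_le
  obtain ⟨c, r, hc⟩ := hl.pair (hs.pair PolyTime.arg)
  obtain ⟨d, u, hd⟩ := hstep
  obtain ⟨e, v, he⟩ := hres
  let bound : Polynomial ℕ := q + (p + .X + 1) + 1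
  have hbound : ∀ a i, size ((l a).drop i, (((l a).take i).foldl (f a) (s a), a)) ≤
      bound.eval (size a) := by
    intro a i
    have h1 := hp a i
    have h2 := (size_drop_le (l a) i).trans (hq a)
    simp [bound]
    omega
  refine ⟨fun b => .seq (.seq (c b) (loopCmd d b)) (e b), r + (q * (u.comp bound + 6) + 6) + v.comp bound, fun a => ?_⟩
  have h1 := hc a
  have h2 := Computes.loop (c := d) (x := fun i => enc ((l a).drop i))
    (y := fun i => enc (((l a).take i).foldl (f a) (s a), a)) (n := (l a).length)
    (t := (u.comp bound).eval (size a)) (by simp; rfl) (fun i hi => ?_) (fun i hi => ?_)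
  · have h3 := he ((l a).drop (l a).length, (((l a).take (l a).length).foldl (f a) (s a), a))
    have hb := eval_mono v (hbound a (l a).length)
    simp only [List.take_length, List.drop_length] at h3 h2 hb
    refine ((h1.comp h2).comp h3).mono ?_
    have := Nat.mul_le_mul_right ((u.comp bound).eval (size a) + 6)
      ((length_le_size (l a)).trans (hq a))
    simp only [Polynomial.eval_add, Polynomial.eval_mul, Polynomial.eval_comp,
      Polynomial.eval_ofNat] at this ⊢
    omega
  · rw [List.drop_eq_getElem_cons hi]
    rfl
  · have h := hd ((l a).drop i, (((l a).take i).foldl (f a) (s a), a))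
    have hb := eval_mono u (hbound a i)
    have h' := h.mono (t' := (u.comp bound).eval (size a)) (by simpa using hb)
    have e1 : ((l a).drop i).tail = (l a).drop (i + 1) := by simp
    have e2 : (((l a).drop i).head?.elim (((l a).take i).foldl (f a) (s a))
        (f a (((l a).take i).foldl (f a) (s a)))) = ((l a).take (i + 1)).foldl (f a) (s a) := by
      rw [List.take_succ_eq_append_getElem hi, List.foldl_append, List.head?_drop,
        List.getElem?_eq_getElem hi]
      rfl
    simp only [e1, e2] at h'
    exact h'

end StackProgram

/-! ### List operations in polynomial time. -/

namespace StackProgram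

open Function Enc

variable {α β γ δ : Type} [Enc α] [Enc β] [Enc γ] [Enc δ]

theorem size_le_of_mem {l : List α} {a : α} (h : a ∈ l) : size a ≤ size l := by
  induction l with
  | nil => simp at h
  | cons b l ih =>
    rcases List.mem_cons.1 h with rfl | h
    · simp; omega
    · have := ih h; simp; omega

theorem exists_size_le (α : Type) [Finite α] [Enc α] : ∃ M, ∀ a : α, size a ≤ M := by
  have := Fintype.ofFinite α
  exact ⟨Finset.univ.sup size, fun a => Finset.le_sup (f := size) (Finset.mem_univ a)⟩

theorem size_append_le (l l' : List α) : size (l ++ l') ≤ size l + size l' := by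
  induction l with
  | nil => simp
  | cons a l ih => simp; omega

theorem size_le_of_forall {l : List α} {M : ℕ} (h : ∀ a ∈ l, size a ≤ M) :
    size l ≤ l.length * (M + 1) + 1 := by
  induction l with
  | nil => simp
  | cons a l ih =>
    have := ih fun b hb => h b (by simp [hb])
    have := h a (by simp)
    have : (a :: l).length * (M + 1) = l.length * (M + 1) + (M + 1) := by simp; ring
    simp only [size_cons]
    omega

theorem size_flatMap_le {ι : Type} {l : List ι} {g : ι → List β} {M : ℕ} (h : ∀ a ∈ l, size (g a) ≤ M) :
    size (l.flatMap g) ≤ l.length * M + 1 := by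
  induction l with
  | nil => simp
  | cons a l ih =>
    have := ih fun b hb => h b (by simp [hb])
    have := h a (by simp)
    have := size_append_le (g a) (l.flatMap g)
    have : (a :: l).length * M = l.length * M + M := by simp; ring
    simp only [List.flatMap_cons]
    omega

namespace PolyTime

/-- Additive growth telescopes to a bound linear in the size of the list. -/
theorem foldl_of_linear {l : α → List β} {s : α → γ} {f : α → γ → β → γ} (hl : PolyTime l)
    (hs : PolyTime s) (hf : PolyTime (fun x : α × γ × β => f x.1 x.2.1 x.2.2))
    {c : ℕ} (hc : ∀ a s b, size (f a s b) ≤ size s + size b + c) :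
    PolyTime (fun a => (l a).foldl (f a) (s a)) := by
  refine foldl hl hs hf ?_
  obtain ⟨p, hp⟩ := hl.size_le
  obtain ⟨q, hq⟩ := hs.size_le
  have key : ∀ a (m : List β) s, size (m.foldl (f a) s) ≤ size s + size m * (c + 1) := by
    intro a m
    induction m with
    | nil => intro s; simp
    | cons b m ih =>
      intro s
      have h1 := ih (f a s b)
      have h2 := hc a s b
      simp only [List.foldl_cons, size_cons]
      have : (size b + size m + 1) * (c + 1) = size b * c + size b + size m * (c + 1) + c + 1 := by
        ring
      omega
  refine ⟨q + p * (Polynomial.C (c + 1)), fun a i => (key a _ _).trans ?_⟩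
  have h1 : size ((l a).take i) ≤ size (l a) := by
    conv_rhs => rw [← List.take_append_drop i (l a)]
    generalize (l a).take i = m
    induction m with
    | nil => exact size_pos _
    | cons b m ih => simp; omega
  have h2 := Nat.mul_le_mul_right (c + 1) (h1.trans (hp a))
  have h3 := hq a
  simp only [Polynomial.eval_add, Polynomial.eval_mul, Polynomial.eval_C]
  omega

/-- Here the result of a step is bounded independently of the accumulator. The main loops of the
algorithm are of this kind, since each of their steps ends with `compress`. -/
theorem foldl_of_bounded {l : α → List β} {s : α → γ} {f : α → γ → β → γ} (hl : PolyTime l)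
    (hs : PolyTime s) (hf : PolyTime (fun x : α × γ × β => f x.1 x.2.1 x.2.2))
    (hp : ∃ p : Polynomial ℕ, ∀ a s b, size (f a s b) ≤ p.eval (size a)) :
    PolyTime (fun a => (l a).foldl (f a) (s a)) := by
  refine foldl hl hs hf ?_
  obtain ⟨p, hp⟩ := hp
  obtain ⟨q, hq⟩ := hs.size_le
  refine ⟨p + q, fun a i => ?_⟩
  have h1 := hq a
  simp only [Polynomial.eval_add]
  induction (l a).take i using List.reverseRecOn with
  | nil => simp; omega
  | append_singleton m b _ =>
    have := hp a (m.foldl (f a) (s a)) b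
    simp
    omega

theorem reverse {l : α → List β} (hl : PolyTime l) : PolyTime (fun a => (l a).reverse) := by
  convert foldl_of_linear (f := fun _ s b => b :: s) hl (const []) (arg.snd.snd.cons arg.snd.fst)
    (c := 1) (fun _ s b => by simp; omega) using 2 with a
  simp

theorem append {l l' : α → List β} (hl : PolyTime l) (hl' : PolyTime l') :
    PolyTime (fun a => l a ++ l' a) := by
  convert foldl_of_linear (f := fun _ s b => b :: s) hl.reverse hl' (arg.snd.snd.cons arg.snd.fst)
    (c := 1) (fun _ s b => by simp; omega) using 2 with a
  simp

theorem flatMap {l : α → List β} {g : α → β → List γ} (hl : PolyTime l)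
    (hg : PolyTime (fun x : α × β => g x.1 x.2)) : PolyTime (fun a => (l a).flatMap (g a)) := by
  have key : ∀ a (m : List β) s,
      m.foldl (fun (s : List γ) b => s ++ g a b) s = s ++ m.flatMap (g a) := by
    intro a m
    induction m with
    | nil => simp
    | cons b m ih => intro s; simp [ih]
  convert foldl (f := fun a s b => s ++ g a b) hl (const [])
    (arg.snd.fst.append (hg.comp (arg.fst.pair arg.snd.snd))) ?_ using 2 with a
  · simp [key]
  · obtain ⟨p, hp⟩ := hl.size_le
    obtain ⟨q, hq⟩ := hg.size_le
    refine ⟨p * q.comp (.X + p + 1) + 1, fun a i => ?_⟩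
    rw [key, List.nil_append]
    have h1 : ∀ b ∈ (l a).take i, size (g a b) ≤ (q.comp (.X + p + 1)).eval (size a) := by
      intro b hb
      have h1 := hq (a, b)
      have h2 := (size_le_of_mem (List.mem_of_mem_take hb)).trans (hp a)
      refine h1.trans ?_
      rw [Polynomial.eval_comp]
      exact eval_mono q (by simp; omega)
    refine (size_flatMap_le h1).trans ?_
    have h2 : ((l a).take i).length ≤ p.eval (size a) :=
      (List.length_take_le' i (l a)).trans ((length_le_size _).trans (hp a))
    have := Nat.mul_le_mul_right ((q.comp (.X + p + 1)).eval (size a)) h2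
    simp only [Polynomial.eval_add, Polynomial.eval_mul, Polynomial.eval_one]
    omega

theorem map {l : α → List β} {g : α → β → γ} (hl : PolyTime l)
    (hg : PolyTime (fun x : α × β => g x.1 x.2)) : PolyTime (fun a => (l a).map (g a)) := by
  convert hl.flatMap (g := fun a b => [g a b]) (hg.cons (const [])) using 2 with a
  exact List.map_eq_flatMap

theorem filter {l : α → List β} {g : α → β → Bool} (hl : PolyTime l)
    (hg : PolyTime (fun x : α × β => g x.1 x.2)) : PolyTime (fun a => (l a).filter (g a)) := by
  convert hl.flatMap (g := fun a b => if g a b then [b] else [])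
    (hg.ite (arg.snd.cons (const [])) (const [])) using 2 with a
  induction l a with
  | nil => rfl
  | cons b m ih =>
    cases h : g a b <;> simp [h, ih]

theorem find? {l : α → List β} {g : α → β → Bool} (hl : PolyTime l)
    (hg : PolyTime (fun x : α × β => g x.1 x.2)) : PolyTime (fun a => (l a).find? (g a)) := by
  convert (hl.filter hg).head? using 2 with a
  simp

theorem not {f : α → Bool} (hf : PolyTime f) : PolyTime (fun a => !f a) :=
  (of_finite (fun b : Bool => !b)).comp hf

theorem all {l : α → List β} {g : α → β → Bool} (hl : PolyTime l)
    (hg : PolyTime (fun x : α × β => g x.1 x.2)) : PolyTime (fun a => (l a).all (g a)) := by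
  convert (hl.filter (g := fun a b => !g a b) hg.not).isEmpty using 2 with a
  rw [Bool.eq_iff_iff]
  simp [List.filter_eq_nil_iff]

theorem length {l : α → List β} (hl : PolyTime l) : PolyTime (fun a => (l a).length) := by
  convert foldl_of_linear (f := fun _ (s : ℕ) _ => s + 1) hl (const 0) arg.snd.fst.succ
    (c := 2) (fun _ s b => by simp; omega) using 2 with a
  generalize l a = m
  have : ∀ (m : List β) s, m.foldl (fun (s : ℕ) _ => s + 1) s = s + m.length := by
    intro m
    induction m with
    | nil => simp
    | cons b m ih => intro s; simp [ih]; omega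
  simp [this]

theorem replicate_leaf {n : α → ℕ} (hn : PolyTime n) :
    PolyTime (fun a => List.replicate (n a) Tree.leaf) := by
  refine of_enc ?_
  convert hn.enc_comp using 2 with a
  induction n a with
  | zero => rfl
  | succ n ih => exact congrArg (Tree.node .leaf) ih

theorem range {n : α → ℕ} (hn : PolyTime n) : PolyTime (fun a => List.range (n a)) := by
  have key : ∀ n, (List.replicate n Tree.leaf).foldl (fun (s : List ℕ) _ => s ++ [s.length]) [] =
      List.range n := by
    intro n
    induction n with
    | zero => rfl
    | succ n ih => rw [List.replicate_succ', List.foldl_append, ih]; simp [List.range_succ]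
  convert foldl (f := fun _ (s : List ℕ) _ => s ++ [s.length]) hn.replicate_leaf (const [])
    (arg.snd.fst.append (arg.snd.fst.length.cons (const []))) ?_ using 2 with a
  · exact (key _).symm
  · obtain ⟨p, hp⟩ := hn.size_le
    refine ⟨p * (2 * p + 1 + 1) + 1, fun a i => ?_⟩
    rw [List.take_replicate, key]
    have h := hp a
    rw [size_nat] at h
    have h1 : min i (n a) ≤ p.eval (size a) := by omega
    refine (size_le_of_forall (M := 2 * p.eval (size a) + 1) fun j hj => ?_).trans ?_
    · rw [List.mem_range] at hj
      rw [size_nat]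
      omega
    · rw [List.length_range]
      have := Nat.mul_le_mul_right (2 * p.eval (size a) + 1 + 1) h1
      simp
      omega

theorem drop {l : α → List β} {n : α → ℕ} (hl : PolyTime l) (hn : PolyTime n) :
    PolyTime (fun a => (l a).drop (n a)) := by
  convert foldl_of_linear (f := fun _ (s : List β) _ => s.tail) hn.replicate_leaf hl
    arg.snd.fst.tail (c := 0) (fun _ s b => by
      have := size_drop_le s 1
      rw [List.drop_one] at this
      omega) using 2 with a
  generalize l a = m
  induction n a generalizing m with
  | zero => rfl
  | succ n ih => simp [List.replicate_succ, ← ih]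

theorem getElem? {l : α → List β} {n : α → ℕ} (hl : PolyTime l) (hn : PolyTime n) :
    PolyTime (fun a => (l a)[n a]?) := by
  convert (hl.drop hn).head? using 2 with a
  simp

theorem toList {o : α → Option β} (ho : PolyTime o) : PolyTime (fun a => (o a).toList) := by
  convert ho.optionElim (const []) (g := fun _ b => [b]) (arg.snd.cons (const [])) using 2 with a
  cases o a <;> rfl

theorem take {l : α → List β} {n : α → ℕ} (hl : PolyTime l) (hn : PolyTime n) :
    PolyTime (fun a => (l a).take (n a)) := by
  convert hn.range.flatMap (g := fun a i => (l a)[i]?.toList)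
    ((hl.comp arg.fst).getElem? arg.snd).toList using 2 with a
  generalize l a = m
  induction n a generalizing m with
  | zero => rfl
  | succ n ih =>
    cases m with
    | nil => simp
    | cons b m => simp [List.range_succ_eq_map, List.flatMap_map, ih]

theorem zipWith {l : α → List β} {l' : α → List γ} {g : α → β → γ → δ} (hl : PolyTime l)
    (hl' : PolyTime l') (hg : PolyTime (fun x : α × β × γ => g x.1 x.2.1 x.2.2)) :
    PolyTime (fun a => List.zipWith (g a) (l a) (l' a)) := by
  have h1 : PolyTime (fun x : (α × ℕ) × β =>
      ((l' x.1.1)[x.1.2]?).toList.map (fun c => g x.1.1 x.2 c)) :=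
    ((hl'.comp arg.fst.fst).getElem? arg.fst.snd).toList.map
      (hg.comp (arg.fst.fst.fst.pair (arg.fst.snd.pair arg.snd)))
  convert hl.length.range.flatMap
    (g := fun a i => (l a)[i]?.toList.flatMap
      (fun b => ((l' a)[i]?).toList.map (fun c => g a b c)))
    (((hl.comp arg.fst).getElem? arg.snd).toList.flatMap h1) using 2 with a
  generalize l a = m
  generalize l' a = m'
  induction m generalizing m' with
  | nil => simp
  | cons b m ih =>
    cases m' with
    | nil => simp
    | cons c m' =>
      simp [List.range_succ_eq_map, List.flatMap_map, ih]

end PolyTime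

end StackProgram

/-! ### The algorithm on representations and its running time. -/

namespace GMMCSP

open StackProgram

/-- A list of the elements of a finite type. -/
noncomputable def elements (A : Type) [Finite A] : List A :=
  have := Fintype.ofFinite A
  (Finset.univ : Finset A).toList

theorem mem_elements {A : Type} [Finite A] (a : A) : a ∈ elements A := by
  simp [elements]

noncomputable instance {A : Type} [Finite A] {m : ℕ} : Enc (Fin m → A) := Enc.ofFinite _

section Algorithm

variable {A : Type} [Finite A] {k : ℕ}

/-- The lists of the columns of all `m × N` matrices whose rows are elements of `U`. -/
def columns (N : ℕ) (U : List (List A)) : (m : ℕ) → List (List (Fin m → A))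
  | 0 => [(List.range N).map fun _ => Fin.elim0]
  | m + 1 => U.flatMap fun t => (columns N U m).map fun c =>
      List.zipWith (fun a v => (Fin.cons a v : Fin (m + 1) → A)) t c

/-- Add the values of `φ` at all `k`-tuples of elements of `U`. -/
def expand (φ : (Fin k → A) → A) (N : ℕ) (U : List (List A)) : List (List A) :=
  U ++ (columns N U k).map fun c => c.map φ

/-- The lists of at most `m` pairs of a coordinate and a value. -/
noncomputable def queries (A : Type) [Finite A] (N : ℕ) : ℕ → List (List (ℕ × A))
  | 0 => [[]]
  | m + 1 => queries A N m ++ (List.range N).flatMap fun i => (elements A).flatMap fun a =>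
      (queries A N m).map fun q => (i, a) :: q

open Classical in
/-- The tuple `t` has the values prescribed by `q`. -/
noncomputable def satisfies (q : List (ℕ × A)) (t : List A) : Bool :=
  q.all fun x => decide (t[x.1]? = some x.2)

open Classical in
/-- The tuples of the pair `x` agree before the coordinate `i`, where they are `a` and `b`. -/
noncomputable def forks (i : ℕ) (a b : A) (x : List A × List A) : Bool :=
  decide (x.1[i]? = some a) && decide (x.2[i]? = some b) &&
    (List.range i).all fun j => decide (x.1[j]? = x.2[j]?)

/-- All pairs of elements of a list. -/
def pairs {B : Type} (W : List B) : List (B × B) := W.flatMap fun t => W.map fun t' => (t, t')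

/-- A short sublist of `W` with the same projections to at most `m` coordinates, and the same
forks. -/
noncomputable def compress (m N : ℕ) (W : List (List A)) : List (List A) :=
  ((queries A N m).flatMap fun q => (W.find? (satisfies q)).toList.map fun t => t.take N) ++
    (List.range N).flatMap fun i => (elements (A × A)).flatMap fun ab =>
      ((pairs W).find? (forks i ab.1 ab.2)).toList.flatMap fun x => [x.1.take N, x.2.take N]

/-- The number of rounds after which `expand` does not give new projections to at most `k + 1`
coordinates, with two rounds more. -/
@[irreducible] noncomputable def rounds (A : Type) (k : ℕ) : ℕ := (Nat.card A + 1) ^ (k + 1) + 2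

noncomputable def generate (φ : (Fin k → A) → A) (N : ℕ) (U : List (List A)) : List (List A) :=
  (expand φ N)^[rounds A k] U

open Classical in
/-- Pass to the tuples whose coordinate `j` is `v`. -/
noncomputable def fixCoord (φ : (Fin k → A) → A) (N : ℕ) (U : List (List A)) (j : ℕ)
    (v : Option A) : List (List A) :=
  compress (k - 1) N ((generate φ N U).filter fun t => decide (t[j]? = v))

/-- Pass to the tuples which agree with `t` before the coordinate `i`. -/
noncomputable def fixPrefix (φ : (Fin k → A) → A) (N : ℕ) (U : List (List A)) (t : List A)
    (i : ℕ) : List (List A) :=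
  (List.range i).foldl (fun V j => fixCoord φ N V j t[j]?) U

open Classical in
/-- Pass to the tuples whose coordinates `p` and `q` are equal. -/
noncomputable def equate (φ : (Fin k → A) → A) (N : ℕ) (U : List (List A)) (p q : ℕ) :
    List (List A) :=
  let W := (generate φ N U).filter fun t => decide (t[p]? = t[q]?)
  compress (k - 1) N (W ++ (W.flatMap fun t => (List.range N).flatMap fun i =>
    generate φ N (fixPrefix φ N U t i)).filter fun t => decide (t[p]? = t[q]?))

/-- Pass to the concatenations with the tuples of `S`. -/
noncomputable def extend (k N : ℕ) (U S : List (List A)) : List (List A) :=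
  compress (k - 1) N (U.flatMap fun t => S.map fun s => t ++ s)

/-- Decide whether the product of the relations in `blocks` contains a tuple which satisfies the
equations in `eqs` between its coordinates. -/
noncomputable def solve (φ : (Fin k → A) → A) (N : ℕ) (blocks : List (List (List A)))
    (eqs : List (ℕ × ℕ)) : Bool :=
  !(eqs.foldl (fun U e => equate φ N U e.1 e.2) (blocks.foldl (extend k N) [[]])).isEmpty

variable [Enc A]

open Classical PolyTime

theorem polyTime_optionEq {α : Type} [Enc α] {f g : α → Option A} (hf : PolyTime f)
    (hg : PolyTime g) : PolyTime (fun a => decide (f a = g a)) :=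
  (of_finite (fun x : Option A × Option A => decide (x.1 = x.2))).comp (hf.pair hg)

/-- The number `m` of rows is fixed, so the recursion on it is a finite composition; the output has
about the `m`-th power of the number of tuples. -/
theorem polyTime_columns (m : ℕ) :
    PolyTime (fun x : ℕ × List (List A) => columns x.1 x.2 m) := by
  induction m with
  | zero => exact (arg.fst.range.map (const _)).cons (const [])
  | succ m ih =>
    refine arg.snd.flatMap ((ih.comp arg.fst).map ?_)
    refine PolyTime.zipWith arg.fst.snd arg.snd
      (g := fun _ a v => (Fin.cons a v : Fin (m + 1) → A)) ?_
    exact (of_finite (fun x : A × (Fin m → A) => (Fin.cons x.1 x.2 : Fin (m + 1) → A))).comp arg.snd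

theorem polyTime_expand (φ : (Fin k → A) → A) :
    PolyTime (fun x : ℕ × List (List A) => expand φ x.1 x.2) :=
  arg.snd.append ((polyTime_columns k).map (arg.snd.map ((of_finite φ).comp arg.snd)))

/-- The number of rounds depends on `A` and `k` only, so this is again a finite composition. -/
theorem polyTime_generate (φ : (Fin k → A) → A) :
    PolyTime (fun x : ℕ × List (List A) => generate φ x.1 x.2) := by
  unfold generate
  induction rounds A k with
  | zero => exact arg.snd
  | succ n ih =>
    simp only [Function.iterate_succ_apply']
    exact (polyTime_expand φ).comp (arg.fst.pair ih)

attribute [local irreducible] generate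

theorem polyTime_queries (m : ℕ) : PolyTime (fun N : ℕ => queries A N m) := by
  induction m with
  | zero => exact const _
  | succ m ih =>
    refine ih.append (arg.range.flatMap ((const (elements A)).flatMap ?_))
    exact (ih.comp arg.fst.fst).map ((arg.fst.fst.snd.pair arg.fst.snd).cons arg.snd)

theorem polyTime_satisfies :
    PolyTime (fun x : List (ℕ × A) × List A => satisfies x.1 x.2) :=
  arg.fst.all (polyTime_optionEq (arg.fst.snd.getElem? arg.snd.fst) arg.snd.snd.optionSome)

theorem polyTime_forks :
    PolyTime (fun x : (ℕ × A × A) × List A × List A => forks x.1.1 x.1.2.1 x.1.2.2 x.2) :=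
  ((polyTime_optionEq (arg.snd.fst.getElem? arg.fst.fst) arg.fst.snd.fst.optionSome).and
    (polyTime_optionEq (arg.snd.snd.getElem? arg.fst.fst) arg.fst.snd.snd.optionSome)).and
    (arg.fst.fst.range.all (polyTime_optionEq (arg.fst.snd.fst.getElem? arg.snd)
      (arg.fst.snd.snd.getElem? arg.snd)))

theorem polyTime_pairs {B : Type} [Enc B] : PolyTime (pairs : List B → List (B × B)) :=
  arg.flatMap (arg.fst.map (arg.fst.snd.pair arg.snd))

theorem polyTime_compress (m : ℕ) :
    PolyTime (fun x : ℕ × List (List A) => compress m x.1 x.2) := by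
  refine (((polyTime_queries m).comp arg.fst).flatMap ?_).append
    (arg.fst.range.flatMap ((const (elements (A × A))).flatMap ?_))
  · exact (arg.fst.snd.find? (polyTime_satisfies.comp (arg.fst.snd.pair arg.snd))).toList.map
      (arg.snd.take arg.fst.fst.fst)
  · refine ((polyTime_pairs.comp arg.fst.fst.snd).find?
      (polyTime_forks.comp ((arg.fst.fst.snd.pair arg.fst.snd).pair arg.snd))).toList.flatMap ?_
    exact (arg.snd.fst.take arg.fst.fst.fst.fst).cons
      ((arg.snd.snd.take arg.fst.fst.fst.fst).cons (const []))

/-- The bound does not involve `W`: at most one tuple is kept for each query, and at most one pair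
for each coordinate and pair of values. Cutting tuples to length `N` changes nothing on the lists
that occur, but makes the bound hold for all `W`. -/
theorem size_compress_le (m : ℕ) :
    ∃ p : Polynomial ℕ, ∀ (N : ℕ) (W : List (List A)), size (compress m N W) ≤ p.eval (size N) := by
  obtain ⟨p, hp⟩ := (polyTime_queries (A := A) m).size_le
  obtain ⟨M, hM⟩ := exists_size_le A
  let T : Polynomial ℕ := .X * (Polynomial.C M + 1) + 1
  have hT : ∀ (N : ℕ) (t : List A), size (t.take N) ≤ T.eval (size N) := by
    intro N t
    refine (size_le_of_forall fun a _ => hM a).trans ?_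
    have h : (t.take N).length ≤ size N := (List.length_take_le N t).trans (by simp; omega)
    have := Nat.mul_le_mul_right (M + 1) h
    simp only [T, Polynomial.eval_add, Polynomial.eval_mul, Polynomial.eval_X, Polynomial.eval_C,
      Polynomial.eval_one]
    omega
  refine ⟨p * (T + 3) + 1 + (.X * (Polynomial.C (elements (A × A)).length * (2 * T + 5) + 1) + 1),
    fun N W => (size_append_le _ _).trans ?_⟩
  have h1 : size ((queries A N m).flatMap fun q =>
      (W.find? (satisfies q)).toList.map fun t => t.take N) ≤
      p.eval (size N) * (T.eval (size N) + 3) + 1 := by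
    refine (size_flatMap_le (M := T.eval (size N) + 3) fun q _ => ?_).trans ?_
    · cases W.find? (satisfies q) with
      | none => simp
      | some t =>
        have := hT N t
        simp only [Option.toList_some, List.map_cons, List.map_nil, size_cons, size_nil]
        omega
    · have := Nat.mul_le_mul_right (T.eval (size N) + 3) ((length_le_size _).trans (hp N))
      omega
  have h2 : size ((List.range N).flatMap fun i => (elements (A × A)).flatMap fun ab =>
      ((pairs W).find? (forks i ab.1 ab.2)).toList.flatMap fun x => [x.1.take N, x.2.take N]) ≤
      size N * ((elements (A × A)).length * (2 * T.eval (size N) + 5) + 1) + 1 := by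
    refine (size_flatMap_le fun i _ => size_flatMap_le (M := 2 * T.eval (size N) + 5)
      fun ab _ => ?_).trans ?_
    · cases (pairs W).find? (forks i ab.1 ab.2) with
      | none => simp
      | some x =>
        have := hT N x.1
        have := hT N x.2
        simp only [Option.toList_some, List.flatMap_cons, List.flatMap_nil, List.append_nil,
          size_cons, size_nil]
        omega
    · rw [List.length_range]
      have := Nat.mul_le_mul_right ((elements (A × A)).length * (2 * T.eval (size N) + 5) + 1)
        (show N ≤ size N by simp; omega)
      omega
  simp only [Polynomial.eval_add, Polynomial.eval_mul, Polynomial.eval_X, Polynomial.eval_C,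
    Polynomial.eval_one, Polynomial.eval_ofNat]
  omega

attribute [local irreducible] compress

theorem size_compress_le_of_fst {α : Type} [Enc α] (m : ℕ) {N : α → ℕ} (hN : PolyTime N) :
    ∃ p : Polynomial ℕ, ∀ a (W : List (List A)), size (compress m (N a) W) ≤ p.eval (size a) := by
  obtain ⟨p, hp⟩ := size_compress_le (A := A) m
  obtain ⟨q, hq⟩ := hN.size_le
  refine ⟨p.comp q, fun a W => (hp _ _).trans ?_⟩
  rw [Polynomial.eval_comp]
  exact eval_mono p (hq a)

theorem polyTime_fixCoord (φ : (Fin k → A) → A) :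
    PolyTime (fun x : (ℕ × List (List A)) × ℕ × Option A =>
      fixCoord φ x.1.1 x.1.2 x.2.1 x.2.2) :=
  (polyTime_compress (k - 1)).comp (arg.fst.fst.pair (((polyTime_generate φ).comp arg.fst).filter
    (polyTime_optionEq (arg.snd.getElem? arg.fst.snd.fst) arg.fst.snd.snd)))

attribute [local irreducible] fixCoord

theorem polyTime_fixPrefix (φ : (Fin k → A) → A) :
    PolyTime (fun x : (ℕ × List (List A)) × List A × ℕ =>
      fixPrefix φ x.1.1 x.1.2 x.2.1 x.2.2) := by
  refine foldl_of_bounded (f := fun (x : (ℕ × List (List A)) × List A × ℕ) V j =>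
    fixCoord φ x.1.1 V j x.2.1[j]?) arg.snd.snd.range arg.fst.snd ?_ ?_
  · exact (polyTime_fixCoord φ).comp ((arg.fst.fst.fst.pair arg.snd.fst).pair
      (arg.snd.snd.pair (arg.fst.snd.fst.getElem? arg.snd.snd)))
  · obtain ⟨p, hp⟩ := size_compress_le_of_fst (A := A) (k - 1)
      (arg (α := (ℕ × List (List A)) × List A × ℕ)).fst.fst
    exact ⟨p, fun a _ _ => by unfold fixCoord; exact hp a _⟩

attribute [local irreducible] fixPrefix

theorem polyTime_equate (φ : (Fin k → A) → A) :
    PolyTime (fun x : (ℕ × List (List A)) × ℕ × ℕ => equate φ x.1.1 x.1.2 x.2.1 x.2.2) := by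
  have hW : PolyTime (fun x : (ℕ × List (List A)) × ℕ × ℕ =>
      (generate φ x.1.1 x.1.2).filter fun t => decide (t[x.2.1]? = t[x.2.2]?)) :=
    ((polyTime_generate φ).comp arg.fst).filter (polyTime_optionEq (arg.snd.getElem? arg.fst.snd.fst)
      (arg.snd.getElem? arg.fst.snd.snd))
  refine (polyTime_compress (k - 1)).comp (arg.fst.fst.pair (hW.append ?_))
  refine (hW.flatMap (arg.fst.fst.fst.range.flatMap ?_)).filter
    (polyTime_optionEq (arg.snd.getElem? arg.fst.snd.fst) (arg.snd.getElem? arg.fst.snd.snd))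
  exact (polyTime_generate φ).comp (arg.fst.fst.fst.fst.pair ((polyTime_fixPrefix φ).comp
    (arg.fst.fst.fst.pair (arg.fst.snd.pair arg.snd))))

theorem polyTime_extend : PolyTime (fun x : (ℕ × List (List A)) × List (List A) =>
    extend k x.1.1 x.1.2 x.2) :=
  (polyTime_compress (k - 1)).comp (arg.fst.fst.pair (arg.fst.snd.flatMap
    ((arg.fst.snd).map (arg.fst.snd.append arg.snd))))

attribute [local irreducible] extend equate

theorem polyTime_solve (φ : (Fin k → A) → A) :
    PolyTime (fun x : ℕ × List (List (List A)) × List (ℕ × ℕ) => solve φ x.1 x.2.1 x.2.2) := by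
  obtain ⟨p, hp⟩ := size_compress_le_of_fst (A := A) (k - 1)
    (arg (α := ℕ × List (List (List A)) × List (ℕ × ℕ))).fst
  have h1 : PolyTime (fun x : ℕ × List (List (List A)) × List (ℕ × ℕ) =>
      x.2.1.foldl (extend k x.1) [[]]) :=
    foldl_of_bounded arg.snd.fst (const _) (polyTime_extend.comp
      ((arg.fst.fst.pair arg.snd.fst).pair arg.snd.snd))
      ⟨p, fun a _ _ => by unfold extend; exact hp a _⟩
  have h2 := foldl_of_bounded (f := fun (x : ℕ × List (List (List A)) × List (ℕ × ℕ)) U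
    (e : ℕ × ℕ) => equate φ x.1 U e.1 e.2) arg.snd.snd h1 ((polyTime_equate φ).comp
      ((arg.fst.fst.pair arg.snd.fst).pair arg.snd.snd))
      ⟨p, fun a _ _ => by unfold equate; exact hp a _⟩
  exact h2.isEmpty.not

end Algorithm

end GMMCSP

/-! ### Reading an instance from its word, and the decision procedure. -/

namespace GMMCSP

open StackProgram

variable {A : Type} [Finite A] {k : ℕ}

instance : Finite (Symbol A) := by
  refine Finite.of_surjective (α := Option (Option (Option (Option A)))) (fun x => match x with
    | none => .tick
    | some none => .newConstraint
    | some (some none) => .newVar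
    | some (some (some none)) => .newTuple
    | some (some (some (some a))) => .val a) fun s => ?_
  cases s with
  | tick => exact ⟨none, rfl⟩
  | newConstraint => exact ⟨some none, rfl⟩
  | newVar => exact ⟨some (some none), rfl⟩
  | newTuple => exact ⟨some (some (some none)), rfl⟩
  | val a => exact ⟨some (some (some (some a))), rfl⟩

noncomputable instance : Enc (Symbol A) := Enc.ofFinite _

/-- What has been read of an instance, from right to left: the number of ticks, the end of the
scope, the end of the tuple, and the end of the list of tuples read last, and the constraints. -/
abbrev ParseState (A : Type) : Type :=
  ℕ × List ℕ × List A × List (List A) × List (List ℕ × List (List A))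

def readSymbol (x : ParseState A) : Symbol A → ParseState A
  | .tick => (x.1 + 1, x.2)
  | .newVar => (0, x.1 :: x.2.1, x.2.2)
  | .val a => (x.1, x.2.1, a :: x.2.2.1, x.2.2.2)
  | .newTuple => (x.1, x.2.1, [], x.2.2.1 :: x.2.2.2.1, x.2.2.2.2)
  | .newConstraint => (x.1, [], x.2.2.1, [], (x.2.1, x.2.2.2.1) :: x.2.2.2.2)

def parseWord (w : List (Symbol A)) : ParseState A :=
  w.reverse.foldl readSymbol (0, [], [], [], [])

/-- The variables at the coordinates of the product of the relations of an instance, where one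
unary relation for each variable comes first. -/
def coordVars (n : ℕ) (cs : List (List ℕ × List (List A))) : List ℕ :=
  List.range n ++ cs.flatMap fun c => c.1

/-- The relations of an instance, where one unary relation for each variable comes first. -/
noncomputable def blocks (n : ℕ) (cs : List (List ℕ × List (List A))) : List (List (List A)) :=
  ((List.range n).map fun _ => (elements A).map fun a => [a]) ++ cs.map fun c => c.2

/-- The equations of each coordinate with the coordinate of its variable. -/
def equations (vars : List ℕ) : List (ℕ × ℕ) :=
  (List.range vars.length).flatMap fun q => vars[q]?.toList.map fun p => (p, q)

noncomputable def decideInstance (φ : (Fin k → A) → A) (n : ℕ)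
    (cs : List (List ℕ × List (List A))) : Bool :=
  solve φ (coordVars n cs).length (blocks n cs) (equations (coordVars n cs))

noncomputable def decideWord (φ : (Fin k → A) → A) (w : List (Symbol A)) : Bool :=
  decideInstance φ (parseWord w).1 (parseWord w).2.2.2.2

section PolyTime

variable [Enc A]

open PolyTime

theorem polyTime_readSymbol :
    PolyTime (fun x : ParseState A × Symbol A => readSymbol x.1 x.2) := by
  classical
  have his : ∀ s : Symbol A, PolyTime (fun x : ParseState A × Symbol A => decide (x.2 = s)) :=
    fun s => (of_finite fun s' : Symbol A => decide (s' = s)).comp arg.snd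
  have hval : PolyTime (fun x : ParseState A × Symbol A =>
      (match x.2 with | .val a => some a | _ => none : Option A)) :=
    (of_finite fun s : Symbol A => (match s with | .val a => some a | _ => none : Option A)).comp
      arg.snd
  have key := (his .tick).ite (arg.fst.fst.succ.pair arg.fst.snd) ((his .newVar).ite
    ((const 0).pair ((arg.fst.fst.cons arg.fst.snd.fst).pair arg.fst.snd.snd)) ((his .newTuple).ite
    (arg.fst.fst.pair (arg.fst.snd.fst.pair ((const []).pair
      ((arg.fst.snd.snd.fst.cons arg.fst.snd.snd.snd.fst).pair arg.fst.snd.snd.snd.snd))))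
    (hval.optionElim (arg.fst.fst.pair ((const []).pair (arg.fst.snd.snd.fst.pair ((const []).pair
      ((arg.fst.snd.fst.pair arg.fst.snd.snd.snd.fst).cons arg.fst.snd.snd.snd.snd)))))
      (g := fun x a => (x.1.1, x.1.2.1, a :: x.1.2.2.1, x.1.2.2.2))
      (arg.fst.fst.fst.pair (arg.fst.fst.snd.fst.pair ((arg.snd.cons arg.fst.fst.snd.snd.fst).pair
        arg.fst.fst.snd.snd.snd))))))
  convert key using 2 with x
  obtain ⟨x, s⟩ := x
  cases s <;> simp [readSymbol]

/-- Each symbol only moves stored data and adds a bounded amount, so the state grows linearly. -/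
theorem polyTime_parseWord : PolyTime (parseWord : List (Symbol A) → ParseState A) := by
  obtain ⟨M, hM⟩ := exists_size_le A
  refine foldl_of_linear (f := fun (_ : List (Symbol A)) => readSymbol) arg.reverse (const _)
    (polyTime_readSymbol.comp arg.snd) (c := M + 10) ?_
  rintro w ⟨n, sc, v, ts, cs⟩ s
  cases s with
  | val a =>
    have := hM a
    simp [readSymbol]
    omega
  | _ => simp [readSymbol]; omega

theorem polyTime_coordVars {A : Type} [Enc A] :
    PolyTime (fun x : ℕ × List (List ℕ × List (List A)) => coordVars x.1 x.2) :=
  arg.fst.range.append (arg.snd.flatMap arg.snd.fst)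

theorem polyTime_blocks :
    PolyTime (fun x : ℕ × List (List ℕ × List (List A)) => blocks x.1 x.2) :=
  (arg.fst.range.map (const _)).append (arg.snd.map arg.snd.snd)

theorem polyTime_equations : PolyTime equations :=
  arg.length.range.flatMap ((arg.fst.getElem? arg.snd).toList.map (arg.snd.pair arg.fst.snd))

attribute [local irreducible] coordVars blocks equations solve

theorem polyTime_decideInstance (φ : (Fin k → A) → A) :
    PolyTime (fun x : ℕ × List (List ℕ × List (List A)) => decideInstance φ x.1 x.2) :=
  (polyTime_solve φ).comp (polyTime_coordVars.length.pair
    (polyTime_blocks.pair (polyTime_equations.comp polyTime_coordVars)))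

attribute [local irreducible] parseWord decideInstance

theorem polyTime_decideWord (φ : (Fin k → A) → A) : PolyTime (decideWord φ) :=
  (polyTime_decideInstance φ).comp
    (polyTime_parseWord.fst.pair polyTime_parseWord.snd.snd.snd.snd)

end PolyTime

end GMMCSP

/-! ### From polynomial-time functions to Turing machines. -/

namespace StackProgram

open Function Turing

/-- Replace the code of a Boolean on stack `0` by the Boolean. -/
def boolCmd : Cmd :=
  .popCase 0 .skip (.seq (clear 0) (.push 0 true)) (.push 0 false)

theorem execLe_boolCmd (S : Store) (β : Bool) :
    ExecLe boolCmd (frame S 0 (boolTree β).code [] [] []) 10 (frame S 0 [β] [] [] []) := by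
  cases β with
  | false =>
    refine (ExecLe.pop_false (l := []) (by simp [Tree.code, boolTree]) (t := 1) ?_).mono (by omega)
    simpa using execLe_push 0 false (frame S 0 [] [] [] [])
  | true =>
    refine (ExecLe.pop_true (l := [false, false]) (by simp [Tree.code, boolTree])
      (t := 6) ?_).mono (by omega)
    have h1 := execLe_clear 0 (frame S 0 [false, false] [] [] [])
    have h2 := execLe_push 0 true (frame S 0 [] [] [] [])
    simp at h1 h2 ⊢
    exact h1.seq h2

theorem flatMap_code_append {α : Type} [Enc α] (l : List α) :
    (l.flatMap fun a => true :: (Enc.enc a).code) ++ [false] = (Enc.enc l).code := by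
  induction l with
  | nil => rfl
  | cons a l ih =>
    rw [List.flatMap_cons, List.append_assoc, ih]
    simp [Enc.enc, encList, Tree.code]

open Classical in
/-- A decision problem is decided in polynomial time by a machine if a `PolyTime` function
decides it. -/
theorem PolyTime.tm2ComputableInPolyTime {α I : Type} [Finite I] [Enc I] {F : List I → Bool}
    (hF : PolyTime F) (ea : α → List I) (f : α → Bool) (h : ∀ a, F (ea a) = f a) :
    Nonempty (TM2ComputableInPolyTime ea Computability.encodeBool f) := by
  obtain ⟨c, p, hc⟩ := hF
  obtain ⟨M, hM⟩ := exists_size_le I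
  let s : Polynomial ℕ := .X * Polynomial.C (M + 1) + 1
  -- A list is coded by `true` and the code of the element for each entry, and a final `false`. The
  -- machine thus assembles the code of its input while reading, reversed on stack `1`; the program
  -- pushes the final `false` and moves everything to stack `0`, which restores the order.
  refine nonempty_tm2ComputableInPolyTime ea f (fun a => true :: (Enc.enc a).code)
    (.seq (.push 1 false) (.seq (move 1 0) (.seq (c 0) boolCmd)))
    (2 * s + p.comp s + 12) fun a => ?_
  have hs : size (ea a) ≤ s.eval (ea a).length := by
    simpa [s] using size_le_of_forall (l := ea a) fun b _ => hM b
  let S : Store := fun _ => []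
  have e0 : ∀ w, update S 0 w = frame S 0 w [] [] [] := by
    intro w
    funext j
    by_cases hj : j = 0
    · subst hj; simp
    · simp [S, frame, hj]
  have e1 : ∀ w, update S 1 w = frame S 0 [] w [] [] := by
    intro w
    funext j
    by_cases hj : j = 1
    · subst hj; simp [frame]
    · simp [S, frame, hj]
  have h1 := execLe_push 1 false (update S 1 ((ea a).flatMap fun a => true :: (Enc.enc a).code).reverse)
  have e2 : update (update S 1 ((ea a).flatMap fun a => true :: (Enc.enc a).code).reverse) 1
      (false :: update S 1 ((ea a).flatMap fun a => true :: (Enc.enc a).code).reverse 1) =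
      frame S 0 [] (Enc.enc (ea a)).code.reverse [] [] := by
    rw [update_idem, update_self, ← flatMap_code_append, e1]
    simp
  rw [e2] at h1
  have h2 := execLe_move (i := 1) (j := 0) (by omega)
    (frame S 0 [] (Enc.enc (ea a)).code.reverse [] [])
  have e3 : update (update (frame S 0 [] (Enc.enc (ea a)).code.reverse [] []) 1 []) 0
      ((frame S 0 [] (Enc.enc (ea a)).code.reverse [] [] 1).reverse ++
        frame S 0 [] (Enc.enc (ea a)).code.reverse [] [] 0) =
      frame S 0 (Enc.enc (ea a)).code [] [] [] := by
    have := update_frame_one (S := S) (b := 0) (w := []) (x := (Enc.enc (ea a)).code.reverse)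
      (y := []) (z := []) (v := [])
    rw [zero_add] at this
    rw [this, update_frame_zero]
    simp [frame]
  rw [e3] at h2
  have h3 := hc (ea a) 0 S
  have h4 := execLe_boolCmd S (F (ea a))
  rw [h] at h3 h4
  have h5 := h1.seq (h2.seq (h3.seq h4))
  rw [← e0] at h5
  refine h5.mono ?_
  have h6 : (frame S 0 [] (Enc.enc (ea a)).code.reverse [] [] 1).length = size (ea a) := by
    simp [frame, size, Tree.size]
  have h7 := eval_mono p hs
  rw [h6]
  simp only [Polynomial.eval_add, Polynomial.eval_mul, Polynomial.eval_comp,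
    Polynomial.eval_ofNat]
  omega

end StackProgram

/-! ### Representations of relations closed under a generalized majority-minority operation. -/

namespace GMMCSP

section Theory

variable {B : Type} {k : ℕ} {ψ : (Fin k → B) → B}

theorem IsMajorityPair.apply {a b : B} (h : IsMajorityPair ψ a b) {g : Fin k → B} {i : Fin k}
    (hi : g i = a) (hg : ∀ j, j ≠ i → g j = b) : ψ g = b := by
  convert h a (by simp) b (by simp) i using 2
  funext j
  by_cases hj : j = i
  · subst hj; simp [single, hi]
  · simp [single, hj, hg j hj]

theorem IsMinorityPair.apply {a b : B} (h : IsMinorityPair ψ a b) {g : Fin k → B} {i : Fin k}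
    (hi' : (i : ℕ) = 0 ∨ (i : ℕ) + 1 = k) (hi : g i = a) (hg : ∀ j, j ≠ i → g j = b) :
    ψ g = a := by
  convert h a (by simp) b (by simp) i hi' using 2
  funext j
  by_cases hj : j = i
  · subst hj; simp [single, hi]
  · simp [single, hj, hg j hj]

theorem IsMajorityPair.symm {a b : B} (h : IsMajorityPair ψ a b) : IsMajorityPair ψ b a := by
  intro x hx y hy
  exact h x (Set.pair_comm b a ▸ hx) y (Set.pair_comm b a ▸ hy)

theorem IsMinorityPair.symm {a b : B} (h : IsMinorityPair ψ a b) : IsMinorityPair ψ b a := by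
  intro x hx y hy
  exact h x (Set.pair_comm b a ▸ hx) y (Set.pair_comm b a ▸ hy)

theorem IsGMM.idem (hψ : IsGMM ψ) (b : B) : ψ (fun _ => b) = b := by
  have i : Fin k := ⟨0, by have := hψ.1; omega⟩
  rcases hψ.2 b b with h | h
  · exact h.apply (i := i) rfl fun _ _ => rfl
  · exact h.apply (i := ⟨0, i.pos⟩) (Or.inl rfl) rfl fun _ _ => rfl

theorem IsGMM.majority_self (hψ : IsGMM ψ) (b : B) : IsMajorityPair ψ b b := by
  intro x hx y hy i
  simp only [Set.mem_insert_iff, Set.mem_singleton_iff, or_self] at hx hy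
  subst hx hy
  simpa [single] using hψ.idem _

theorem IsGMM.minority (hψ : IsGMM ψ) {a b : B} (h : ¬IsMajorityPair ψ a b) : IsMinorityPair ψ a b :=
  (hψ.2 a b).resolve_left h

/-- The term `φ(y, x, …, x)`. -/
def selectTerm (hk : 3 ≤ k) (ψ : (Fin k → B) → B) (x y : B) : B :=
  ψ fun i => if i = ⟨0, by omega⟩ then y else x

/-- The term `φ(x, d(x, y), …, d(x, y), d(x, z))`, where `d(x, y) = φ(y, x, …, x)`. -/
def forkTerm (hk : 3 ≤ k) (ψ : (Fin k → B) → B) (x y z : B) : B :=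
  ψ fun i => if i = ⟨0, by omega⟩ then x else if i = ⟨k - 1, by omega⟩ then selectTerm hk ψ x z
    else selectTerm hk ψ x y

theorem selectTerm_of_majority {a b : B} (hk : 3 ≤ k) (h : IsMajorityPair ψ a b) :
    selectTerm hk ψ a b = a :=
  h.symm.apply (i := ⟨0, by omega⟩) (by simp) fun j hj => by simp [hj]

theorem selectTerm_of_minority {a b : B} (hk : 3 ≤ k) (h : IsMinorityPair ψ a b) :
    selectTerm hk ψ a b = b :=
  h.symm.apply (i := ⟨0, by omega⟩) (Or.inl rfl) (by simp) fun j hj => by simp [hj]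

theorem IsGMM.selectTerm_self (hψ : IsGMM ψ) (a : B) : selectTerm hψ.1 ψ a a = a :=
  selectTerm_of_majority _ (hψ.majority_self a)

/-- On a majority pair all arguments of the outer operation become `a`; on a minority pair they are
a, b, …, b. Hence, applied to a tuple and a fork, the term does not change the tuple before the
forking coordinate. -/
theorem IsGMM.forkTerm_right (hψ : IsGMM ψ) (a b : B) : forkTerm hψ.1 ψ a b b = a := by
  have hk := hψ.1
  by_cases h : IsMajorityPair ψ a b
  · unfold forkTerm
    rw [selectTerm_of_majority _ h]
    simpa using hψ.idem a
  · have h := hψ.minority h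
    unfold forkTerm
    rw [selectTerm_of_minority _ h]
    exact h.apply (i := ⟨0, by omega⟩) (Or.inl rfl) (by simp) fun j hj => by simp [hj]

/-- The outer arguments are a, …, a, b, with the odd one in the last position. At the forking
coordinate, this replaces the first value of the fork by the second. -/
theorem IsGMM.forkTerm_left (hψ : IsGMM ψ) {a b : B} (h : IsMinorityPair ψ a b) :
    forkTerm hψ.1 ψ a a b = b := by
  have hk := hψ.1
  unfold forkTerm
  rw [selectTerm_of_minority _ h, hψ.selectTerm_self]
  refine h.symm.apply (i := ⟨k - 1, by omega⟩) (Or.inr (by simp; omega)) ?_ fun j hj => ?_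
  · have : (⟨k - 1, by omega⟩ : Fin k) ≠ ⟨0, by omega⟩ := by simp; omega
    simp [this]
  · simp [hj]

/-- Application of an operation at each coordinate. -/
def pointwise (ψ : (Fin k → B) → B) (ts : Fin k → ℕ → B) : ℕ → B := fun j => ψ fun i => ts i j

def IsClosedUnder (ψ : (Fin k → B) → B) (R : Set (ℕ → B)) : Prop :=
  ∀ ts : Fin k → ℕ → B, (∀ i, ts i ∈ R) → pointwise ψ ts ∈ R

theorem IsClosedUnder.inter {R R' : Set (ℕ → B)} (h : IsClosedUnder ψ R)
    (h' : IsClosedUnder ψ R') : IsClosedUnder ψ (R ∩ R') :=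
  fun ts hts => ⟨h ts fun i => (hts i).1, h' ts fun i => (hts i).2⟩

/-- Add the values of `ψ` at the elements of `X`. -/
def expandSet (ψ : (Fin k → B) → B) (X : Set (ℕ → B)) : Set (ℕ → B) :=
  X ∪ {w | ∃ ts : Fin k → ℕ → B, (∀ i, ts i ∈ X) ∧ w = pointwise ψ ts}

theorem subset_expandSet (X : Set (ℕ → B)) : X ⊆ expandSet ψ X := Set.subset_union_left

theorem IsClosedUnder.expandSet_subset {R X : Set (ℕ → B)} (hR : IsClosedUnder ψ R) (h : X ⊆ R) :
    expandSet ψ X ⊆ R := by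
  rintro w (hw | ⟨ts, hts, rfl⟩)
  · exact h hw
  · exact hR ts fun i => h (hts i)

theorem IsClosedUnder.iterate_expandSet_subset {R X : Set (ℕ → B)} (hR : IsClosedUnder ψ R)
    (h : X ⊆ R) (n : ℕ) : (expandSet ψ)^[n] X ⊆ R := by
  induction n with
  | zero => exact h
  | succ n ih =>
    rw [Function.iterate_succ_apply']
    exact hR.expandSet_subset ih

theorem monotone_iterate_expandSet (X : Set (ℕ → B)) :
    Monotone fun n => (expandSet ψ)^[n] X := by
  refine monotone_nat_of_le_succ fun n => ?_
  rw [Function.iterate_succ_apply']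
  exact subset_expandSet _

theorem selectTerm_mem_expandSet (hk : 3 ≤ k) {X : Set (ℕ → B)} {s t : ℕ → B} (hs : s ∈ X)
    (ht : t ∈ X) : (fun j => selectTerm hk ψ (s j) (t j)) ∈ expandSet ψ X := by
  refine Or.inr ⟨fun i => if i = ⟨0, by omega⟩ then t else s, fun i => ?_, ?_⟩
  · dsimp only
    split_ifs <;> assumption
  · funext j
    simp only [selectTerm, pointwise]
    congr 1
    funext i
    split_ifs <;> rfl

theorem forkTerm_mem_expandSet (hk : 3 ≤ k) {X : Set (ℕ → B)} {s t u : ℕ → B} (hs : s ∈ X)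
    (ht : t ∈ X) (hu : u ∈ X) :
    (fun j => forkTerm hk ψ (s j) (t j) (u j)) ∈ expandSet ψ (expandSet ψ X) := by
  refine Or.inr ⟨fun i => if i = ⟨0, by omega⟩ then s else if i = ⟨k - 1, by omega⟩ then
    (fun j => selectTerm hk ψ (s j) (u j)) else (fun j => selectTerm hk ψ (s j) (t j)),
    fun i => ?_, ?_⟩
  · dsimp only
    split_ifs
    · exact subset_expandSet _ hs
    · exact selectTerm_mem_expandSet hk hs hu
    · exact selectTerm_mem_expandSet hk hs ht
  · funext j
    simp only [forkTerm, pointwise]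
    congr 1
    funext i
    split_ifs <;> rfl

theorem IsClosedUnder.selectTerm_mem {R : Set (ℕ → B)} (hR : IsClosedUnder ψ R) (hk : 3 ≤ k)
    {s t : ℕ → B} (hs : s ∈ R) (ht : t ∈ R) : (fun j => selectTerm hk ψ (s j) (t j)) ∈ R :=
  hR.expandSet_subset subset_rfl (selectTerm_mem_expandSet hk hs ht)

theorem IsClosedUnder.forkTerm_mem {R : Set (ℕ → B)} (hR : IsClosedUnder ψ R) (hk : 3 ≤ k)
    {s t u : ℕ → B} (hs : s ∈ R) (ht : t ∈ R) (hu : u ∈ R) :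
    (fun j => forkTerm hk ψ (s j) (t j) (u j)) ∈ R :=
  hR.expandSet_subset (hR.expandSet_subset subset_rfl) (forkTerm_mem_expandSet hk hs ht hu)

/-- All elements of `R` agree from the coordinate `N` on. -/
def IsBoundedBy (N : ℕ) (R : Set (ℕ → B)) : Prop := ∀ t ∈ R, ∀ t' ∈ R, ∀ j, N ≤ j → t j = t' j

/-- The subset `U` of `R` has the same projections to fewer than `k` coordinates, and the same
forks at minority pairs. -/
structure Represents (ψ : (Fin k → B) → B) (N : ℕ) (R U : Set (ℕ → B)) : Prop where
  subset : U ⊆ R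
  proj : ∀ t ∈ R, ∀ I : Finset ℕ, (∀ i ∈ I, i < N) → I.card ≤ k - 1 → ∃ u ∈ U, ∀ i ∈ I, u i = t i
  fork : ∀ i < N, ∀ t ∈ R, ∀ t' ∈ R, (∀ j < i, t j = t' j) → ¬IsMajorityPair ψ (t i) (t' i) →
    ∃ u ∈ U, ∃ u' ∈ U, (∀ j < i, u j = u' j) ∧ u i = t i ∧ u' i = t' i

variable {N : ℕ} {R U : Set (ℕ → B)}

/-- The step from agreement on the coordinates below `m` to agreement on the coordinates up to `m`
if the values at `m` are a majority pair. -/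
theorem Represents.exists_agree_of_majority (hψ : IsGMM ψ) (h : Represents ψ N R U)
    {C : Set (ℕ → B)} (hC : IsClosedUnder ψ C) (hUC : U ⊆ C) {t u₀ : ℕ → B} (ht : t ∈ R)
    (hu₀ : u₀ ∈ C) {m : ℕ} (hm : m < N) (hlt : ∀ j < m, u₀ j = t j)
    (hmaj : IsMajorityPair ψ (u₀ m) (t m)) (I : Finset ℕ) (hI : ∀ i ∈ I, i < m) :
    ∃ w ∈ C, (∀ i ∈ I, w i = t i) ∧ w m = t m := by
  induction I using Finset.strongInduction with
  | H I ih =>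
    -- For a small `I` there is room for `m` among the `k - 1` coordinates of a projection.
    rcases lt_or_ge I.card (k - 1) with hcard | hcard
    · obtain ⟨u, hu, hu'⟩ := h.proj t ht (insert m I) (by
        intro i hi
        rcases Finset.mem_insert.1 hi with rfl | hi
        · exact hm
        · exact (hI i hi).trans hm) ((Finset.card_insert_le _ _).trans hcard)
      exact ⟨u, hUC hu, fun i hi => hu' i (by simp [hi]), hu' m (by simp)⟩
    · obtain ⟨J, hJI, hJ⟩ := Finset.exists_subset_card_eq hcard
      obtain ⟨l, rfl⟩ : ∃ l, k = l + 1 := ⟨k - 1, by have := hψ.1; omega⟩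
      have hw : ∀ j ∈ J, ∃ w ∈ C, (∀ i ∈ I.erase j, w i = t i) ∧ w m = t m := fun j hj =>
        ih (I.erase j) (Finset.erase_ssubset (hJI hj))
          fun i hi => hI i (Finset.mem_of_mem_erase hi)
      have : Nonempty (ℕ → B) := ⟨t⟩
      choose! w hwC hwI hwm using hw
      let e := J.orderEmbOfFin hJ
      have he : ∀ i, e i ∈ J := fun i => Finset.orderEmbOfFin_mem J hJ i
      -- The arguments are `u₀` and, for each of the `k - 1` chosen `j`, the tuple d(w_j, u₀). At
      -- `j` the value of w_j is unknown, but d leaves it only if it forms a majority pair with `t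
      -- j` and otherwise replaces it by `t j`; the other arguments are `t j`, so the value is `t
      -- j`. At `m` only `u₀` can differ from `t`, and there the pair is a majority pair by `hmaj`.
      let ts : Fin (l + 1) → ℕ → B := Fin.cons u₀
        fun i j => selectTerm hψ.1 ψ (w (e i) j) (u₀ j)
      have hts : ∀ i, ts i ∈ C := by
        intro i
        refine Fin.cases ?_ (fun i => ?_) i
        · exact hu₀
        · exact hC.selectTerm_mem hψ.1 (hwC _ (he i)) hu₀
      have hts_succ : ∀ (i : Fin l) (j : ℕ), j ∈ I → j ≠ e i → ts i.succ j = t j := by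
        intro i j hj hji
        simp only [ts, Fin.cons_succ]
        rw [hwI _ (he i) j (Finset.mem_erase.2 ⟨hji, hj⟩), hlt j (hI j hj), hψ.selectTerm_self]
      refine ⟨pointwise ψ ts, hC ts hts, fun j hj => ?_, ?_⟩
      · by_cases hje : ∃ i, j = e i
        · obtain ⟨i, rfl⟩ := hje
          refine IsMajorityPair.apply (a := ts i.succ (e i)) (i := i.succ) ?_ rfl ?_
          · simp only [ts, Fin.cons_succ, hlt _ (hI _ hj)]
            by_cases hM : IsMajorityPair ψ (w (e i) (e i)) (t (e i))
            · rwa [selectTerm_of_majority _ hM]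
            · rw [selectTerm_of_minority _ (hψ.minority hM)]
              exact hψ.majority_self _
          · intro i'
            refine Fin.cases (fun _ => ?_) (fun i' hi' => ?_) i'
            · exact hlt _ (hI _ hj)
            · refine hts_succ i' _ hj fun he' => hi' ?_
              rw [e.injective he']
        · have : (fun i => ts i j) = fun _ => t j := by
            funext i
            refine Fin.cases ?_ (fun i => ?_) i
            · exact hlt j (hI j hj)
            · exact hts_succ i j hj fun h => hje ⟨i, h⟩
          simp only [pointwise, this]
          exact hψ.idem _
      · refine hmaj.apply (i := 0) rfl fun i => ?_
        refine Fin.cases (fun h => absurd rfl h) (fun i _ => ?_) i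
        simp only [ts, Fin.cons_succ]
        rw [hwm _ (he i)]
        exact selectTerm_of_majority _ hmaj.symm

/-- A representation generates the relation. -/
theorem Represents.subset_of_closed (hψ : IsGMM ψ) (h : Represents ψ N R U)
    (hR : IsClosedUnder ψ R) (hN : IsBoundedBy N R) {C : Set (ℕ → B)} (hC : IsClosedUnder ψ C)
    (hUC : U ⊆ C) : R ⊆ C := by
  intro t ht
  -- The approximations must stay in `R`, so that together with `t` they are forks of `R`.
  have hCR := hC.inter hR
  have hUCR : U ⊆ C ∩ R := Set.subset_inter hUC h.subset
  have key : ∀ m ≤ N, ∃ u ∈ C ∩ R, ∀ j < m, u j = t j := by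
    intro m
    induction m with
    | zero =>
      obtain ⟨u, hu, -⟩ := h.proj t ht ∅ (by simp) (by simp)
      exact fun _ => ⟨u, hUCR hu, by simp⟩
    | succ m ih =>
      intro hm
      obtain ⟨u₀, hu₀, hlt⟩ := ih (by omega)
      by_cases hmaj : IsMajorityPair ψ (u₀ m) (t m)
      · obtain ⟨w, hw, hw1, hw2⟩ := h.exists_agree_of_majority hψ hCR hUCR ht hu₀ (by omega) hlt
          hmaj (Finset.range m) (by simp)
        refine ⟨w, hw, fun j hj => ?_⟩
        rcases Nat.lt_succ_iff_lt_or_eq.1 hj with hj | rfl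
        · exact hw1 j (by simpa using hj)
        · exact hw2
      -- The values of `u₀` and `t` at `m` also occur at a fork `v`, `v'` in `U`; the fork term
      -- keeps `u₀` before `m` and corrects it at `m`.
      · obtain ⟨v, hv, v', hv', hvv, hvm, hvm'⟩ := h.fork m (by omega) u₀ hu₀.2 t ht hlt hmaj
        refine ⟨_, hCR.forkTerm_mem hψ.1 hu₀ (hUCR hv) (hUCR hv'), fun j hj => ?_⟩
        rcases Nat.lt_succ_iff_lt_or_eq.1 hj with hj | rfl
        · simp only [hvv j hj, hψ.forkTerm_right, hlt j hj]
        · simp only [hvm, hvm']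
          exact hψ.forkTerm_left (hψ.minority hmaj)
  obtain ⟨u, hu, hut⟩ := key N le_rfl
  have : u = t := by
    funext j
    rcases lt_or_ge j N with hj | hj
    · exact hut j hj
    · exact hN u hu.2 t ht j hj
  exact this ▸ hu.1

/-- The projections of `R` to at most `l` coordinates are generated in a constant number of
rounds. -/
theorem Represents.exists_agree [Finite B] [Nonempty B] (hψ : IsGMM ψ) (h : Represents ψ N R U)
    (hR : IsClosedUnder ψ R) (hN : IsBoundedBy N R) {t : ℕ → B} (ht : t ∈ R) {l : ℕ}
    (J : Finset ℕ) (hJ : J.card ≤ l) :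
    ∃ u ∈ (expandSet ψ)^[Nat.card B ^ l] U, ∀ j ∈ J, u j = t j := by
  let π : (ℕ → B) → (J → B) := fun u j => u j
  let X : ℕ → Set (ℕ → B) := fun n => (expandSet ψ)^[n] U
  have hX : Monotone X := monotone_iterate_expandSet U
  -- The projections to `J` form an increasing chain of subsets of a set with at most |B|^l
  -- elements, so some round adds none.
  obtain ⟨n, hn, hfix⟩ : ∃ n ≤ Nat.card B ^ l, π '' X (n + 1) ⊆ π '' X n := by
    by_contra! hne
    have hcard : ∀ n ≤ Nat.card B ^ l + 1, n ≤ (π '' X n).ncard := by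
      intro n
      induction n with
      | zero => simp
      | succ n ih =>
        intro hn
        refine (ih (by omega)).trans_lt (Set.ncard_lt_ncard ?_ (Set.toFinite _))
        exact ⟨Set.image_mono (hX (Nat.le_succ n)), hne n (by omega)⟩
    have h1 := hcard _ le_rfl
    have h2 := Set.ncard_le_card (π '' X (Nat.card B ^ l + 1))
    rw [Nat.card_fun, Nat.card_eq_fintype_card (α := J), Fintype.card_coe] at h2
    have h3 := Nat.pow_le_pow_right (Nat.card_pos (α := B)) hJ
    omega
  -- As the projection of `X n` is stable under one more round, its preimage is closed; it contains
  -- `U`, hence all of `R`.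
  have hC : IsClosedUnder ψ {w | π w ∈ π '' X n} := by
    intro ts hts
    choose us hus hus' using hts
    refine hfix ⟨pointwise ψ us, ?_, ?_⟩
    · simp only [X, Function.iterate_succ_apply']
      exact Or.inr ⟨us, hus, rfl⟩
    · funext j
      simp only [π, pointwise]
      congr 1
      funext i
      exact congrFun (hus' i) j
  obtain ⟨u, hu, hut⟩ := h.subset_of_closed hψ hR hN hC
    (fun u hu => ⟨u, hX (Nat.zero_le n) hu, rfl⟩) ht
  exact ⟨u, hX hn hu, fun j hj => congrFun hut ⟨j, hj⟩⟩

theorem Represents.exists_agree_add_two [Finite B] [Nonempty B] (hψ : IsGMM ψ)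
    (h : Represents ψ N R U) (hR : IsClosedUnder ψ R) (hN : IsBoundedBy N R) {t : ℕ → B}
    (ht : t ∈ R) {l : ℕ} (J : Finset ℕ) (hJ : J.card ≤ l) :
    ∃ u ∈ (expandSet ψ)^[Nat.card B ^ l + 2] U, ∀ j ∈ J, u j = t j :=
  let ⟨u, hu, hu'⟩ := h.exists_agree hψ hR hN ht J hJ
  ⟨u, monotone_iterate_expandSet U (Nat.le_add_right _ 2) hu, hu'⟩

theorem IsClosedUnder.fix (hψ : IsGMM ψ) (hR : IsClosedUnder ψ R) (j : ℕ) (v : B) :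
    IsClosedUnder ψ {t ∈ R | t j = v} := by
  refine fun ts hts => ⟨hR ts fun i => (hts i).1, ?_⟩
  have : (fun i => ts i j) = fun _ => v := funext fun i => (hts i).2
  simp only [pointwise, this]
  exact hψ.idem v

theorem IsClosedUnder.equalizer (hR : IsClosedUnder ψ R) (p q : ℕ) :
    IsClosedUnder ψ {t ∈ R | t p = t q} := by
  refine fun ts hts => ⟨hR ts fun i => (hts i).1, ?_⟩
  have : (fun i => ts i p) = fun i => ts i q := funext fun i => (hts i).2
  simp only [pointwise, this]

theorem IsBoundedBy.mono {R' : Set (ℕ → B)} (hR : IsBoundedBy N R) (h : R' ⊆ R) :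
    IsBoundedBy N R' := fun t ht t' ht' => hR t (h ht) t' (h ht')

/-- Because `R` is constant before `j`, the new relation has no forks up to `j`. A later fork at `i`
is obtained from one in `U` by moving it onto a tuple `s` that has the right values at `j` and `i`;
the fork term does not change coordinate `j < i`. -/
theorem Represents.fix [Finite B] [Nonempty B] (hψ : IsGMM ψ) (h : Represents ψ N R U)
    (hR : IsClosedUnder ψ R) (hN : IsBoundedBy N R) {j : ℕ}
    (hj : ∀ t ∈ R, ∀ t' ∈ R, ∀ i < j, t i = t' i) (v : B) :
    Represents ψ N {t ∈ R | t j = v}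
      {t ∈ (expandSet ψ)^[Nat.card B ^ (k + 1) + 2] U | t j = v} where
  subset t ht := ⟨hR.iterate_expandSet_subset h.subset _ ht.1, ht.2⟩
  proj t ht I hI hcard := by
    have hk := hψ.1
    obtain ⟨u, hu, hut⟩ := h.exists_agree_add_two hψ hR hN ht.1 (l := k + 1) (insert j I)
      ((Finset.card_insert_le _ _).trans (by omega))
    exact ⟨u, ⟨hu, (hut j (by simp)).trans ht.2⟩, fun i hi => hut i (by simp [hi])⟩
  fork i hi t ht t' ht' hlt hmaj := by
    have hk := hψ.1
    rcases lt_trichotomy i j with hij | rfl | hij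
    · rw [hj t ht.1 t' ht'.1 i hij] at hmaj
      exact absurd (hψ.majority_self _) hmaj
    · rw [ht.2, ht'.2] at hmaj
      exact absurd (hψ.majority_self _) hmaj
    · obtain ⟨u, hu, u', hu', huu, hui, hui'⟩ := h.fork i hi t ht.1 t' ht'.1 hlt hmaj
      obtain ⟨s, hs, hst⟩ := h.exists_agree hψ hR hN ht.1 (l := k + 1) {j, i}
        (Finset.card_le_two.trans (by omega))
      have hsj : s j = v := (hst j (by simp)).trans ht.2
      have hsi : s i = t i := hst i (by simp)
      have hU := monotone_iterate_expandSet (ψ := ψ) U (Nat.zero_le (Nat.card B ^ (k + 1)))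
      -- The fork term is a nesting of depth two; this accounts for the two extra rounds.
      have hf := forkTerm_mem_expandSet (ψ := ψ) hψ.1 hs (hU hu) (hU hu')
      refine ⟨s, ⟨monotone_iterate_expandSet U (Nat.le_add_right _ 2) hs, hsj⟩,
        fun j => forkTerm hψ.1 ψ (s j) (u j) (u' j), ⟨?_, ?_⟩, fun j' hj' => ?_, hsi, ?_⟩
      · rw [Function.iterate_succ_apply', Function.iterate_succ_apply']
        exact hf
      · simp only [huu j hij, hψ.forkTerm_right, hsj]
      · simp only [huu j' hj', hψ.forkTerm_right]
      · simp only [hsi, hui, hui']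
        exact hψ.forkTerm_left (hψ.minority hmaj)

/-- Projections to `k - 1` coordinates together with `p` and `q` involve at most `k + 1`
coordinates, which `W` covers. For a fork at `i`, the first tuple is some `s ∈ W`, and the second is
sought among the tuples of `R` with the same prefix as `s`, represented by `V s i`. -/
theorem Represents.equalizer [Finite B] [Nonempty B] (hψ : IsGMM ψ) (h : Represents ψ N R U)
    (hR : IsClosedUnder ψ R) (hN : IsBoundedBy N R) (p q : ℕ) {W : Set (ℕ → B)}
    {V : (ℕ → B) → ℕ → Set (ℕ → B)}
    (hW : W = {t ∈ (expandSet ψ)^[Nat.card B ^ (k + 1) + 2] U | t p = t q})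
    (hV : ∀ t ∈ W, ∀ i < N, Represents ψ N {s ∈ R | ∀ j < i, s j = t j} (V t i)) :
    Represents ψ N {t ∈ R | t p = t q} (W ∪ {s | (∃ t ∈ W, ∃ i < N,
      s ∈ (expandSet ψ)^[Nat.card B ^ (k + 1) + 2] (V t i)) ∧ s p = s q}) := by
  have hk := hψ.1
  have hclosed : ∀ (t : ℕ → B) (i : ℕ), IsClosedUnder ψ {s ∈ R | ∀ j < i, s j = t j} := by
    intro t i ts hts
    refine ⟨hR ts fun i => (hts i).1, fun j hj => ?_⟩
    have : (fun i => ts i j) = fun _ => t j := funext fun i => (hts i).2 j hj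
    simp only [pointwise, this]
    exact hψ.idem _
  have hWR : W ⊆ {t ∈ R | t p = t q} := by
    rw [hW]
    exact fun t ht => ⟨hR.iterate_expandSet_subset h.subset _ ht.1, ht.2⟩
  have hagree : ∀ t ∈ R, t p = t q → ∀ I : Finset ℕ, I.card ≤ k - 1 →
      ∃ u ∈ W, ∀ i ∈ I, u i = t i := by
    intro t ht htpq I hI
    obtain ⟨u, hu, hut⟩ := h.exists_agree_add_two hψ hR hN ht (l := k + 1) (insert p (insert q I))
      (by
        have h1 := Finset.card_insert_le p (insert q I)
        have h2 := Finset.card_insert_le q I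
        omega)
    refine ⟨u, ?_, fun i hi => hut i (by simp [hi])⟩
    rw [hW]
    exact ⟨hu, by rw [hut p (by simp), hut q (by simp), htpq]⟩
  refine ⟨?_, fun t ht I _ hI => ?_, fun i hi t ht t' ht' hlt hmaj => ?_⟩
  · rintro s (hs | ⟨⟨t, ht, i, hi, hs⟩, hpq⟩)
    · exact hWR hs
    · exact ⟨((hclosed t i).iterate_expandSet_subset (hV t ht i hi).subset _ hs).1, hpq⟩
  · obtain ⟨u, hu, hut⟩ := hagree t ht.1 ht.2 I hI
    exact ⟨u, Or.inl hu, hut⟩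
  · obtain ⟨s, hs, hst⟩ := hagree t ht.1 ht.2 {i} (by simp; omega)
    have hsi : s i = t i := hst i (by simp)
    have hsR := hWR hs
    -- This tuple proves that the second half of the fork exists. A generated tuple `u` agreeing
    -- with it only at `i`, `p`, `q` suffices: it satisfies the equation and has the value `t' i`.
    have hr : (fun j => forkTerm hψ.1 ψ (s j) (t j) (t' j)) ∈ {r ∈ R | ∀ j < i, r j = s j} :=
      ⟨hR.forkTerm_mem hψ.1 hsR.1 ht.1 ht'.1, fun j hj => by
        simp only [hlt j hj, hψ.forkTerm_right]⟩
    have hr' : (fun j => forkTerm hψ.1 ψ (s j) (t j) (t' j)) ∈ {t ∈ R | t p = t q} :=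
      (hR.equalizer p q).forkTerm_mem hψ.1 hsR ht ht'
    obtain ⟨u, hu, hut⟩ := (hV s hs i hi).exists_agree_add_two hψ (hclosed s i)
      (hN.mono (Set.sep_subset _ _)) hr (l := k + 1) {i, p, q}
      (Finset.card_le_three.trans (by omega))
    have huR := (hclosed s i).iterate_expandSet_subset (hV s hs i hi).subset _ hu
    refine ⟨s, Or.inl hs, u, Or.inr ⟨⟨s, hs, i, hi, hu⟩, ?_⟩, fun j hj => (huR.2 j hj).symm,
      hsi, ?_⟩
    · rw [hut p (by simp), hut q (by simp)]
      exact hr'.2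
    · rw [hut i (by simp)]
      simp only [hsi]
      exact hψ.forkTerm_left (hψ.minority hmaj)

/-- The concatenation of `t`, up to the coordinate `N`, and `s`. -/
def concat (N : ℕ) (t s : ℕ → B) : ℕ → B := fun j => if j < N then t j else s (j - N)

theorem IsClosedUnder.concat {S : Set (ℕ → B)} (hR : IsClosedUnder ψ R) (hS : IsClosedUnder ψ S)
    (N : ℕ) : IsClosedUnder ψ (Set.image2 (concat N) R S) := by
  intro ts hts
  choose t ht s hs hts using hts
  refine ⟨_, hR t ht, _, hS s hs, ?_⟩
  funext j
  simp only [GMMCSP.concat, pointwise, ← hts]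
  split_ifs <;> rfl

/-- The factor `S` enters in full, so only the first part needs a representation: forks before `N`
come from `U`, and forks from `N` on are formed by two elements of `S` after one common `u ∈ U`. -/
theorem Represents.concat (h : Represents ψ N R U) (S : Set (ℕ → B)) (r : ℕ) :
    Represents ψ (N + r) (Set.image2 (concat N) R S) (Set.image2 (concat N) U S) where
  subset := Set.image2_subset_right h.subset
  proj := by
    rintro _ ⟨t, ht, s, hs, rfl⟩ I _ hI
    obtain ⟨u, hu, hut⟩ := h.proj t ht (I.filter (· < N)) (by simp)
      ((Finset.card_filter_le _ _).trans hI)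
    refine ⟨_, ⟨u, hu, s, hs, rfl⟩, fun i hi => ?_⟩
    simp only [GMMCSP.concat]
    split_ifs with hiN
    · exact hut i (by simp [hi, hiN])
    · rfl
  fork := by
    rintro i hi _ ⟨t, ht, s, hs, rfl⟩ _ ⟨t', ht', s', hs', rfl⟩ hlt hmaj
    rcases lt_or_ge i N with hiN | hiN
    · have hlt' : ∀ j < i, t j = t' j := fun j hj => by
        simpa [GMMCSP.concat, hj.trans hiN] using hlt j hj
      obtain ⟨u, hu, u', hu', huu, hui, hui'⟩ := h.fork i hiN t ht t' ht' hlt'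
        (by simpa [GMMCSP.concat, hiN] using hmaj)
      refine ⟨_, ⟨u, hu, s, hs, rfl⟩, _, ⟨u', hu', s, hs, rfl⟩, fun j hj => ?_, ?_, ?_⟩
      · simp [GMMCSP.concat, hj.trans hiN, huu j hj]
      · simp [GMMCSP.concat, hiN, hui]
      · simp [GMMCSP.concat, hiN, hui']
    · obtain ⟨u, hu, -⟩ := h.proj t ht ∅ (by simp) (by simp)
      refine ⟨_, ⟨u, hu, s, hs, rfl⟩, _, ⟨u, hu, s', hs', rfl⟩, fun j hj => ?_, ?_, ?_⟩
      · have := hlt j hj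
        simp only [GMMCSP.concat] at this ⊢
        split_ifs with hjN
        · rfl
        · simpa [hjN] using this
      · simp [GMMCSP.concat, hiN.not_gt]
      · simp [GMMCSP.concat, hiN.not_gt]

end Theory

end GMMCSP

/-! ### Extension of the operation to `Option A`, so that tuples of any length become functions on
ℕ. -/

namespace GMMCSP

section OptionOp

variable {A : Type} {k : ℕ} {φ : (Fin k → A) → A}

open Classical in
/-- An extension of `φ` to `Option A` which is a generalized majority-minority operation
if `φ` is one. -/
noncomputable def optionOp (φ : (Fin k → A) → A) (u : Fin k → Option A) : Option A :=
  if h : ∃ v : Fin k → A, u = fun i => some (v i) then some (φ h.choose)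
  else if h : ∃ (a : A) (i : Fin k), u = single i none (some a) then some h.choose else none

theorem optionOp_some (v : Fin k → A) : optionOp φ (fun i => some (v i)) = some (φ v) := by
  have h : ∃ v' : Fin k → A, (fun i => some (v i)) = fun i => some (v' i) := ⟨v, rfl⟩
  have e : h.choose = v := funext fun i => (Option.some.inj (congrFun h.choose_spec i)).symm
  unfold optionOp
  rw [dif_pos h, e]

theorem exists_ne_ne (hk : 3 ≤ k) (i i' : Fin k) : ∃ j, j ≠ i ∧ j ≠ i' := by
  have h : ({i, i'} : Finset (Fin k)).card < (Finset.univ : Finset (Fin k)).card := by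
    rw [Finset.card_univ, Fintype.card_fin]
    exact Finset.card_le_two.trans_lt hk
  obtain ⟨j, -, hj⟩ := Finset.exists_mem_notMem_of_card_lt_card h
  exact ⟨j, by simpa using hj⟩

theorem optionOp_single_some_none (hk : 3 ≤ k) (i : Fin k) (x : Option A) :
    optionOp φ (single i x none) = none := by
  have h1 : ¬∃ v : Fin k → A, single i x none = fun i => some (v i) := by
    rintro ⟨v, hv⟩
    obtain ⟨j, hj, -⟩ := exists_ne_ne hk i i
    simpa [single, hj] using congrFun hv j
  have h2 : ¬∃ (a : A) (i' : Fin k), single i x none = single i' none (some a) := by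
    rintro ⟨a, i', h⟩
    obtain ⟨j, hj, hj'⟩ := exists_ne_ne hk i i'
    simpa [single, hj, hj'] using congrFun h j
  unfold optionOp
  rw [dif_neg h1, dif_neg h2]

/-- As `3 ≤ k`, some position avoids both candidates for the exceptional one, so the chosen value
must be `a`. -/
theorem optionOp_single_none_some (hk : 3 ≤ k) (i : Fin k) (a : A) :
    optionOp φ (single i none (some a)) = some a := by
  have h1 : ¬∃ v : Fin k → A, single i none (some a) = fun i => some (v i) := by
    rintro ⟨v, hv⟩
    simpa [single] using congrFun hv i
  have h2 : ∃ (a' : A) (i' : Fin k), single i none (some a) = single i' none (some a') :=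
    ⟨a, i, rfl⟩
  have e : h2.choose = a := by
    obtain ⟨i', h⟩ := h2.choose_spec
    obtain ⟨j, hj, hj'⟩ := exists_ne_ne hk i i'
    simpa [single, hj, hj', eq_comm] using congrFun h j
  unfold optionOp
  rw [dif_neg h1, dif_pos h2, e]

theorem optionOp_single_some (i : Fin k) (a b : A) :
    optionOp φ (single i (some a) (some b)) = some (φ (single i a b)) := by
  rw [← optionOp_some]
  congr 1
  funext j
  by_cases hj : j = i
  · subst hj; simp [single]
  · simp [single, hj]

theorem optionOp_none (hk : 3 ≤ k) : optionOp φ (fun _ => none) = none := by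
  have := optionOp_single_some_none (φ := φ) hk ⟨0, by omega⟩ none
  rwa [single, Function.update_eq_self_iff.2 rfl] at this

/-- Pairs that involve `none` are majority pairs by construction; pairs of values keep the type they
have under φ. -/
theorem IsGMM.optionOp (hφ : IsGMM φ) : IsGMM (optionOp φ) := by
  have hk := hφ.1
  have hsome : ∀ a : A, IsMajorityPair (GMMCSP.optionOp φ) (some a) none := by
    intro a x hx y hy i
    rcases hy with rfl | rfl
    · rcases hx with rfl | rfl
      · rw [optionOp_single_some, hφ.majority_self a a (by simp) a (by simp)]
      · exact optionOp_single_none_some hk i a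
    · exact optionOp_single_some_none hk i x
  refine ⟨hk, fun a b => ?_⟩
  rcases a with _ | a <;> rcases b with _ | b
  · refine Or.inl fun x hx y hy i => ?_
    simp only [Set.mem_insert_iff, Set.mem_singleton_iff, or_self] at hx hy
    subst hx hy
    exact optionOp_single_some_none hk i _
  · exact Or.inl (hsome b).symm
  · exact Or.inl (hsome a)
  · refine (hφ.2 a b).imp (fun h x hx y hy i => ?_) (fun h x hx y hy i hi => ?_)
    · obtain ⟨x, rfl, hxab⟩ : ∃ x', x = some x' ∧ x' ∈ ({a, b} : Set A) := by
        rcases hx with rfl | rfl <;> exact ⟨_, rfl, by simp⟩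
      obtain ⟨y, rfl, hyab⟩ : ∃ x', y = some x' ∧ x' ∈ ({a, b} : Set A) := by
        rcases hy with rfl | rfl <;> exact ⟨_, rfl, by simp⟩
      rw [optionOp_single_some, h x hxab y hyab i]
    · obtain ⟨x, rfl, hxab⟩ : ∃ x', x = some x' ∧ x' ∈ ({a, b} : Set A) := by
        rcases hx with rfl | rfl <;> exact ⟨_, rfl, by simp⟩
      obtain ⟨y, rfl, hyab⟩ : ∃ x', y = some x' ∧ x' ∈ ({a, b} : Set A) := by
        rcases hy with rfl | rfl <;> exact ⟨_, rfl, by simp⟩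
      rw [optionOp_single_some, h x hxab y hyab i hi]

end OptionOp

/-! ### Correctness of the algorithm. -/

section Correctness

variable {A : Type} {k : ℕ} {φ : (Fin k → A) → A}

/-- The function of the coordinates given by a list. -/
def view (l : List A) : ℕ → Option A := fun j => l[j]?

theorem view_injective : Function.Injective (view : List A → ℕ → Option A) :=
  fun _ _ h => List.ext_getElem? (congrFun h)

/-- The functions of the coordinates given by a list of lists. -/
def views (U : List (List A)) : Set (ℕ → Option A) := {w | ∃ l ∈ U, w = view l}

/-- All tuples in `U` have length `N`. -/
def HasLength (N : ℕ) (U : List (List A)) : Prop := ∀ t ∈ U, t.length = N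

theorem HasLength.isBoundedBy {N : ℕ} {U : List (List A)} (h : HasLength N U) :
    IsBoundedBy N (views U) := by
  rintro _ ⟨t, ht, rfl⟩ _ ⟨t', ht', rfl⟩ j hj
  simp only [view]
  rw [List.getElem?_eq_none (by rw [h t ht]; exact hj),
    List.getElem?_eq_none (by rw [h t' ht']; exact hj)]

/-- The list `cols` consists of the columns of the matrix with rows `ts`. -/
def IsColumns (N : ℕ) {m : ℕ} (ts : Fin m → List A) (cols : List (Fin m → A)) : Prop :=
  cols.length = N ∧ ∀ j (hj : j < cols.length) i, (ts i)[j]? = some (cols[j] i)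

theorem isColumns_cons {N m : ℕ} {ts : Fin m → List A} {cols : List (Fin m → A)}
    (h : IsColumns N ts cols) {t : List A} (ht : t.length = N) :
    IsColumns N (Fin.cons t ts : Fin (m + 1) → List A)
      (List.zipWith (fun a v => (Fin.cons a v : Fin (m + 1) → A)) t cols) := by
  obtain ⟨hc, h⟩ := h
  refine ⟨by simp [hc, ht], fun j hj i => ?_⟩
  simp only [List.length_zipWith] at hj
  simp only [List.getElem_zipWith]
  refine Fin.cases ?_ (fun i => ?_) i
  · simp [List.getElem?_eq_getElem (show j < t.length by omega)]
  · simpa using h j (by omega) i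

theorem exists_rows_of_mem_columns {N m : ℕ} {U : List (List A)} (hU : HasLength N U)
    {cols : List (Fin m → A)} (hc : cols ∈ columns N U m) :
    ∃ ts : Fin m → List A, (∀ i, ts i ∈ U) ∧ IsColumns N ts cols := by
  induction m with
  | zero =>
    simp only [columns, List.mem_singleton] at hc
    subst hc
    exact ⟨Fin.elim0, fun i => i.elim0, by simp, fun _ _ i => i.elim0⟩
  | succ m ih =>
    simp only [columns, List.mem_flatMap, List.mem_map] at hc
    obtain ⟨t, ht, cols, hc, rfl⟩ := hc
    obtain ⟨ts, hts, h⟩ := ih hc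
    exact ⟨Fin.cons t ts, fun i => Fin.cases ht hts i, isColumns_cons h (hU t ht)⟩

theorem exists_mem_columns {N m : ℕ} {U : List (List A)} (hU : HasLength N U)
    {ts : Fin m → List A} (hts : ∀ i, ts i ∈ U) : ∃ cols ∈ columns N U m, IsColumns N ts cols := by
  induction m with
  | zero => exact ⟨_, List.mem_singleton_self _, by simp, fun _ _ i => i.elim0⟩
  | succ m ih =>
    obtain ⟨cols, hc, h⟩ := ih (ts := fun i => ts i.succ) fun i => hts _
    refine ⟨_, ?_, Fin.cons_self_tail ts ▸ isColumns_cons h (hU _ (hts 0))⟩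
    simp only [columns, List.mem_flatMap, List.mem_map]
    exact ⟨_, hts 0, cols, hc, rfl⟩

theorem view_map_of_isColumns (hk : 3 ≤ k) {N : ℕ} {ts : Fin k → List A} {cols : List (Fin k → A)}
    (h : IsColumns N ts cols) (hts : ∀ i, (ts i).length = N) :
    view (cols.map φ) = pointwise (optionOp φ) fun i => view (ts i) := by
  funext j
  simp only [view, pointwise]
  rcases lt_or_ge j cols.length with hj | hj
  · have : (fun i => (ts i)[j]?) = fun i => some (cols[j] i) := funext (h.2 j hj)
    rw [this, optionOp_some]
    simp [hj]
  · have : (fun i => (ts i)[j]?) = fun _ => none := funext fun i =>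
      List.getElem?_eq_none (by have := hts i; have := h.1; omega)
    rw [this, optionOp_none hk]
    simpa using hj

theorem HasLength.expand {N : ℕ} {U : List (List A)} (hU : HasLength N U) :
    HasLength N (expand φ N U) := by
  intro t ht
  rcases List.mem_append.1 ht with ht | ht
  · exact hU t ht
  · obtain ⟨cols, hc, rfl⟩ := List.mem_map.1 ht
    obtain ⟨ts, -, h⟩ := exists_rows_of_mem_columns hU hc
    simpa using h.1

theorem views_expand (hk : 3 ≤ k) {N : ℕ} {U : List (List A)} (hU : HasLength N U) :
    views (expand φ N U) = expandSet (optionOp φ) (views U) := by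
  ext w
  constructor
  · rintro ⟨t, ht, rfl⟩
    rcases List.mem_append.1 ht with ht | ht
    · exact Or.inl ⟨t, ht, rfl⟩
    · obtain ⟨cols, hc, rfl⟩ := List.mem_map.1 ht
      obtain ⟨ts, hts, h⟩ := exists_rows_of_mem_columns hU hc
      exact Or.inr ⟨_, fun i => ⟨ts i, hts i, rfl⟩,
        view_map_of_isColumns hk h fun i => hU _ (hts i)⟩
  · rintro (⟨t, ht, rfl⟩ | ⟨ws, hws, rfl⟩)
    · exact ⟨t, List.mem_append_left _ ht, rfl⟩
    · choose ts hts hws using hws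
      obtain ⟨cols, hc, h⟩ := exists_mem_columns hU hts
      refine ⟨cols.map φ, List.mem_append_right _ (List.mem_map_of_mem hc), ?_⟩
      rw [view_map_of_isColumns hk h fun i => hU _ (hts i)]
      congr 1
      exact funext hws

theorem HasLength.filter {N : ℕ} {U : List (List A)} (hU : HasLength N U) (p : List A → Bool) :
    HasLength N (U.filter p) := fun t ht => hU t (List.mem_of_mem_filter ht)

theorem views_filter {U : List (List A)} {p : List A → Bool} {P : (ℕ → Option A) → Prop}
    (h : ∀ t, p t = true ↔ P (view t)) : views (U.filter p) = {w ∈ views U | P w} := by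
  ext w
  constructor
  · rintro ⟨t, ht, rfl⟩
    rw [List.mem_filter, h] at ht
    exact ⟨⟨t, ht.1, rfl⟩, ht.2⟩
  · rintro ⟨⟨t, ht, rfl⟩, hP⟩
    exact ⟨t, List.mem_filter.2 ⟨ht, (h t).2 hP⟩, rfl⟩

theorem views_append {N : ℕ} {T S : List (List A)} (hT : HasLength N T) :
    views (T.flatMap fun t => S.map fun s => t ++ s) =
      Set.image2 (concat N) (views T) (views S) := by
  have h : ∀ t ∈ T, ∀ s, view (t ++ s) = concat N (view t) (view s) := by
    intro t ht s
    funext j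
    simp only [view, concat]
    rw [List.getElem?_append, hT t ht]
  ext w
  constructor
  · rintro ⟨l, hl, rfl⟩
    obtain ⟨t, ht, hl⟩ := List.mem_flatMap.1 hl
    obtain ⟨s, hs, rfl⟩ := List.mem_map.1 hl
    exact ⟨_, ⟨t, ht, rfl⟩, _, ⟨s, hs, rfl⟩, (h t ht s).symm⟩
  · rintro ⟨_, ⟨t, ht, rfl⟩, _, ⟨s, hs, rfl⟩, rfl⟩
    exact ⟨t ++ s, List.mem_flatMap.2 ⟨t, ht, List.mem_map.2 ⟨s, hs, rfl⟩⟩, (h t ht s).symm⟩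

theorem HasLength.append {N r : ℕ} {T S : List (List A)} (hT : HasLength N T)
    (hS : HasLength r S) : HasLength (N + r) (T.flatMap fun t => S.map fun s => t ++ s) := by
  intro l hl
  obtain ⟨t, ht, hl⟩ := List.mem_flatMap.1 hl
  obtain ⟨s, hs, rfl⟩ := List.mem_map.1 hl
  simp [hT t ht, hS s hs]

/-- The list `U` of tuples of length `N` represents the relation `R`. -/
structure ListRepresents (φ : (Fin k → A) → A) (N : ℕ) (R : Set (ℕ → Option A))
    (U : List (List A)) : Prop where
  hasLength : HasLength N U
  represents : Represents (optionOp φ) N R (views U)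

theorem ListRepresents.nonempty_iff {N : ℕ} {R : Set (ℕ → Option A)}
    {U : List (List A)} (h : ListRepresents φ N R U) :
    R.Nonempty ↔ U ≠ [] := by
  constructor
  · rintro ⟨t, ht⟩ rfl
    obtain ⟨_, ⟨l, hl, -⟩, -⟩ := h.represents.proj t ht ∅ (by simp) (by simp)
    simp at hl
  · intro hU
    obtain ⟨l, hl⟩ := List.exists_mem_of_ne_nil U hU
    exact ⟨view l, h.represents.subset ⟨l, hl, rfl⟩⟩

variable [Finite A]

/-- Links the program to the theory: `rounds` is the bound of the counting argument for `Option A`,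
which has one element more than `A`. -/
theorem generate_spec (hk : 3 ≤ k) {N : ℕ} {U : List (List A)} (hU : HasLength N U) :
    HasLength N (generate φ N U) ∧ views (generate φ N U) =
      (expandSet (optionOp φ))^[Nat.card (Option A) ^ (k + 1) + 2] (views U) := by
  have : rounds A k = Nat.card (Option A) ^ (k + 1) + 2 := by
    rw [rounds, Finite.card_option]
  rw [generate, this]
  generalize Nat.card (Option A) ^ (k + 1) + 2 = n
  induction n with
  | zero => exact ⟨hU, rfl⟩
  | succ n ih =>
    rw [Function.iterate_succ_apply', Function.iterate_succ_apply']
    exact ⟨ih.1.expand, by rw [views_expand hk ih.1, ih.2]⟩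

theorem mem_queries {N m : ℕ} {q : List (ℕ × A)} (hq : q.length ≤ m) (hN : ∀ x ∈ q, x.1 < N) :
    q ∈ queries A N m := by
  induction m generalizing q with
  | zero => simpa [queries] using hq
  | succ m ih =>
    rw [queries, List.mem_append]
    rcases q with _ | ⟨x, q⟩
    · exact Or.inl (ih (by simp) (by simp))
    · refine Or.inr ?_
      simp only [List.mem_flatMap, List.mem_map, List.mem_range]
      exact ⟨x.1, hN x (by simp), x.2, mem_elements _, q,
        ih (by simpa using hq) fun y hy => hN y (by simp [hy]), rfl⟩

theorem HasLength.mem_of_mem_compress {m N N' : ℕ} {W : List (List A)} (hW : HasLength N' W)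
    (hN : N' ≤ N) {t : List A} (ht : t ∈ compress m N W) : t ∈ W := by
  have htake : ∀ t ∈ W, t.take N = t := fun t ht =>
    List.take_of_length_le (by rw [hW t ht]; exact hN)
  rw [compress, List.mem_append] at ht
  rcases ht with ht | ht
  · simp only [List.mem_flatMap, List.mem_map, Option.mem_toList] at ht
    obtain ⟨q, -, t, ht, rfl⟩ := ht
    have := List.mem_of_find?_eq_some ht
    rwa [htake t this]
  · simp only [List.mem_flatMap, Option.mem_toList, List.mem_range] at ht
    obtain ⟨i, -, ab, -, x, hx, ht⟩ := ht
    have := List.mem_of_find?_eq_some hx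
    simp only [pairs, List.mem_flatMap, List.mem_map] at this
    obtain ⟨s, hs, s', hs', rfl⟩ := this
    simp only [htake s hs, htake s' hs', List.mem_cons, List.not_mem_nil, or_false] at ht
    rcases ht with rfl | rfl
    · exact hs
    · exact hs'

theorem ListRepresents.compress {N N' : ℕ} {R : Set (ℕ → Option A)} {W : List (List A)}
    (h : ListRepresents φ N' R W) (hN : N' ≤ N) :
    ListRepresents φ N' R (compress (k - 1) N W) where
  hasLength t ht := h.hasLength t (h.hasLength.mem_of_mem_compress hN ht)
  represents := by
    have htake : ∀ t ∈ W, t.take N = t := fun t ht =>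
      List.take_of_length_le (by rw [h.hasLength t ht]; exact hN)
    refine ⟨?_, fun t ht I hI hcard => ?_, fun i hi t ht t' ht' hlt hmaj => ?_⟩
    · rintro _ ⟨t, ht, rfl⟩
      exact h.represents.subset ⟨t, h.hasLength.mem_of_mem_compress hN ht, rfl⟩
    · obtain ⟨_, ⟨l, hl, rfl⟩, hlt⟩ := h.represents.proj t ht I hI hcard
      -- The query records the values on `I` of a tuple `l` known to be in `W`; the search may
      -- return another tuple, but with the same values on `I`.
      let q := I.toList.filterMap fun i => l[i]?.map fun a => (i, a)
      have hq : q ∈ queries A N (k - 1) := by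
        refine mem_queries ((List.length_filterMap_le _ _).trans (by simpa using hcard))
          fun x hx => ?_
        obtain ⟨i, hi, hx⟩ := List.mem_filterMap.1 hx
        obtain ⟨a, -, rfl⟩ := Option.map_eq_some_iff.1 hx
        exact (hI i (by simpa using hi)).trans_le hN
      have hsat : satisfies q l = true := by
        simp only [satisfies, List.all_eq_true, decide_eq_true_eq]
        intro x hx
        obtain ⟨i, hi, hx⟩ := List.mem_filterMap.1 hx
        obtain ⟨a, ha, rfl⟩ := Option.map_eq_some_iff.1 hx
        exact ha
      obtain ⟨l', hl'⟩ := Option.isSome_iff_exists.1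
        (List.find?_isSome.2 ⟨l, hl, hsat⟩ : (W.find? (satisfies q)).isSome)
      have hl'W := List.mem_of_find?_eq_some hl'
      have hl'q := List.find?_some hl'
      simp only [satisfies, List.all_eq_true, decide_eq_true_eq] at hl'q
      refine ⟨view l', ⟨l', ?_, rfl⟩, fun i hi => ?_⟩
      · rw [GMMCSP.compress, List.mem_append]
        refine Or.inl ?_
        simp only [List.mem_flatMap, List.mem_map, Option.mem_toList]
        exact ⟨q, hq, l', hl', htake l' hl'W⟩
      · rw [← hlt i hi]
        have hil : i < l.length := by rw [h.hasLength l hl]; exact hI i hi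
        have := hl'q (i, l[i]) (List.mem_filterMap.2 ⟨i, by simpa using hi, by simp [hil]⟩)
        simp only [view]
        rw [this, List.getElem?_eq_getElem hil]
    · obtain ⟨_, ⟨l, hl, rfl⟩, _, ⟨l', hl', rfl⟩, hll, hli, hli'⟩ :=
        h.represents.fork i hi t ht t' ht' hlt hmaj
      have hil : i < l.length := by rw [h.hasLength l hl]; exact hi
      have hil' : i < l'.length := by rw [h.hasLength l' hl']; exact hi
      have hf : forks i l[i] l'[i] (l, l') = true := by
        simp only [forks, Bool.and_eq_true, decide_eq_true_eq, List.all_eq_true, List.mem_range]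
        exact ⟨⟨List.getElem?_eq_getElem hil, List.getElem?_eq_getElem hil'⟩, hll⟩
      have hp : (l, l') ∈ pairs W := by
        simp only [pairs, List.mem_flatMap, List.mem_map]
        exact ⟨l, hl, l', hl', rfl⟩
      obtain ⟨⟨u, u'⟩, hu⟩ := Option.isSome_iff_exists.1
        (List.find?_isSome.2 ⟨_, hp, hf⟩ : ((pairs W).find? (forks i l[i] l'[i])).isSome)
      have hup := List.mem_of_find?_eq_some hu
      have huf := List.find?_some hu
      simp only [pairs, List.mem_flatMap, List.mem_map, Prod.mk.injEq] at hup
      obtain ⟨u, huW, u', hu'W, rfl, rfl⟩ := hup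
      simp only [forks, Bool.and_eq_true, decide_eq_true_eq, List.all_eq_true,
        List.mem_range] at huf
      have hmem : ∀ v ∈ [u, u'], v ∈ GMMCSP.compress (k - 1) N W := by
        intro v hv
        rw [GMMCSP.compress, List.mem_append]
        refine Or.inr ?_
        simp only [List.mem_flatMap, Option.mem_toList, List.mem_range]
        refine ⟨i, hi.trans_le hN, (l[i], l'[i]), mem_elements _, (u, u'), hu, ?_⟩
        simpa only [htake u huW, htake u' hu'W] using hv
      refine ⟨view u, ⟨u, hmem u (by simp), rfl⟩, view u', ⟨u', hmem u' (by simp), rfl⟩,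
        huf.2, ?_, ?_⟩
      · rw [← hli]
        simp only [view]
        rw [huf.1.1, List.getElem?_eq_getElem hil]
      · rw [← hli']
        simp only [view]
        rw [huf.1.2, List.getElem?_eq_getElem hil']

variable {N : ℕ} {R : Set (ℕ → Option A)} {U : List (List A)}

theorem ListRepresents.fixCoord (hφ : IsGMM φ) (h : ListRepresents φ N R U)
    (hR : IsClosedUnder (optionOp φ) R) (hN : IsBoundedBy N R) {j : ℕ}
    (hj : ∀ t ∈ R, ∀ t' ∈ R, ∀ i < j, t i = t' i) (v : Option A) :
    ListRepresents φ N {t ∈ R | t j = v} (fixCoord φ N U j v) := by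
  obtain ⟨h1, h2⟩ := generate_spec (φ := φ) hφ.1 h.hasLength
  refine ListRepresents.compress ⟨h1.filter _, ?_⟩ le_rfl
  rw [views_filter (P := fun w => w j = v) (fun t => by simp [view]), h2]
  exact h.represents.fix hφ.optionOp hR hN hj v

/-- Fixing coordinates in increasing order provides the hypothesis of `fixCoord`: all earlier
coordinates are already constant. -/
theorem ListRepresents.fixPrefix (hφ : IsGMM φ) (h : ListRepresents φ N R U)
    (hR : IsClosedUnder (optionOp φ) R) (hN : IsBoundedBy N R) (t : List A) (i : ℕ) :
    IsClosedUnder (optionOp φ) {s ∈ R | ∀ j < i, s j = view t j} ∧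
      ListRepresents φ N {s ∈ R | ∀ j < i, s j = view t j} (fixPrefix φ N U t i) := by
  induction i with
  | zero => simpa [GMMCSP.fixPrefix] using And.intro hR h
  | succ i ih =>
    have e : {s ∈ R | ∀ j < i + 1, s j = view t j} =
        {s ∈ {s ∈ R | ∀ j < i, s j = view t j} | s i = view t i} := by
      ext s
      simp only [Set.mem_ofPred_eq, and_assoc, Nat.lt_succ_iff_lt_or_eq, or_imp, forall_and,
        forall_eq]
    rw [e]
    refine ⟨ih.1.fix hφ.optionOp i _, ?_⟩
    rw [GMMCSP.fixPrefix, List.range_succ, List.foldl_append]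
    exact ih.2.fixCoord hφ ih.1 (hN.mono (Set.sep_subset _ _))
      (fun s hs s' hs' j hj => (hs.2 j hj).trans (hs'.2 j hj).symm) _

theorem ListRepresents.equate (hφ : IsGMM φ) (h : ListRepresents φ N R U)
    (hR : IsClosedUnder (optionOp φ) R) (hN : IsBoundedBy N R) (p q : ℕ) :
    ListRepresents φ N {t ∈ R | t p = t q} (equate φ N U p q) := by
  classical
  obtain ⟨h1, h2⟩ := generate_spec (φ := φ) hφ.1 h.hasLength
  have hfix := fun t i => (h.fixPrefix hφ hR hN t i).2
  have hgen := fun t i => generate_spec (φ := φ) hφ.1 (hfix t i).hasLength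
  refine ListRepresents.compress ⟨?_, ?_⟩ le_rfl
  · intro t ht
    rcases List.mem_append.1 ht with ht | ht
    · exact h1.filter _ t ht
    · obtain ⟨s, -, ht⟩ := List.mem_flatMap.1 (List.mem_of_mem_filter ht)
      obtain ⟨i, -, ht⟩ := List.mem_flatMap.1 ht
      exact (hgen s i).1 t ht
  · have hW := views_filter (U := generate φ N U) (p := fun t => decide (t[p]? = t[q]?))
      (P := fun w => w p = w q) (fun t => by simp [view])
    rw [h2] at hW
    -- The theory indexes `V` by functions, the program by lists; since `view` is injective, the
    -- union is over a single list.
    let V : (ℕ → Option A) → ℕ → Set (ℕ → Option A) :=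
      fun w i => {s | ∃ t, view t = w ∧ s ∈ views (GMMCSP.fixPrefix φ N U t i)}
    have hV : ∀ t i, V (view t) i = views (GMMCSP.fixPrefix φ N U t i) := by
      intro t i
      ext s
      constructor
      · rintro ⟨t', ht', hs⟩
        rwa [view_injective ht'] at hs
      · exact fun hs => ⟨t, rfl, hs⟩
    have key := h.represents.equalizer hφ.optionOp hR hN p q hW (V := V) (by
      rintro _ ⟨t, -, rfl⟩ i -
      rw [hV]
      exact (hfix t i).represents)
    convert key using 1
    ext w
    constructor
    · rintro ⟨l, hl, rfl⟩
      rcases List.mem_append.1 hl with hl | hl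
      · exact Or.inl ⟨l, hl, rfl⟩
      · obtain ⟨hl, hpq⟩ := List.mem_filter.1 hl
        obtain ⟨t, ht, hl⟩ := List.mem_flatMap.1 hl
        obtain ⟨i, hi, hl⟩ := List.mem_flatMap.1 hl
        refine Or.inr ⟨⟨view t, ⟨t, ht, rfl⟩, i, List.mem_range.1 hi, ?_⟩, by simpa [view] using hpq⟩
        rw [hV, ← (hgen t i).2]
        exact ⟨l, hl, rfl⟩
    · rintro (⟨l, hl, rfl⟩ | ⟨⟨_, ⟨t, ht, rfl⟩, i, hi, hw⟩, hpq⟩)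
      · exact ⟨l, List.mem_append_left _ hl, rfl⟩
      · rw [hV, ← (hgen t i).2] at hw
        obtain ⟨l, hl, rfl⟩ := hw
        refine ⟨l, List.mem_append_right _ (List.mem_filter.2 ⟨?_, by simpa [view] using hpq⟩), rfl⟩
        exact List.mem_flatMap.2 ⟨t, ht, List.mem_flatMap.2 ⟨i, List.mem_range.2 hi, hl⟩⟩

theorem ListRepresents.extend {N N' r : ℕ} {T U S : List (List A)}
    (h : ListRepresents φ N' (views T) U) (hT : HasLength N' T) (hS : HasLength r S)
    (hN : N' + r ≤ N) :
    ListRepresents φ (N' + r) (views (T.flatMap fun t => S.map fun s => t ++ s))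
      (extend k N U S) := by
  refine ListRepresents.compress ⟨h.hasLength.append hS, ?_⟩ hN
  rw [views_append hT, views_append h.hasLength]
  exact h.represents.concat _ _

/-- The list of all concatenations of tuples in `T` and tuples in the relations in `bs`. -/
def productList (T : List (List A)) (bs : List (List (List A))) : List (List A) :=
  bs.foldl (fun T S => T.flatMap fun t => S.map fun s => t ++ s) T

theorem ListRepresents.foldl_extend {N N' : ℕ} {T U : List (List A)} {bs : List (List (List A))}
    {rs : List ℕ} (hbs : List.Forall₂ (fun S r => HasLength r S ∧
      IsClosedUnder (optionOp φ) (views S)) bs rs)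
    (h : ListRepresents φ N' (views T) U) (hT : HasLength N' T)
    (hT' : IsClosedUnder (optionOp φ) (views T)) (hN : N' + rs.sum ≤ N) :
    ListRepresents φ (N' + rs.sum) (views (productList T bs)) (bs.foldl (GMMCSP.extend k N) U) ∧
      HasLength (N' + rs.sum) (productList T bs) ∧
      IsClosedUnder (optionOp φ) (views (productList T bs)) := by
  induction hbs generalizing N' T U with
  | nil => exact ⟨h, hT, hT'⟩
  | @cons S r bs rs hS _ ih =>
    rw [List.sum_cons, ← add_assoc] at hN ⊢
    refine ih (h.extend hT hS.1 (by omega)) (hT.append hS.1) ?_ hN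
    rw [views_append hT]
    exact hT'.concat hS.2 _

theorem ListRepresents.foldl_equate (hφ : IsGMM φ) (eqs : List (ℕ × ℕ))
    (h : ListRepresents φ N R U) (hR : IsClosedUnder (optionOp φ) R) (hN : IsBoundedBy N R) :
    ListRepresents φ N {t ∈ R | ∀ e ∈ eqs, t e.1 = t e.2}
      (eqs.foldl (fun U e => GMMCSP.equate φ N U e.1 e.2) U) := by
  induction eqs generalizing R U with
  | nil => simpa using h
  | cons e eqs ih =>
    have key := ih (h.equate hφ hR hN e.1 e.2) (hR.equalizer e.1 e.2)
      (hN.mono (Set.sep_subset _ _))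
    have e' : {t ∈ R | ∀ d ∈ e :: eqs, t d.1 = t d.2} =
        {t ∈ {t ∈ R | t e.1 = t e.2} | ∀ d ∈ eqs, t d.1 = t d.2} := by
      ext t
      simp [and_assoc]
    rw [e', List.foldl_cons]
    exact key

theorem solve_iff (hφ : IsGMM φ) {bs : List (List (List A))} {rs : List ℕ}
    (hbs : List.Forall₂ (fun S r => HasLength r S ∧ IsClosedUnder (optionOp φ) (views S)) bs rs)
    (eqs : List (ℕ × ℕ)) :
    solve φ rs.sum bs eqs = true ↔
      ∃ l ∈ productList [[]] bs, ∀ e ∈ eqs, l[e.1]? = l[e.2]? := by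
  have hT : HasLength 0 ([[]] : List (List A)) := by simp [HasLength]
  have hT' : IsClosedUnder (optionOp φ) (views ([[]] : List (List A))) := by
    intro ts hts
    have : ∀ i, ts i = fun _ => none := fun i => by
      obtain ⟨l, hl, e⟩ := hts i
      rw [List.mem_singleton.1 hl] at e
      rw [e]; rfl
    refine ⟨[], by simp, ?_⟩
    funext j
    simp only [pointwise, this]
    exact optionOp_none hφ.1
  -- The empty product represents itself; with no coordinates there are no forks to realize.
  have h0 : ListRepresents φ 0 (views ([[]] : List (List A))) [[]] :=
    ⟨hT, subset_rfl, fun t ht I _ _ => ⟨t, ht, fun _ _ => rfl⟩, fun i hi => absurd hi (by omega)⟩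
  obtain ⟨h1, h2, h3⟩ := h0.foldl_extend (N := rs.sum) hbs hT hT' (by omega)
  rw [zero_add] at h1 h2
  have h4 := (h1.foldl_equate hφ eqs h3 h2.isBoundedBy).nonempty_iff
  rw [solve, Bool.not_eq_true', List.isEmpty_eq_false_iff, ← h4]
  constructor
  · rintro ⟨_, ⟨l, hl, rfl⟩, he⟩
    exact ⟨l, hl, he⟩
  · rintro ⟨l, hl, he⟩
    exact ⟨view l, ⟨l, hl, rfl⟩, he⟩

end Correctness

/-! ### Instances as products of relations with equations. -/

section Instances

variable {A : Type} {k : ℕ} {φ : (Fin k → A) → A}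

/-- The tuple `l` is a concatenation of tuples in the relations in `bs`. -/
def IsConcat : List (List (List A)) → List A → Prop
  | [], l => l = []
  | S :: bs, l => ∃ s ∈ S, ∃ l', IsConcat bs l' ∧ l = s ++ l'

theorem mem_productList {T : List (List A)} {bs : List (List (List A))} {l : List A} :
    l ∈ productList T bs ↔ ∃ t ∈ T, ∃ l', IsConcat bs l' ∧ l = t ++ l' := by
  induction bs generalizing T with
  | nil => simp [productList, IsConcat]
  | cons S bs ih =>
    rw [productList, List.foldl_cons, ← productList, ih]
    constructor
    · rintro ⟨t, ht, l', hl', rfl⟩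
      obtain ⟨t, ht', ht⟩ := List.mem_flatMap.1 ht
      obtain ⟨s, hs, rfl⟩ := List.mem_map.1 ht
      exact ⟨t, ht', s ++ l', ⟨s, hs, l', hl', rfl⟩, by simp⟩
    · rintro ⟨t, ht, _, ⟨s, hs, l', hl', rfl⟩, rfl⟩
      exact ⟨t ++ s, List.mem_flatMap.2 ⟨t, ht, List.mem_map.2 ⟨s, hs, rfl⟩⟩, l', hl', by simp⟩

theorem isConcat_append {bs bs' : List (List (List A))} {l : List A} :
    IsConcat (bs ++ bs') l ↔ ∃ l₁ l₂, IsConcat bs l₁ ∧ IsConcat bs' l₂ ∧ l = l₁ ++ l₂ := by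
  induction bs generalizing l with
  | nil => simp [IsConcat]
  | cons S bs ih =>
    simp only [List.cons_append, IsConcat, ih]
    constructor
    · rintro ⟨s, hs, _, ⟨l₁, l₂, h1, h2, rfl⟩, rfl⟩
      exact ⟨_, l₂, ⟨s, hs, l₁, h1, rfl⟩, h2, by simp⟩
    · rintro ⟨_, l₂, ⟨s, hs, l₁, h1, rfl⟩, h2, rfl⟩
      exact ⟨s, hs, _, ⟨l₁, l₂, h1, h2, rfl⟩, by simp⟩

/-- The scope and the tuples of a constraint as lists. -/
def Constraint.toLists {n : ℕ} (C : Constraint A n) : List ℕ × List (List A) :=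
  ((List.ofFn C.scope).map Fin.val, C.tuples.map List.ofFn)

/-- The scopes of some constraints, one after the other. -/
def scopes {n : ℕ} (cs : List (Constraint A n)) : List (Fin n) :=
  cs.flatMap fun C => List.ofFn C.scope

theorem isConcat_map_scopes {n : ℕ} (cs : List (Constraint A n)) (s : Fin n → A) :
    IsConcat (cs.map fun C => C.toLists.2) ((scopes cs).map s) ↔
      ∀ C ∈ cs, (fun j => s (C.scope j)) ∈ C.tuples := by
  induction cs with
  | nil => simp [IsConcat, scopes]
  | cons C cs ih =>
    have e : (scopes (C :: cs)).map s =
        List.ofFn (fun j => s (C.scope j)) ++ (scopes cs).map s := by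
      simp [scopes, List.map_ofFn, Function.comp_def]
    rw [List.forall_mem_cons, ← ih, e]
    simp only [List.map_cons, IsConcat, Constraint.toLists]
    constructor
    · rintro ⟨u, hu, l', hl', h⟩
      obtain ⟨t, ht, rfl⟩ := List.mem_map.1 hu
      obtain ⟨h1, h2⟩ := List.append_inj h (by simp)
      rw [List.ofFn_injective h1, h2]
      exact ⟨ht, hl'⟩
    · rintro ⟨h1, h2⟩
      exact ⟨_, List.mem_map_of_mem h1, _, h2, rfl⟩

theorem length_of_isConcat {n : ℕ} (cs : List (Constraint A n)) {l : List A}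
    (h : IsConcat (cs.map fun C => C.toLists.2) l) : l.length = (scopes cs).length := by
  induction cs generalizing l with
  | nil => simp only [List.map_nil, IsConcat] at h; subst h; rfl
  | cons C cs ih =>
    obtain ⟨s, hs, l', hl', rfl⟩ := h
    obtain ⟨t, -, rfl⟩ := List.mem_map.1 hs
    simp [ih hl', scopes]

theorem isClosedUnder_views_ofFn (hφ : IsGMM φ) {r : ℕ} {ts : List (Fin r → A)}
    (h : Invariant φ {t | t ∈ ts}) :
    IsClosedUnder (optionOp φ) (views (ts.map List.ofFn)) := by
  intro ws hws
  have : ∀ i, ∃ t ∈ ts, ws i = view (List.ofFn t) := fun i => by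
    obtain ⟨_, hl, e⟩ := hws i
    obtain ⟨t, ht, rfl⟩ := List.mem_map.1 hl
    exact ⟨t, ht, e⟩
  choose t ht hws using this
  refine ⟨_, List.mem_map_of_mem (h t ht), ?_⟩
  funext j
  simp only [pointwise, hws, view, List.getElem?_ofFn]
  split_ifs with hj
  · exact optionOp_some _
  · exact optionOp_none hφ.1

variable [Finite A]

theorem isConcat_full (n : ℕ) (l : List A) :
    IsConcat ((List.range n).map fun _ => (elements A).map fun a => [a]) l ↔ l.length = n := by
  rw [List.map_const', List.length_range]
  induction n generalizing l with
  | zero => simp [IsConcat]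
  | succ n ih =>
    simp only [List.replicate_succ, IsConcat, ih]
    constructor
    · rintro ⟨s, hs, l', rfl, rfl⟩
      obtain ⟨a, -, rfl⟩ := List.mem_map.1 hs
      simp
    · intro h
      obtain ⟨a, l', rfl⟩ := List.exists_cons_of_length_eq_add_one h
      exact ⟨[a], List.mem_map_of_mem (mem_elements a), l', by simpa using h, rfl⟩

theorem isClosedUnder_views_singletons (hφ : IsGMM φ) :
    IsClosedUnder (optionOp φ) (views ((elements A).map fun a => [a])) := by
  have := isClosedUnder_views_ofFn hφ (r := 1) (ts := (elements A).map fun a _ => a)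
    (fun t ht => List.mem_map.2 ⟨φ fun i => t i 0, mem_elements _, by
      funext j; rw [Fin.fin_one_eq_zero j]⟩)
  simpa [Function.comp_def] using this

/-- A tuple of the product is an arbitrary assignment followed by one tuple from each constraint
relation. The equations force these tuples to be the values of the assignment along the scopes. -/
theorem decideInstance_iff (hφ : IsGMM φ) (P : Instance A)
    (hP : ∀ C ∈ P.constraints, C.relation ∈ Inv φ) :
    decideInstance φ P.numVars (P.constraints.map Constraint.toLists) = true ↔
      P.HasSolution := by
  obtain ⟨n, cs⟩ := P
  dsimp only at hP ⊢
  have hvars : coordVars n (cs.map Constraint.toLists) =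
      List.range n ++ (scopes cs).map (Fin.val (n := n)) := by
    simp [coordVars, scopes, List.flatMap_map, List.map_flatMap, Constraint.toLists]
  have hblocks : blocks n (cs.map Constraint.toLists) =
      ((List.range n).map fun _ => (elements A).map fun a => [a]) ++
        cs.map fun C : Constraint A n => C.toLists.2 := by
    simp [blocks]
  have hlen : (coordVars n (cs.map Constraint.toLists)).length =
      (List.replicate n 1 ++ cs.map fun C : Constraint A n => C.arity).sum := by
    rw [hvars]
    simp [scopes, List.length_flatMap]
  have hclosed : List.Forall₂ (fun S r => HasLength r S ∧ IsClosedUnder (optionOp φ) (views S))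
      (blocks n (cs.map Constraint.toLists)) (List.replicate n 1 ++ cs.map fun C : Constraint A n => C.arity) := by
    rw [hblocks]
    refine List.rel_append ?_ ?_
    · rw [← List.length_range (n := n), ← List.map_const', List.length_range,
        List.forall₂_map_left_iff, List.forall₂_map_right_iff, List.forall₂_same]
      refine fun _ _ => ⟨fun t ht => ?_, isClosedUnder_views_singletons hφ⟩
      obtain ⟨a, -, rfl⟩ := List.mem_map.1 ht
      rfl
    · rw [List.forall₂_map_left_iff, List.forall₂_map_right_iff, List.forall₂_same]
      refine fun C hC => ⟨?_, isClosedUnder_views_ofFn hφ (hP C hC)⟩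
      intro t ht
      obtain ⟨t, -, rfl⟩ := List.mem_map.1 ht
      simp
  rw [decideInstance, hlen, solve_iff hφ hclosed]
  have hsol : Instance.HasSolution ⟨n, cs⟩ ↔ ∃ s : Fin n → A, ∀ C ∈ cs, (fun j => s (C.scope j)) ∈ C.tuples :=
    Iff.rfl
  rw [hsol]
  simp only [← isConcat_map_scopes, mem_productList, hblocks, isConcat_append, isConcat_full,
    List.mem_singleton, exists_eq_left, List.nil_append]
  have heqs : ∀ l : List A, (∀ e ∈ equations (coordVars n (cs.map Constraint.toLists)),
      l[e.1]? = l[e.2]?) ↔ ∀ q i : ℕ, (coordVars n (cs.map Constraint.toLists))[q]? = some i →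
        l[i]? = l[q]? := by
    intro l
    simp only [equations, List.mem_flatMap, List.mem_range, List.mem_map, Option.mem_toList]
    constructor
    · intro h q i hq
      refine h (i, q) ⟨q, ?_, i, hq, rfl⟩
      exact (List.getElem?_eq_some_iff.1 hq).1
    · rintro h _ ⟨q, -, i, hq, rfl⟩
      exact h q i hq
  simp only [heqs]
  simp only [hvars]
  constructor
  · rintro ⟨_, ⟨_, ⟨l₁, l₂, hl₁, hl₂, rfl⟩, rfl⟩, h⟩
    refine ⟨fun i => l₁[i]'(by omega), ?_⟩
    convert hl₂ using 1
    have hl := length_of_isConcat cs hl₂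
    refine List.ext_getElem (by simp [hl]) fun r hr hr' => ?_
    simp only [List.length_map] at hr
    -- Coordinate `n + r` belongs to the `r`-th entry of the concatenated scopes, after the `n`
    -- coordinates of the variables.
    have := h (n + r) (scopes cs)[r] (by simp [hr])
    rw [List.getElem?_append_left (by omega), List.getElem?_append_right (by omega)] at this
    simp only [hl₁, Nat.add_sub_cancel_left] at this
    rw [List.getElem?_eq_getElem hr', List.getElem?_eq_getElem (by omega)] at this
    simpa using this
  · rintro ⟨s, hs⟩
    refine ⟨_, ⟨_, ⟨List.ofFn s, _, by simp, hs, rfl⟩, rfl⟩, fun q i hq => ?_⟩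
    rcases lt_or_ge q n with hqn | hqn
    · rw [List.getElem?_append_left (by simpa using hqn), List.getElem?_range hqn] at hq
      rw [Option.some.inj hq]
    · rw [List.getElem?_append_right (by simpa using hqn)] at hq
      simp only [List.length_range, List.getElem?_map, Option.map_eq_some_iff] at hq
      obtain ⟨j, hj, rfl⟩ := hq
      rw [List.getElem?_append_left (by simp), List.getElem?_append_right (by simpa using hqn)]
      simp [hj]

end Instances

end GMMCSP

/-! ### Correctness of the parser. -/

namespace GMMCSP

variable {A : Type}

/-- Read a word from right to left. -/
def readWord (w : List (Symbol A)) (x : ParseState A) : ParseState A :=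
  w.foldr (fun s x => readSymbol x s) x

theorem readWord_append (w w' : List (Symbol A)) (x : ParseState A) :
    readWord (w ++ w') x = readWord w (readWord w' x) := List.foldr_append

theorem readWord_cons (s : Symbol A) (w : List (Symbol A)) (x : ParseState A) :
    readWord (s :: w) x = readSymbol (readWord w x) s := rfl

theorem parseWord_eq (w : List (Symbol A)) : parseWord w = readWord w (0, [], [], [], []) := by
  rw [parseWord, List.foldl_reverse, readWord]

theorem readWord_ticks (m n : ℕ) (y) :
    readWord (List.replicate m Symbol.tick) ((n, y) : ParseState A) = (n + m, y) := by
  induction m with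
  | zero => rfl
  | succ m ih => rw [List.replicate_succ, readWord_cons, ih]; rfl

theorem readWord_vals (v : List A) (n sc v' y) :
    readWord (v.map Symbol.val) ((n, sc, v', y) : ParseState A) = (n, sc, v ++ v', y) := by
  induction v with
  | nil => rfl
  | cons a v ih => rw [List.map_cons, readWord_cons, ih]; rfl

theorem readWord_tuples {r : ℕ} (T : List (Fin r → A)) (n sc ts cs) :
    readWord (T.flatMap fun t => Symbol.newTuple :: (List.ofFn t).map Symbol.val)
      ((n, sc, [], ts, cs) : ParseState A) = (n, sc, [], T.map List.ofFn ++ ts, cs) := by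
  induction T with
  | nil => rfl
  | cons t T ih =>
    rw [List.flatMap_cons, readWord_append, ih, readWord_cons, readWord_vals]
    simp [readSymbol]

theorem readWord_scope (S : List ℕ) (sc y) :
    readWord (S.flatMap fun i => Symbol.newVar :: List.replicate i Symbol.tick)
      ((0, sc, y) : ParseState A) = (0, S ++ sc, y) := by
  induction S with
  | nil => rfl
  | cons i S ih =>
    rw [List.flatMap_cons, readWord_append, ih, readWord_cons, readWord_ticks]
    simp [readSymbol]

/-- Read from right to left, every marker comes after the data it closes, and a complete constraint
leaves all partial data empty. The ticks that remain at the end count the variables. -/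
theorem readWord_constraints {m : ℕ} (L : List (Constraint A m)) (cs) :
    readWord (L.flatMap Constraint.encode) ((0, [], [], [], cs) : ParseState A) =
      (0, [], [], [], L.map Constraint.toLists ++ cs) := by
  induction L with
  | nil => rfl
  | cons C L ih =>
    rw [List.flatMap_cons, readWord_append, ih, Constraint.encode, readWord_cons,
      readWord_append, readWord_tuples, readWord_scope]
    simp [readSymbol, Constraint.toLists, ← List.map_eq_flatMap]

theorem parseWord_encode (P : Instance A) :
    parseWord P.encode = (P.numVars, [], [], [], P.constraints.map Constraint.toLists) := by
  rw [parseWord_eq, Instance.encode, readWord_append, readWord_constraints, readWord_ticks]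
  simp

end GMMCSP

theorem theorem1 {A : Type} [Finite A] {k : ℕ} (φ : (Fin k → A) → A)
    (hφ : GMMCSP.IsGMM φ) :
    GMMCSP.SolvableInPolyTime (GMMCSP.Inv φ) := by
  classical
  let _ : StackProgram.Enc A := StackProgram.Enc.ofFinite A
  refine (GMMCSP.polyTime_decideWord φ).tm2ComputableInPolyTime _ _ fun P => ?_
  rw [Bool.eq_iff_iff, decide_eq_true_iff, ← GMMCSP.decideInstance_iff hφ P.1 P.2,
    GMMCSP.decideWord, GMMCSP.parseWord_encode]
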